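/- Let $p\in(0,1)$ and $q\ge 1$. For $L\ge 3$ let $\mathbb{Z}_L=(V,E)$ be the cycle with $L$ vertices and $L$ edges, and for $A\subseteq E$ let $$\phi(A)=\frac{1}{Z}\,q^{k(A)}p^{|A|}(1-p)^{|E\setminus A|},$$ where $k(A)$ is the number of connected components of $(V,A)$ and $Z$ is the normalizing constant. For $A\subseteq E$, $e\in E$ and $u\in[0,1]$ put $$p(A,e)=\frac{\phi(A\cup e)}{\phi(A\cup e)+\phi(A\setminus e)},\qquad f(A,e,u)=\begin{cases}A\cup e,&u\le p(A,e),\\ A\setminus e,&u>p(A,e).\end{cases}$$ The FK heat-bath process is the Markov chain on the subsets of $E$ with transition matrix $P=\frac1L\sum_{e\in E}P_e$, where $P_e(A,A\cup e)=p(A,e)$, $P_e(A,A\setminus e)=1-p(A,e)$, and $P_e(A,B)=0$ for all other $B$. Its relaxation time is $t_{\mathrm{rel}}=1/(1-\lambda_2)$, where $\lambda_2$ is the second-largest eigenvalue of $P$. Let $(\mathcal{E}_t,U_t)_{t\ge1}$ be i.i.d. pairs, where $\mathcal{E}_t$ is uniform on $E$, $U_t$ is uniform on $[0,1]$, and $\mathcal{E}_t$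 and $U_t$ are independent. Let the top chain be $\top_0=E$, $\top_{t+1}=f(\top_t,\mathcal{E}_{t+1},U_{t+1})$, and the bottom chain be $\bot_0=\emptyset$, $\bot_{t+1}=f(\bot_t,\mathcal{E}_{t+1},U_{t+1})$. Let $T_L=\min\{t\ge 0:\top_t=\bot_t\}$ be the coupling time, and $W_L=\min\{t\ge1:\{\mathcal{E}_1,\dots,\mathcal{E}_t\}=E\}$ the coupon collector time. Then, for every $L\ge3$, the times $T_L$ and $W_L$ are almost surely finite and have finite second moments, and, as $L\to\infty$ with $p$ and $q$ fixed: 1. $\mathbb{E}(T_L)\sim\mathbb{E}(W_L)$. 2. $\operatorname{var}(T_L)\sim\operatorname{var}(W_L)$. 3. For each $x\in\mathbb{R}$, $$\mathbb{P}\left[T_L\le\mathbb{E}(T_L)+x\sqrt{\operatorname{var}(T_L)}\right]\to G(x):=\exp\left(-\exp\left(-\frac{\pi}{\sqrt6}\,x-\gamma\right)\right),$$ where $\gamma$ is the Euler–Mascheroni constant; $G$ is the distribution function of the Gumbel law with mean zero and unit variance. 4. $t_{\mathrm{rel}}\asymp L$, that is, there are constants $c,C>0$ with $cL\le t_{\mathrm{rel}}\le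 CL$ for all sufficiently large $L$. -/

import Mathlib

open MeasureTheory ProbabilityTheory Filter Topology
open scoped Asymptotics

/-- The edge set of a graph carries the discrete sigma-algebra. -/
instance fkMeasurableSpaceEdgeSet {V : Type*} (G : SimpleGraph V) : MeasurableSpace G.edgeSet := ⊤

instance fkDiscreteMeasurableSpaceEdgeSet {V : Type*} (G : SimpleGraph V) :
    DiscreteMeasurableSpace G.edgeSet := ⟨fun _ => trivial⟩

noncomputable section

namespace FK

section Model

variable {V : Type*} [Fintype V] [DecidableEq V] (G : SimpleGraph V) [DecidableRel G.Adj]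

/-- `k(A)`: the number of connected components of the spanning subgraph `(V, A)`. -/
def numClusters (A : Finset G.edgeSet) : ℕ :=
  Nat.card
    (SimpleGraph.fromEdgeSet (Subtype.val '' (A : Set G.edgeSet)) : SimpleGraph V).ConnectedComponent

/-- The unnormalised random-cluster weight `q ^ k(A) * p ^ |A| * (1 - p) ^ |E \ A|`. -/
def weight (p q : ℝ) (A : Finset G.edgeSet) : ℝ :=
  q ^ numClusters G A * p ^ A.card * (1 - p) ^ Aᶜ.card

/-- The partition function. -/
def partitionFunction (p q : ℝ) : ℝ := ∑ A : Finset G.edgeSet, weight G p q A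

/-- The random-cluster probability `φ(A)` of the configuration `A ⊆ E`. -/
def prob (p q : ℝ) (A : Finset G.edgeSet) : ℝ := weight G p q A / partitionFunction G p q

/-- `p(A, e) = φ(A ∪ e) / (φ(A ∪ e) + φ(A \ e))`: the conditional probability that `e` is occupied,
given the state of `A` off `e`. -/
def occProb (p q : ℝ) (A : Finset G.edgeSet) (e : G.edgeSet) : ℝ :=
  prob G p q (insert e A) / (prob G p q (insert e A) + prob G p q (A.erase e))

/-- The heat-bath transition matrix `P_e` of the edge `e`. -/
def edgeTransition (p q : ℝ) (e : G.edgeSet) : Matrix (Finset G.edgeSet) (Finset G.edgeSet) ℝ :=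
  fun A B =>
    if B = insert e A then occProb G p q A e
    else if B = A.erase e then 1 - occProb G p q A e
    else 0

/-- The transition matrix `P = (1 / m) ∑ e, P_e` of the FK heat-bath process, `m = |E|`. -/
def transition (p q : ℝ) : Matrix (Finset G.edgeSet) (Finset G.edgeSet) ℝ :=
  (1 / (Fintype.card G.edgeSet : ℝ)) • ∑ e : G.edgeSet, edgeTransition G p q e

/-- The second-largest eigenvalue `λ₂` of `P`: the largest real eigenvalue other than the top
eigenvalue `1` of the stochastic matrix `P` (which is simple, as the chain is irreducible for
`0 < p < 1` and `0 < q`). -/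
def secondEigenvalue (p q : ℝ) : ℝ :=
  sSup {l : ℝ | l ≠ 1 ∧ Module.End.HasEigenvalue (Matrix.toLin' (transition G p q)) l}

/-- The relaxation time `1 / (1 - λ₂)`. -/
def relaxationTime (p q : ℝ) : ℝ := 1 / (1 - secondEigenvalue G p q)

/-- The random mapping: `f(A, e, u) = A ∪ e` if `u ≤ p(A, e)`, and `A \ e` if `u > p(A, e)`. -/
def update (p q : ℝ) (A : Finset G.edgeSet) (e : G.edgeSet) (u : ℝ) : Finset G.edgeSet :=
  if u ≤ occProb G p q A e then insert e A else A.erase e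

/-- The chain started from `A` and driven by the updates `(e 0, u 0), (e 1, u 1), …`; the pair
`(e t, u t)` drives the step from time `t` to time `t + 1`. -/
def chain (p q : ℝ) (A : Finset G.edgeSet) (e : ℕ → G.edgeSet) (u : ℕ → ℝ) :
    ℕ → Finset G.edgeSet
  | 0 => A
  | t + 1 => update G p q (chain p q A e u t) (e t) (u t)

/-- The top chain starts with all edges occupied. -/
def topChain (p q : ℝ) (e : ℕ → G.edgeSet) (u : ℕ → ℝ) : ℕ → Finset G.edgeSet :=
  chain G p q Finset.univ e u

/-- The bottom chain starts with no edge occupied. -/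
def bottomChain (p q : ℝ) (e : ℕ → G.edgeSet) (u : ℕ → ℝ) : ℕ → Finset G.edgeSet :=
  chain G p q ∅ e u

/-- The coupling time `T`: the first time at which the top and the bottom chain agree
(`0` if they never do). -/
def couplingTime (p q : ℝ) (e : ℕ → G.edgeSet) (u : ℕ → ℝ) : ℕ :=
  sInf {t : ℕ | topChain G p q e u t = bottomChain G p q e u t}

/-- The coupon collector time `W`: the least `t ≥ 1` such that the first `t` updates visit every
edge (`0` if some edge is never visited). -/
def couponTime (e : ℕ → G.edgeSet) : ℕ :=
  sInf {t : ℕ | 1 ≤ t ∧ (Finset.range t).image e = Finset.univ}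

end Model

/-- `(𝓔 t, U t)`, `t = 0, 1, …`, is an i.i.d. sequence of pairs on the probability space `(Ω, μ)`,
where `𝓔 t` is uniform on the edges of `G`, `U t` is uniform on `[0, 1]`, and `𝓔 t` and `U t` are
independent. -/
structure IsNoise {V : Type*} (G : SimpleGraph V) {Ω : Type*} [MeasurableSpace Ω] (μ : Measure Ω)
    (𝓔 : ℕ → Ω → G.edgeSet) (U : ℕ → Ω → ℝ) : Prop where
  isProbabilityMeasure : IsProbabilityMeasure μ
  measurable_edge : ∀ t, Measurable (𝓔 t)
  measurable_unif : ∀ t, Measurable (U t)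
  hasLaw_edge : ∀ t, HasLaw (𝓔 t) (uniformOn Set.univ) μ
  hasLaw_unif : ∀ t, HasLaw (U t) (volume.restrict (Set.Icc (0 : ℝ) 1)) μ
  indep_pair : ∀ t, IndepFun (𝓔 t) (U t) μ
  indep_seq : iIndepFun (fun t ω => (𝓔 t ω, U t ω)) μ

/-- The distribution function of the Gumbel law with mean zero and unit variance. -/
def gumbelCDF (x : ℝ) : ℝ :=
  Real.exp (-Real.exp (-(Real.pi / Real.sqrt 6) * x - Real.eulerMascheroniConstant))

end FK

end

/-! On a cycle `k(A) = |E \ A|` for every `A ≠ E`, while `k(E) = 1`. Away from the full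
configuration the weight is therefore that of a product measure, and `p(A, e)` takes only two
values: `p` if all other edges are open, and `r = p / (p + q (1 - p)) ≤ p` otherwise
(`occProb_cycleGraph`). The coupling is monotone. While the top chain has two closed edges, both
chains use the same threshold `r`, so each update makes them agree on the chosen edge. Coupling thus
differs from coupon collecting only through times at which the top chain is nearly full.

An unvisited edge is still open in the top chain and closed in the bottom chain, so `T ≥ W`
(`covers_of_coalesced`). Conversely, a drift estimate for `(1/2) ^ (number of closed edges)` shows
that after a burn-in of `s = √L` steps the top chain is nearly full at a given time with probability
at most `δ`, which is smaller than any power of `1 / L`. This gives `P(T > s + m) ≤ P(W > m) + m δ`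
(`IsNoise.measureReal_not_coalesced_le`). Since `W` fluctuates on the scale `L`, the shift by `√L`
is invisible, and `T` inherits the Gumbel limit, which for `W` comes from inclusion-exclusion
(`tendsto_one_sub_couponTail`).

Moments need control of the far tail. The tail of `T` is submultiplicative, so it decays
geometrically beyond time of order `L ^ 2`. Summing `(2 t + 1) P(T > t)` gives `E T² ≤ E W² + R`
with `R` of order `L ^ (3/2) log L` (`tsum_weighted_le`). As `T ≥ W ≥ L`, also `2 L (T - W) ≤ T² -
W²`, so the means differ by at most `R / (2 L)` (`IsNoise.integral_sub_le`). The exact moments of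
`W` are harmonic sums, and its variance is asymptotic to `π² L² / 6`; the error in the variance is
negligible because `R log L / L² → 0` (`tendsto_variance`).

For the relaxation time, running two coupled copies from the states that realise the oscillation of
an eigenfunction gives `|λ| ^ t ≤ P(T > t)` for every eigenvalue `λ ≠ 1`. At a time `t` of order `L
log L` the tail is at most `exp (-t / (4 L))`, so the gap is at least of order `1 / L`. In the other
direction each `P_e` is an orthogonal projection for the stationary measure, so the centred
indicator of a single edge has Rayleigh quotient at least `1 - 1 / L` (`exists_eigenfunction`). -/

namespace FK

/-! ### Alternating binomial sums and the moments of the coupon collector -/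

/-- The alternating sum `∑ j, (-1) ^ j * C(L, j + 1) * (1 - (j + 1) / L) ^ r`, which is the
probability that `r` uniform coupons do not exhaust `L` types. -/
noncomputable def couponTail (L r : ℕ) : ℝ :=
  ∑ j ∈ Finset.range L, (-1 : ℝ) ^ j * (L.choose (j + 1)) * (1 - ((j : ℝ) + 1) / L) ^ r

/-- The harmonic number as a real number. -/
noncomputable def harm (L : ℕ) : ℝ := ∑ i ∈ Finset.range L, 1 / ((i : ℝ) + 1)

/-- The second-order harmonic number. -/
noncomputable def harmSq (L : ℕ) : ℝ := ∑ i ∈ Finset.range L, 1 / ((i : ℝ) + 1) ^ 2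

lemma sum_alternating_choose_succ (L : ℕ) :
    ∑ j ∈ Finset.range (L + 1), (-1 : ℝ) ^ j * ((L + 1).choose (j + 1)) = 1 := by
  have h := Int.alternating_sum_range_choose (n := L + 1)
  rw [Finset.sum_range_succ'] at h
  simp only [pow_succ, Nat.succ_ne_zero, if_false, pow_zero,
    Nat.choose_zero_right] at h
  have h' : ∑ j ∈ Finset.range (L + 1), (-1 : ℤ) ^ j * ((L + 1).choose (j + 1)) = 1 := by
    have : ∑ j ∈ Finset.range (L + 1), (-1 : ℤ) ^ j * -1 * ((L + 1).choose (j + 1)) =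
        - ∑ j ∈ Finset.range (L + 1), (-1 : ℤ) ^ j * ((L + 1).choose (j + 1)) := by
      rw [← Finset.sum_neg_distrib]
      exact Finset.sum_congr rfl fun j _ => by ring
    rw [this] at h
    push_cast at h
    linarith
  exact_mod_cast h'

/-- Pascal's rule together with the absorption identity `C(L, j) / (j + 1) = C(L + 1, j + 1) / (L +
1)`. Dividing the coefficients by `j + 1` becomes a summation over `L`, which is how harmonic sums
arise. -/
lemma sum_alternating_choose_step (L : ℕ) (c : ℕ → ℝ) :
    ∑ j ∈ Finset.range (L + 1), (-1 : ℝ) ^ j * ((L + 1).choose (j + 1)) * (c j / ((j : ℝ) + 1)) =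
      ∑ j ∈ Finset.range L, (-1 : ℝ) ^ j * (L.choose (j + 1)) * (c j / ((j : ℝ) + 1)) +
      (1 / ((L : ℝ) + 1)) *
        ∑ j ∈ Finset.range (L + 1), (-1 : ℝ) ^ j * ((L + 1).choose (j + 1)) * c j := by
  have h1 : ∑ j ∈ Finset.range L, (-1 : ℝ) ^ j * (L.choose (j + 1)) * (c j / ((j : ℝ) + 1)) =
      ∑ j ∈ Finset.range (L + 1), (-1 : ℝ) ^ j * (L.choose (j + 1)) * (c j / ((j : ℝ) + 1)) := by
    rw [Finset.sum_range_succ]; simp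
  rw [h1, Finset.mul_sum, ← Finset.sum_add_distrib]
  refine Finset.sum_congr rfl fun j _ => ?_
  have h2 : ((L : ℝ) + 1) * L.choose j = (L + 1).choose (j + 1) * ((j : ℝ) + 1) := by
    exact_mod_cast Nat.add_one_mul_choose_eq L j
  have h3 : ((L + 1).choose (j + 1) : ℝ) = L.choose j + L.choose (j + 1) := by
    exact_mod_cast Nat.choose_succ_succ L j
  have hL : (L : ℝ) + 1 ≠ 0 := by positivity
  have hj : (j : ℝ) + 1 ≠ 0 := by positivity
  have h4 : ((L + 1).choose (j + 1) : ℝ) / (L + 1) = L.choose j / ((j : ℝ) + 1) := by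
    rw [div_eq_div_iff hL hj, ← h2]; ring
  calc (-1 : ℝ) ^ j * ((L + 1).choose (j + 1)) * (c j / ((j : ℝ) + 1))
      = (-1 : ℝ) ^ j * (L.choose (j + 1)) * (c j / ((j : ℝ) + 1))
        + (-1 : ℝ) ^ j * (L.choose j / ((j : ℝ) + 1)) * c j := by rw [h3]; ring
    _ = _ := by rw [← h4]; ring

lemma sum_alternating_choose_div (L : ℕ) :
    ∑ j ∈ Finset.range L, (-1 : ℝ) ^ j * (L.choose (j + 1)) * (1 / ((j : ℝ) + 1)) = harm L := by
  induction L with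
  | zero => simp [harm]
  | succ L ih =>
    rw [sum_alternating_choose_step L (fun _ => 1), ih, harm, harm,
      Finset.sum_range_succ (fun i : ℕ => 1 / ((i : ℝ) + 1))]
    simp only [mul_one, sum_alternating_choose_succ]

/-- With `h = 1 / (L + 1)`, the recursion adds `h (harm L + h)`, which is the increment of `(harm ^
2 + harmSq) / 2`. -/
lemma sum_alternating_choose_div_sq (L : ℕ) :
    ∑ j ∈ Finset.range L, (-1 : ℝ) ^ j * (L.choose (j + 1)) * (1 / ((j : ℝ) + 1) ^ 2) =
      (harm L ^ 2 + harmSq L) / 2 := by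
  have key : ∀ n : ℕ, ∀ j : ℕ, (-1 : ℝ) ^ j * (n.choose (j + 1)) * (1 / ((j : ℝ) + 1) ^ 2) =
      (-1 : ℝ) ^ j * (n.choose (j + 1)) * (1 / ((j : ℝ) + 1) / ((j : ℝ) + 1)) := by
    intro n j; rw [div_div, ← sq]
  simp_rw [key]
  induction L with
  | zero => simp [harm, harmSq]
  | succ L ih =>
    rw [sum_alternating_choose_step L (fun j => 1 / ((j : ℝ) + 1)), ih,
      sum_alternating_choose_div, harm, harm, harmSq, harmSq, Finset.sum_range_succ,
      Finset.sum_range_succ]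
    have hL : (L : ℝ) + 1 ≠ 0 := by positivity
    field_simp
    ring

/-- The weight is `2 r + 1 = (r + 1) ^ 2 - r ^ 2`, so that tail sums with this weight are second
moments. -/
lemma hasSum_geometric_weighted {x : ℝ} (h0 : 0 ≤ x) (h1 : x < 1) :
    HasSum (fun r : ℕ => (2 * (r : ℝ) + 1) * x ^ r) (2 / (1 - x) ^ 2 - 1 / (1 - x)) := by
  have ha := hasSum_coe_mul_geometric_of_norm_lt_one (r := x) (by
    rw [Real.norm_eq_abs, abs_of_nonneg h0]; exact h1)
  have hb := hasSum_geometric_of_lt_one h0 h1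
  have hx : 1 - x ≠ 0 := by linarith
  convert! (ha.mul_left 2).add hb using 1
  · ext r; ring
  · field_simp; ring

lemma coupon_base_mem {L j : ℕ} (hj : j ∈ Finset.range L) :
    0 ≤ 1 - ((j : ℝ) + 1) / L ∧ 1 - ((j : ℝ) + 1) / L < 1 := by
  have hj' : j < L := Finset.mem_range.mp hj
  have hL : (0 : ℝ) < L := by exact_mod_cast (by omega : 0 < L)
  have : (j : ℝ) + 1 ≤ L := by exact_mod_cast hj'
  constructor
  · rw [sub_nonneg, div_le_one hL]; exact this
  · have : 0 < ((j : ℝ) + 1) / L := by positivity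
    linarith

lemma hasSum_couponTail (L : ℕ) : HasSum (couponTail L) (L * harm L) := by
  have h : HasSum (fun r => ∑ j ∈ Finset.range L, (-1 : ℝ) ^ j * (L.choose (j + 1)) *
      (1 - ((j : ℝ) + 1) / L) ^ r)
      (∑ j ∈ Finset.range L, (-1 : ℝ) ^ j * (L.choose (j + 1)) *
        (1 - (1 - ((j : ℝ) + 1) / L))⁻¹) :=
    hasSum_sum fun j hj =>
      (hasSum_geometric_of_lt_one (coupon_base_mem hj).1 (coupon_base_mem hj).2).mul_left _
  convert! h using 1
  rw [← sum_alternating_choose_div, Finset.mul_sum]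
  refine Finset.sum_congr rfl fun j hj => ?_
  rw [sub_sub_cancel, inv_div]; ring

lemma hasSum_mul_couponTail (L : ℕ) :
    HasSum (fun r : ℕ => (2 * (r : ℝ) + 1) * couponTail L r)
      ((L : ℝ) ^ 2 * (harm L ^ 2 + harmSq L) - L * harm L) := by
  have h : HasSum (fun r : ℕ => ∑ j ∈ Finset.range L, (-1 : ℝ) ^ j * (L.choose (j + 1)) *
      ((2 * (r : ℝ) + 1) * (1 - ((j : ℝ) + 1) / L) ^ r))
      (∑ j ∈ Finset.range L, (-1 : ℝ) ^ j * (L.choose (j + 1)) *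
        (2 / (1 - (1 - ((j : ℝ) + 1) / L)) ^ 2 - 1 / (1 - (1 - ((j : ℝ) + 1) / L)))) :=
    hasSum_sum fun j hj =>
      (hasSum_geometric_weighted (coupon_base_mem hj).1 (coupon_base_mem hj).2).mul_left _
  convert! h using 1
  · ext r
    rw [couponTail, Finset.mul_sum]
    exact Finset.sum_congr rfl fun j _ => by ring
  · have e : (L : ℝ) ^ 2 * (harm L ^ 2 + harmSq L) - L * harm L =
        2 * (L : ℝ) ^ 2 * ((harm L ^ 2 + harmSq L) / 2) - L * harm L := by ring
    rw [e, ← sum_alternating_choose_div_sq, ← sum_alternating_choose_div, Finset.mul_sum,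
      Finset.mul_sum, ← Finset.sum_sub_distrib]
    refine Finset.sum_congr rfl fun j hj => ?_
    have hL : (L : ℝ) ≠ 0 := by
      have := Finset.mem_range.mp hj
      exact_mod_cast (by omega : L ≠ 0)
    have hj : (j : ℝ) + 1 ≠ 0 := by positivity
    rw [sub_sub_cancel]
    field_simp

/-! ### Harmonic asymptotics and the Gumbel limit of the coupon collector -/

lemma harm_eq_harmonic (L : ℕ) : harm L = (harmonic L : ℝ) := by
  simp [harm, harmonic]

lemma tendsto_harm_sub_log :
    Tendsto (fun L : ℕ => harm L - Real.log L) atTop (𝓝 Real.eulerMascheroniConstant) := by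
  simp_rw [harm_eq_harmonic]
  exact Real.tendsto_harmonic_sub_log

lemma tendsto_harmSq : Tendsto harmSq atTop (𝓝 (Real.pi ^ 2 / 6)) := by
  have h := (hasSum_nat_add_iff' (f := fun n : ℕ => (1 : ℝ) / (n : ℝ) ^ 2) 1).mpr hasSum_zeta_two
  simp only [Finset.sum_range_one, Nat.cast_zero] at h
  have := h.tendsto_sum_nat
  simp only [sub_zero, Nat.cast_add, Nat.cast_one, ne_eq, OfNat.ofNat_ne_zero, not_false_eq_true,
    zero_pow, div_zero] at this
  exact this

lemma harm_le (L : ℕ) : harm L ≤ 1 + Real.log L := by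
  rw [harm_eq_harmonic]; exact harmonic_le_one_add_log L

lemma one_le_harm {L : ℕ} (hL : 1 ≤ L) : 1 ≤ harm L := by
  obtain ⟨n, rfl⟩ : ∃ n, L = n + 1 := ⟨L - 1, by omega⟩
  rw [harm, Finset.sum_range_succ']
  have : 0 ≤ ∑ k ∈ Finset.range n, 1 / (((k + 1 : ℕ) : ℝ) + 1) :=
    Finset.sum_nonneg fun _ _ => by positivity
  simpa using this

lemma one_sub_couponTail (L r : ℕ) :
    1 - couponTail L r =
      ∑ j ∈ Finset.range (L + 1), (-1 : ℝ) ^ j * (L.choose j) * (1 - (j : ℝ) / L) ^ r := by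
  rw [Finset.sum_range_succ', couponTail, sub_eq_add_neg, ← Finset.sum_neg_distrib, add_comm]
  congr 1
  · refine Finset.sum_congr rfl fun j _ => ?_
    push_cast; ring
  · simp

/-- `log (1 - j / L) = -j / L + O(1 / L ^ 2)`, and `r` is of order `L log L`, so the accumulated
error in the exponent is `O(log L / L)`. -/
lemma tendsto_one_sub_div_pow_mul_exp {r : ℕ → ℕ} {y : ℝ}
    (hr : Tendsto (fun L : ℕ => (r L : ℝ) / L - Real.log L) atTop (𝓝 y)) (j : ℕ) :
    Tendsto (fun L : ℕ => (1 - (j : ℝ) / L) ^ r L * Real.exp (j * ((r L : ℝ) / L)))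
      atTop (𝓝 1) := by
  have hlog : Tendsto (fun L : ℕ => Real.log L / (L : ℝ)) atTop (𝓝 0) :=
    (Real.isLittleO_log_id_atTop.tendsto_div_nhds_zero).comp tendsto_natCast_atTop_atTop
  have hinv : Tendsto (fun L : ℕ => (1 : ℝ) / (L : ℝ)) atTop (𝓝 0) :=
    tendsto_one_div_atTop_nhds_zero_nat
  -- the error term
  have hsmall : Tendsto (fun L : ℕ => 2 * (j : ℝ) ^ 2 *
      (((r L : ℝ) / L - Real.log L) * (1 / (L : ℝ)) + Real.log L / L)) atTop (𝓝 0) := by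
    have := ((hr.mul hinv).add hlog).const_mul (2 * (j : ℝ) ^ 2)
    simpa using this
  have hexp : Tendsto (fun L : ℕ => (r L : ℝ) * (Real.log (1 - (j : ℝ) / L) + (j : ℝ) / L))
      atTop (𝓝 0) := by
    refine squeeze_zero_norm' ?_ hsmall
    have hev : ∀ᶠ L : ℕ in atTop, 2 * j + 1 ≤ L := eventually_ge_atTop _
    filter_upwards [hev] with L hL
    have hL0 : (0 : ℝ) < L := by exact_mod_cast (by omega : 0 < L)
    have hjL : (j : ℝ) / L ≤ 1 / 2 := by
      rw [div_le_div_iff₀ hL0 two_pos]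
      have : (2 * j + 1 : ℝ) ≤ L := by exact_mod_cast hL
      linarith
    have hj0 : 0 ≤ (j : ℝ) / L := by positivity
    have hx : |(j : ℝ) / L| < 1 := by rw [abs_of_nonneg hj0]; linarith
    have hb := Real.abs_log_sub_add_sum_range_le hx 1
    simp only [Finset.sum_range_one, zero_add, pow_one, Nat.cast_zero, div_one,
      abs_of_nonneg hj0] at hb
    rw [Real.norm_eq_abs, abs_mul, Nat.abs_cast, add_comm (Real.log _)]
    have h1 : ((j : ℝ) / L) ^ (1 + 1) / (1 - (j : ℝ) / L) ≤ 2 * ((j : ℝ) / L) ^ 2 := by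
      rw [div_le_iff₀ (by linarith)]
      nlinarith [sq_nonneg ((j : ℝ) / L)]
    calc (r L : ℝ) * |(j : ℝ) / L + Real.log (1 - (j : ℝ) / L)|
        ≤ (r L : ℝ) * (2 * ((j : ℝ) / L) ^ 2) := by
          gcongr; exact hb.trans h1
      _ = _ := by field_simp; ring
  have h2 := (Real.continuous_exp.tendsto 0).comp hexp
  rw [Real.exp_zero] at h2
  refine h2.congr' ?_
  filter_upwards [eventually_ge_atTop (2 * j + 1)] with L hL
  have hL0 : (0 : ℝ) < L := by exact_mod_cast (by omega : 0 < L)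
  have hpos : 0 < 1 - (j : ℝ) / L := by
    rw [sub_pos, div_lt_one hL0]; exact_mod_cast (by omega : j < L)
  simp only [Function.comp]
  rw [mul_add, Real.exp_add, ← Real.log_pow, Real.exp_log (by positivity)]
  congr 2
  ring

/-- The coupon collector limit law. -/
lemma tendsto_one_sub_couponTail {r : ℕ → ℕ} {y : ℝ}
    (hr : Tendsto (fun L : ℕ => (r L : ℝ) / L - Real.log L) atTop (𝓝 y)) :
    Tendsto (fun L => 1 - couponTail L (r L)) atTop (𝓝 (Real.exp (-Real.exp (-y)))) := by
  -- `L exp (-r / L)` approximates the mean number of unvisited types. It tends to `exp (-y)`, and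
  -- the limit law is the Poisson probability of zero with this mean.
  have hp : Tendsto (fun L : ℕ => (L : ℝ) * Real.exp (-((r L : ℝ) / L))) atTop
      (𝓝 (Real.exp (-y))) := by
    refine ((Real.continuous_exp.tendsto _).comp hr.neg).congr' ?_
    filter_upwards [eventually_ge_atTop 1] with L hL
    have hL0 : (0 : ℝ) < L := by exact_mod_cast hL
    simp only [Function.comp]
    rw [neg_sub, sub_eq_add_neg, Real.exp_add, Real.exp_log hL0]
  have hterm : ∀ j : ℕ, Tendsto
      (fun L : ℕ => if j < L + 1 then
        (-1 : ℝ) ^ j * (L.choose j) * (1 - (j : ℝ) / L) ^ r L else 0) atTop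
      (𝓝 ((-Real.exp (-y)) ^ j / j.factorial)) := by
    intro j
    have h1 := (tendsto_choose_mul_pow_atTop (k := j) hp).mul (tendsto_one_sub_div_pow_mul_exp hr j)
    have h2 := h1.const_mul ((-1 : ℝ) ^ j)
    have e : (-1 : ℝ) ^ j * (Real.exp (-y) ^ j / j.factorial * 1) =
        (-Real.exp (-y)) ^ j / j.factorial := by
      rw [neg_pow (Real.exp (-y))]; ring
    rw [e] at h2
    refine h2.congr' ?_
    filter_upwards [eventually_ge_atTop j] with L hL
    rw [if_pos (by omega), ← Real.exp_nat_mul]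
    have : Real.exp ((j : ℝ) * -((r L : ℝ) / L)) * Real.exp (j * ((r L : ℝ) / L)) = 1 := by
      rw [← Real.exp_add]; simp
    calc _ = (-1 : ℝ) ^ j * (L.choose j) * (1 - (j : ℝ) / L) ^ r L *
        (Real.exp ((j : ℝ) * -((r L : ℝ) / L)) * Real.exp (j * ((r L : ℝ) / L))) := by ring
      _ = _ := by rw [this, mul_one]
  -- Dominating series: the `j`-th term is at most `(L exp (-r / L)) ^ j / j!`, whose base is
  -- eventually below `exp (-y) + 1`.
  have hbound : Summable (fun j : ℕ => (Real.exp (-y) + 1) ^ j / (j.factorial : ℝ)) :=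
    Real.summable_pow_div_factorial _
  have hmain := tendsto_tsum_of_dominated_convergence (𝓕 := atTop) hbound hterm ?_
  · have hexp : ∑' j : ℕ, (-Real.exp (-y)) ^ j / (j.factorial : ℝ) =
        Real.exp (-Real.exp (-y)) := by
      rw [Real.exp_eq_exp_ℝ, NormedSpace.exp_eq_tsum_div]
    rw [hexp] at hmain
    refine hmain.congr fun L => ?_
    rw [one_sub_couponTail, tsum_eq_sum (s := Finset.range (L + 1))]
    · exact Finset.sum_congr rfl fun j hj => by rw [if_pos (Finset.mem_range.mp hj)]
    · intro j hj
      rw [if_neg (by simpa using hj)]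
  · have hev : ∀ᶠ L : ℕ in atTop,
        (L : ℝ) * Real.exp (-((r L : ℝ) / L)) < Real.exp (-y) + 1 :=
      hp.eventually_lt_const (by linarith)
    filter_upwards [hev, eventually_ge_atTop 1] with L hL hL1 j
    have hL0 : (0 : ℝ) < L := by exact_mod_cast hL1
    split_ifs with hj
    · have hjL : (j : ℝ) / L ≤ 1 := by
        rw [div_le_one hL0]; exact_mod_cast (by omega : j ≤ L)
      have hbase : 0 ≤ 1 - (j : ℝ) / L := by linarith
      rw [norm_mul, norm_mul, norm_pow, norm_neg, norm_one, one_pow, one_mul, norm_pow,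
        Real.norm_eq_abs, Real.norm_eq_abs, abs_of_nonneg hbase, Nat.abs_cast]
      have hpow : (1 - (j : ℝ) / L) ^ r L ≤ Real.exp (-((r L : ℝ) / L)) ^ j := by
        calc (1 - (j : ℝ) / L) ^ r L ≤ Real.exp (-((j : ℝ) / L)) ^ r L := by
              gcongr
              have := Real.add_one_le_exp (-((j : ℝ) / L))
              linarith
          _ = _ := by
              rw [← Real.exp_nat_mul, ← Real.exp_nat_mul]; congr 1; ring
      calc (L.choose j : ℝ) * (1 - (j : ℝ) / L) ^ r L
          ≤ ((L : ℝ) ^ j / j.factorial) * Real.exp (-((r L : ℝ) / L)) ^ j := by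
            gcongr
            exact Nat.choose_le_pow_div j L
        _ = ((L : ℝ) * Real.exp (-((r L : ℝ) / L))) ^ j / j.factorial := by
            rw [mul_pow]; ring
        _ ≤ _ := by gcongr
    · simp only [norm_zero]; positivity

/-! ### Clusters of a subgraph of the cycle -/

section CycleClusters

variable {n : ℕ}

/-- The edge of the cycle that joins `i` to `i + 1`. -/
def cycleEdge (i : Fin (n + 3)) : (SimpleGraph.cycleGraph (n + 3)).edgeSet :=
  ⟨s(i, i + 1), by
    rw [SimpleGraph.mem_edgeSet, SimpleGraph.cycleGraph_adj (n := n + 1)]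
    right; simp⟩

lemma cycleEdge_injective : Function.Injective (cycleEdge (n := n)) := by
  intro i j h
  have h' : s(i, i + 1) = s(j, j + 1) := congrArg Subtype.val h
  rw [Sym2.eq_iff] at h'
  rcases h' with ⟨h1, _⟩ | ⟨h1, h2⟩
  · exact h1
  · exfalso
    rw [h1, add_assoc] at h2
    have h3 : (1 + 1 : Fin (n + 3)) = 0 := by simpa using h2
    have h4 := congrArg Fin.val h3
    rw [Fin.val_add, Fin.val_one, Nat.mod_eq_of_lt (by omega)] at h4
    simp at h4

lemma cycleEdge_surjective : Function.Surjective (cycleEdge (n := n)) := by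
  rintro ⟨e, he⟩
  induction e using Sym2.ind with
  | _ x y =>
    rw [SimpleGraph.mem_edgeSet, SimpleGraph.cycleGraph_adj (n := n + 1)] at he
    rcases he with h | h
    · refine ⟨y, Subtype.ext ?_⟩
      have : y + 1 = x := by rw [← h]; abel
      simp only [cycleEdge, this]
      exact Sym2.eq_swap
    · refine ⟨x, Subtype.ext ?_⟩
      have : x + 1 = y := by rw [← h]; abel
      simp only [cycleEdge, this]

/-- The edges of the cycle are indexed by the vertices. -/
noncomputable def cycleEdgeEquiv : Fin (n + 3) ≃ (SimpleGraph.cycleGraph (n + 3)).edgeSet :=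
  Equiv.ofBijective cycleEdge ⟨cycleEdge_injective, cycleEdge_surjective⟩

/-- The spanning subgraph `(V, A)` of the cycle. -/
abbrev openGraph (A : Finset (SimpleGraph.cycleGraph (n + 3)).edgeSet) :
    SimpleGraph (Fin (n + 3)) :=
  SimpleGraph.fromEdgeSet
    (Subtype.val '' (A : Set (SimpleGraph.cycleGraph (n + 3)).edgeSet))

variable (A : Finset (SimpleGraph.cycleGraph (n + 3)).edgeSet)

lemma openGraph_adj_succ {i : Fin (n + 3)} (h : cycleEdge i ∈ A) :
    (openGraph A).Adj i (i + 1) := by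
  rw [SimpleGraph.fromEdgeSet_adj]
  exact ⟨⟨cycleEdge i, h, rfl⟩, by simp⟩

lemma openGraph_adj_cases {x y : Fin (n + 3)} (h : (openGraph A).Adj x y) :
    (y = x + 1 ∧ cycleEdge x ∈ A) ∨ (x = y + 1 ∧ cycleEdge y ∈ A) := by
  rw [SimpleGraph.fromEdgeSet_adj] at h
  obtain ⟨⟨e, he, hxy⟩, -⟩ := h
  obtain ⟨i, rfl⟩ := cycleEdge_surjective e
  have h' : s(i, i + 1) = s(x, y) := hxy
  rw [Sym2.eq_iff] at h'
  rcases h' with ⟨rfl, rfl⟩ | ⟨rfl, rfl⟩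
  · exact Or.inl ⟨rfl, he⟩
  · exact Or.inr ⟨rfl, he⟩

/-- Going round the cycle from `x` along open edges, the walk stops at a closed edge, at the latest
at `i`. The induction is on the number of steps from `x` to `i`. -/
lemma exists_closed_reachable {i : Fin (n + 3)} (hi : cycleEdge i ∉ A) (d : ℕ) :
    ∀ x : Fin (n + 3), (i - x).val = d →
      ∃ j, cycleEdge j ∉ A ∧ (openGraph A).Reachable j x := by
  induction d with
  | zero =>
    intro x hx
    refine ⟨x, ?_, SimpleGraph.Reachable.refl _⟩
    have : i - x = 0 := Fin.ext hx
    rwa [← sub_eq_zero.mp this]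
  | succ d ih =>
    intro x hx
    by_cases hxA : cycleEdge x ∈ A
    · obtain ⟨j, hj, hr⟩ := ih (x + 1) (by
        -- The distance to `i` drops by one unless it wraps around, which would mean `x = i`, whose
        -- edge is closed.
        have hne : i - (x + 1) ≠ Fin.last (n + 2) := by
          intro h
          have h1 : i - (x + 1) + 1 = 0 := by rw [h]; exact Fin.last_add_one _
          have h2 : i - x = 0 := by rw [← h1]; abel
          exact hi (sub_eq_zero.mp h2 ▸ hxA)
        have h3 := Fin.val_add_one_of_lt (lt_of_le_of_ne (Fin.le_last _) hne)
        rw [show i - (x + 1) + 1 = i - x by abel] at h3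
        omega)
      exact ⟨j, hj, hr.trans (openGraph_adj_succ A hxA).reachable.symm⟩
    · exact ⟨x, hxA, SimpleGraph.Reachable.refl _⟩

/-- Cut the cycle just after `i`, so that `i` takes the last position. The vertices up to the
position of `j` form a set that open edges cannot leave: one exit is the closed edge at `j`, the
other is the closed edge at `i`. -/
lemma not_reachable_of_closed {i j : Fin (n + 3)} (hi : cycleEdge i ∉ A) (hj : cycleEdge j ∉ A)
    (hij : i ≠ j) : ¬ (openGraph A).Reachable j i := by
  intro hr
  let pos : Fin (n + 3) → Fin (n + 3) := fun x => x - (i + 1)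
  have pos_i : pos i = Fin.last (n + 2) := by
    have h1 : pos i + 1 = 0 := by simp [pos]
    have h2 : Fin.last (n + 2) + 1 = (0 : Fin (n + 3)) := Fin.last_add_one _
    exact add_right_cancel (h1.trans h2.symm)
  have pos_inj : ∀ x y, pos x = pos y → x = y := fun x y h => sub_left_injective h
  have pos_lt : ∀ x, x ≠ i → pos x < Fin.last (n + 2) := fun x hx =>
    lt_of_le_of_ne (Fin.le_last _) fun h => hx (pos_inj _ _ (h.trans pos_i.symm))
  have pos_succ : ∀ x, x ≠ i → (pos (x + 1)).val = (pos x).val + 1 := by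
    intro x hx
    have : pos (x + 1) = pos x + 1 := by simp only [pos]; abel
    rw [this]
    exact Fin.val_add_one_of_lt (pos_lt x hx)
  have closed : ∀ x y, (openGraph A).Adj x y → (pos x).val ≤ (pos j).val →
      (pos y).val ≤ (pos j).val := by
    intro x y hxy hx
    rcases openGraph_adj_cases A hxy with ⟨rfl, hA⟩ | ⟨rfl, hA⟩
    · have hxi : x ≠ i := fun h => hi (h ▸ hA)
      have hxj : x ≠ j := fun h => hj (h ▸ hA)
      have : (pos x).val ≠ (pos j).val := fun h => hxj (pos_inj _ _ (Fin.ext h))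
      rw [pos_succ x hxi]; omega
    · have hyi : y ≠ i := fun h => hi (h ▸ hA)
      rw [pos_succ y hyi] at hx; omega
  have walk_closed : ∀ {x y} (w : (openGraph A).Walk x y), (pos x).val ≤ (pos j).val →
      (pos y).val ≤ (pos j).val := by
    intro x y w
    induction w with
    | nil => exact id
    | cons h _ ih => exact fun hx => ih (closed _ _ h hx)
  obtain ⟨w⟩ := hr
  have h1 := walk_closed w le_rfl
  have h2 : (pos j).val < (pos i).val := by rw [pos_i]; exact pos_lt j hij.symm
  omega

/-- Each cluster is an arc with exactly one closed edge at its forward end, so closed edges and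
clusters are in bijection. -/
lemma numClusters_of_ne_univ (hA : A ≠ Finset.univ) :
    numClusters (SimpleGraph.cycleGraph (n + 3)) A = Aᶜ.card := by
  obtain ⟨e, he⟩ : ∃ e, e ∉ A := by
    by_contra! h
    exact hA (Finset.eq_univ_iff_forall.mpr h)
  obtain ⟨i, rfl⟩ := cycleEdge_surjective e
  have hbij : Function.Bijective
      (fun j : {j : Fin (n + 3) // cycleEdge j ∉ A} => (openGraph A).connectedComponentMk j) := by
    constructor
    · rintro ⟨a, ha⟩ ⟨b, hb⟩ h
      by_contra hab
      exact not_reachable_of_closed A ha hb (fun h' => hab (Subtype.ext h'))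
        (SimpleGraph.ConnectedComponent.exact h.symm)
    · intro c
      induction c using SimpleGraph.ConnectedComponent.ind with
      | _ x =>
        obtain ⟨j, hj, hr⟩ := exists_closed_reachable A he (i - x).val x rfl
        exact ⟨⟨j, hj⟩, SimpleGraph.ConnectedComponent.sound hr⟩
  have h2 : Nat.card {j : Fin (n + 3) // cycleEdge j ∉ A} = Aᶜ.card := by
    rw [Nat.card_congr (cycleEdgeEquiv.subtypeEquiv (q := fun e => e ∈ Aᶜ) fun j => by
      rw [Finset.mem_compl]; rfl), Nat.card_eq_fintype_card, Fintype.card_coe]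
  rw [numClusters, ← Nat.card_eq_of_bijective _ hbij, h2]

/-- The only configuration for which the count of closed edges is wrong; all the interaction of the
model comes from it. -/
lemma numClusters_univ :
    numClusters (SimpleGraph.cycleGraph (n + 3)) Finset.univ = 1 := by
  have h : SimpleGraph.fromEdgeSet (Subtype.val ''
      ((Finset.univ : Finset (SimpleGraph.cycleGraph (n + 3)).edgeSet) :
        Set (SimpleGraph.cycleGraph (n + 3)).edgeSet)) = SimpleGraph.cycleGraph (n + 3) := by
    simp
  have hc : (SimpleGraph.cycleGraph (n + 3)).Connected := SimpleGraph.cycleGraph_connected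
  rw [numClusters, h, Nat.card_eq_one_iff_unique]
  exact ⟨hc.preconnected.subsingleton_connectedComponent,
    ⟨(SimpleGraph.cycleGraph (n + 3)).connectedComponentMk 0⟩⟩

lemma card_cycle_edgeSet : Fintype.card (SimpleGraph.cycleGraph (n + 3)).edgeSet = n + 3 := by
  rw [← Fintype.card_congr (cycleEdgeEquiv (n := n)), Fintype.card_fin]

end CycleClusters

/-! ### Conditional occupation probabilities -/

section Weights

variable {V : Type*} [Fintype V] [DecidableEq V] (G : SimpleGraph V) [DecidableRel G.Adj]
  {p q : ℝ}

lemma weight_pos (hp : p ∈ Set.Ioo (0 : ℝ) 1) (hq : 0 < q) (A : Finset G.edgeSet) :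
    0 < weight G p q A := by
  have h1 : 0 < 1 - p := sub_pos.mpr hp.2
  have h0 := hp.1
  unfold weight
  positivity

lemma partitionFunction_pos (hp : p ∈ Set.Ioo (0 : ℝ) 1) (hq : 0 < q) :
    0 < partitionFunction G p q :=
  Finset.sum_pos (fun A _ => weight_pos G hp hq A) Finset.univ_nonempty

lemma prob_pos (hp : p ∈ Set.Ioo (0 : ℝ) 1) (hq : 0 < q) (A : Finset G.edgeSet) :
    0 < prob G p q A :=
  div_pos (weight_pos G hp hq A) (partitionFunction_pos G hp hq)

lemma occProb_eq_of_numClusters (hp : p ∈ Set.Ioo (0 : ℝ) 1) (hq : 0 < q) (A : Finset G.edgeSet)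
    (e : G.edgeSet) (d : ℕ)
    (h : numClusters G (A.erase e) = numClusters G (insert e A) + d) :
    occProb G p q A e = p / (p + q ^ d * (1 - p)) := by
  have h1 : 0 < 1 - p := sub_pos.mpr hp.2
  have h0 := hp.1
  have hZ := partitionFunction_pos G hp hq
  have hins : insert e A = insert e (A.erase e) := by
    ext x; by_cases hx : x = e <;> simp [hx]
  have hc1 : (insert e A).card = (A.erase e).card + 1 := by
    rw [hins, Finset.card_insert_of_notMem (Finset.notMem_erase e A)]
  have hc2 : (A.erase e)ᶜ.card = (insert e A)ᶜ.card + 1 := by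
    have := Finset.card_add_card_compl (A.erase e)
    have := Finset.card_add_card_compl (insert e A)
    omega
  have hw := weight_pos G hp hq (insert e A)
  have hww : weight G p q (A.erase e) * p = weight G p q (insert e A) * (q ^ d * (1 - p)) := by
    simp only [weight, h, hc1, hc2]
    ring
  have hw2 : weight G p q (A.erase e) = weight G p q (insert e A) * (q ^ d * (1 - p)) / p := by
    rw [← hww]; field_simp
  have hpos : 0 < p + q ^ d * (1 - p) := by positivity
  simp only [occProb, prob]
  rw [hw2]
  field_simp

end Weights

/-- The occupation probability of an edge whose end points are not joined by other open edges. -/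
noncomputable def bridgeProb (p q : ℝ) : ℝ := p / (p + q * (1 - p))

lemma bridgeProb_pos {p q : ℝ} (hp : p ∈ Set.Ioo (0 : ℝ) 1) (hq : 1 ≤ q) : 0 < bridgeProb p q := by
  have h1 : 0 < 1 - p := sub_pos.mpr hp.2
  have h0 := hp.1
  unfold bridgeProb
  positivity

lemma bridgeProb_le {p q : ℝ} (hp : p ∈ Set.Ioo (0 : ℝ) 1) (hq : 1 ≤ q) : bridgeProb p q ≤ p := by
  have h1 : 0 < 1 - p := sub_pos.mpr hp.2
  have h0 := hp.1
  unfold bridgeProb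
  rw [div_le_iff₀ (by positivity)]
  nlinarith [mul_nonneg (sub_nonneg.mpr hq) h1.le, mul_pos h0 h1]

/-- Closing `e` creates one new cluster, which costs a factor `q`, except when all other edges are
open: then there is one cluster before and after, and `q` drops out. -/
lemma occProb_cycleGraph {p q : ℝ} (hp : p ∈ Set.Ioo (0 : ℝ) 1) (hq : 1 ≤ q) {L : ℕ} (hL : 3 ≤ L)
    (A : Finset (SimpleGraph.cycleGraph L).edgeSet) (e : (SimpleGraph.cycleGraph L).edgeSet) :
    occProb (SimpleGraph.cycleGraph L) p q A e =
      if insert e A = Finset.univ then p else bridgeProb p q := by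
  obtain ⟨n, rfl⟩ : ∃ n, L = n + 3 := ⟨L - 3, by omega⟩
  have hne : A.erase e ≠ Finset.univ := fun h =>
    Finset.notMem_erase e A (h ▸ Finset.mem_univ e)
  have hc : (A.erase e)ᶜ.card = (insert e A)ᶜ.card + 1 := by
    have h1 := Finset.card_add_card_compl (A.erase e)
    have h2 := Finset.card_add_card_compl (insert e A)
    have h3 : (insert e A).card = (A.erase e).card + 1 := by
      rw [show insert e A = insert e (A.erase e) by ext x; by_cases hx : x = e <;> simp [hx],
        Finset.card_insert_of_notMem (Finset.notMem_erase e A)]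
    omega
  have hq0 : 0 < q := by linarith
  split_ifs with h
  · rw [occProb_eq_of_numClusters _ hp hq0 A e 0]
    · simp
    · rw [numClusters_of_ne_univ _ hne, hc, h, numClusters_univ]; simp
  · rw [occProb_eq_of_numClusters _ hp hq0 A e 1]
    · rw [pow_one, bridgeProb]
    · rw [numClusters_of_ne_univ _ hne, hc, numClusters_of_ne_univ _ h]

/-! ### The monotone coupling and its comparison with coupon collecting -/

section Dynamics

variable {V : Type*} [Fintype V] [DecidableEq V] (G : SimpleGraph V) [DecidableRel G.Adj]

/-- The conditional occupation probabilities take the value `p` when all other edges are open and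
a value `r ≤ p` otherwise. -/
structure IsTwoLevel (p q r : ℝ) : Prop where
  pos : 0 < r
  le : r ≤ p
  lt_one : p < 1
  occProb_eq : ∀ (A : Finset G.edgeSet) (e : G.edgeSet),
    occProb G p q A e = if insert e A = Finset.univ then p else r

lemma isTwoLevel_cycleGraph {p q : ℝ} (hp : p ∈ Set.Ioo (0 : ℝ) 1) (hq : 1 ≤ q) {L : ℕ}
    (hL : 3 ≤ L) : IsTwoLevel (SimpleGraph.cycleGraph L) p q (bridgeProb p q) :=
  ⟨bridgeProb_pos hp hq, bridgeProb_le hp hq, hp.2, occProb_cycleGraph hp hq hL⟩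

/-- The first `t` terms of `e` visit every edge. -/
def Covers {E : Type*} [Fintype E] [DecidableEq E] (e : ℕ → E) (t : ℕ) : Prop :=
  (Finset.range t).image e = Finset.univ

lemma covers_iff {E : Type*} [Fintype E] [DecidableEq E] {e : ℕ → E} {t : ℕ} :
    Covers e t ↔ ∀ x, ∃ i < t, e i = x := by
  simp [Covers, Finset.eq_univ_iff_forall]

lemma Covers.mono {E : Type*} [Fintype E] [DecidableEq E] {e : ℕ → E} {s t : ℕ} (hst : s ≤ t)
    (h : Covers e s) : Covers e t := by
  rw [covers_iff] at h ⊢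
  intro x
  obtain ⟨i, hi, hx⟩ := h x
  exact ⟨i, hi.trans_le hst, hx⟩

lemma not_covers_zero {E : Type*} [Fintype E] [DecidableEq E] [Nonempty E] (e : ℕ → E) :
    ¬ Covers e 0 := by
  rw [covers_iff]
  intro h
  obtain ⟨i, hi, -⟩ := h (Classical.arbitrary E)
  omega

lemma card_le_of_covers {E : Type*} [Fintype E] [DecidableEq E] {e : ℕ → E} {t : ℕ}
    (h : Covers e t) : Fintype.card E ≤ t := by
  have := Finset.card_image_le (s := Finset.range t) (f := e)
  rw [h, Finset.card_range, Finset.card_univ] at this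
  exact this

lemma couponTime_eq {V : Type*} [Fintype V] [DecidableEq V] (G : SimpleGraph V)
    [DecidableRel G.Adj] [Nonempty G.edgeSet] (e : ℕ → G.edgeSet) :
    couponTime G e = sInf {t | Covers e t} := by
  rw [couponTime]
  congr 1
  ext t
  simp only [Set.mem_ofPred_eq, Covers]
  refine ⟨fun h => h.2, fun h => ⟨?_, h⟩⟩
  by_contra! h0
  have : t = 0 := by omega
  subst this
  exact not_covers_zero e h

variable {G} {p q r : ℝ}

lemma chain_congr (A : Finset G.edgeSet) {e e' : ℕ → G.edgeSet} {u u' : ℕ → ℝ} {t : ℕ}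
    (h : ∀ i < t, e i = e' i ∧ u i = u' i) : chain G p q A e u t = chain G p q A e' u' t := by
  induction t with
  | zero => rfl
  | succ t ih =>
    rw [chain, chain, ih fun i hi => h i (by omega), (h t (by omega)).1, (h t (by omega)).2]

lemma chain_add (A : Finset G.edgeSet) (e : ℕ → G.edgeSet) (u : ℕ → ℝ) (s t : ℕ) :
    chain G p q A e u (s + t) =
      chain G p q (chain G p q A e u s) (fun i => e (s + i)) (fun i => u (s + i)) t := by
  induction t with
  | zero => rfl
  | succ t ih => rw [← add_assoc, chain, ih, chain]

lemma mem_update {A : Finset G.edgeSet} {e x : G.edgeSet} {u : ℝ} :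
    x ∈ update G p q A e u ↔ (x = e ∧ u ≤ occProb G p q A e) ∨ (x ≠ e ∧ x ∈ A) := by
  rw [update]
  split_ifs with h <;> by_cases hx : x = e <;> simp [hx, h]

/-- Only completing the cycle changes the value, and it raises it because `r ≤ p`; for the cycle
this is where `q ≥ 1`, rather than `q > 0`, is needed. -/
lemma IsTwoLevel.occProb_mono (H : IsTwoLevel G p q r) {A B : Finset G.edgeSet} (hAB : A ⊆ B)
    (e : G.edgeSet) : occProb G p q A e ≤ occProb G p q B e := by
  rw [H.occProb_eq, H.occProb_eq]
  split_ifs with h1 h2 h2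
  · exact le_rfl
  · exact absurd (Finset.univ_subset_iff.mp (h1 ▸ Finset.insert_subset_insert e hAB)) h2
  · exact H.le
  · exact le_rfl

lemma IsTwoLevel.update_mono (H : IsTwoLevel G p q r) {A B : Finset G.edgeSet} (hAB : A ⊆ B)
    (e : G.edgeSet) (u : ℝ) : update G p q A e u ⊆ update G p q B e u := by
  intro x hx
  rw [mem_update] at hx ⊢
  rcases hx with ⟨h1, h2⟩ | ⟨h1, h2⟩
  · exact Or.inl ⟨h1, h2.trans (H.occProb_mono hAB e)⟩
  · exact Or.inr ⟨h1, hAB h2⟩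

lemma IsTwoLevel.chain_mono (H : IsTwoLevel G p q r) {A B : Finset G.edgeSet} (hAB : A ⊆ B)
    (e : ℕ → G.edgeSet) (u : ℕ → ℝ) (t : ℕ) : chain G p q A e u t ⊆ chain G p q B e u t := by
  induction t with
  | zero => exact hAB
  | succ t ih => exact H.update_mono ih _ _

/-- The chains from all starting configurations agree once the top and the bottom chain do. -/
lemma IsTwoLevel.chain_eq_bottomChain (H : IsTwoLevel G p q r) {e : ℕ → G.edgeSet} {u : ℕ → ℝ}
    {t : ℕ} (h : topChain G p q e u t = bottomChain G p q e u t) (A : Finset G.edgeSet) :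
    chain G p q A e u t = bottomChain G p q e u t :=
  Finset.Subset.antisymm (h ▸ H.chain_mono (Finset.subset_univ A) e u t)
    (H.chain_mono (Finset.empty_subset A) e u t)

lemma coalesced_mono {e : ℕ → G.edgeSet} {u : ℕ → ℝ} {s t : ℕ} (hst : s ≤ t)
    (h : topChain G p q e u s = bottomChain G p q e u s) :
    topChain G p q e u t = bottomChain G p q e u t := by
  obtain ⟨d, rfl⟩ := Nat.exists_eq_add_of_le hst
  rw [topChain, bottomChain] at h ⊢
  rw [chain_add, chain_add, h]

/-- A block that merges the extreme starting states merges all of them, in particular the states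
that the two chains have reached at time `s`. This makes the tail of the coupling time
submultiplicative. -/
lemma IsTwoLevel.coalesced_of_shift (H : IsTwoLevel G p q r) {e : ℕ → G.edgeSet} {u : ℕ → ℝ}
    {s t : ℕ}
    (h : topChain G p q (fun i => e (s + i)) (fun i => u (s + i)) t =
      bottomChain G p q (fun i => e (s + i)) (fun i => u (s + i)) t) :
    topChain G p q e u (s + t) = bottomChain G p q e u (s + t) := by
  rw [topChain, bottomChain, chain_add, chain_add, H.chain_eq_bottomChain h,
    H.chain_eq_bottomChain h]

/-- An edge that is never updated keeps its initial state, which is open in one chain and closed in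
the other. -/
lemma covers_of_coalesced {e : ℕ → G.edgeSet} {u : ℕ → ℝ} {t : ℕ}
    (h : topChain G p q e u t = bottomChain G p q e u t) : Covers e t := by
  rw [covers_iff]
  intro x
  by_contra! hx
  have key : ∀ A : Finset G.edgeSet, ∀ s ≤ t, (x ∈ chain G p q A e u s ↔ x ∈ A) := by
    intro A s hs
    induction s with
    | zero => rfl
    | succ s ih =>
      rw [chain, mem_update, ih (by omega)]
      have := (hx s (by omega)).symm
      simp [this]
  have h1 := (key Finset.univ t le_rfl).mpr (Finset.mem_univ x)
  have h2 := (key ∅ t le_rfl).not.mpr (Finset.notMem_empty x)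
  rw [topChain, bottomChain] at h
  exact h2 (h ▸ h1)

lemma insert_ne_univ_of_two_le {A : Finset G.edgeSet} (hA : 2 ≤ Aᶜ.card) (e : G.edgeSet) :
    insert e A ≠ Finset.univ := by
  intro h
  have h1 : Aᶜ ⊆ {e} := by
    intro x hx
    have : x ∈ insert e A := h ▸ Finset.mem_univ x
    rw [Finset.mem_compl] at hx
    rw [Finset.mem_insert] at this
    simpa using this.resolve_right hx
  have := Finset.card_le_card h1
  rw [Finset.card_singleton] at this
  omega

/-- While the top chain misses two edges, each update makes the two chains agree on the updated
edge. -/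
lemma IsTwoLevel.coalesced_of_covers (H : IsTwoLevel G p q r) {e : ℕ → G.edgeSet} {u : ℕ → ℝ}
    {s m : ℕ} (hgood : ∀ i < m, 2 ≤ (topChain G p q e u (s + i))ᶜ.card)
    (hcov : Covers (fun i => e (s + i)) m) :
    topChain G p q e u (s + m) = bottomChain G p q e u (s + m) := by
  have key : ∀ j ≤ m, ∀ x, (∃ i < j, e (s + i) = x) →
      (x ∈ topChain G p q e u (s + j) ↔ x ∈ bottomChain G p q e u (s + j)) := by
    intro j hj
    induction j with
    | zero => rintro x ⟨i, hi, -⟩; omega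
    | succ j ih =>
      rintro x ⟨i, hi, hx⟩
      -- The bottom chain lies below the top chain, so it misses two edges as well, and both chains
      -- compare `u` with the same `r`. Agreement on an edge, once reached, therefore persists.
      have hsub : bottomChain G p q e u (s + j) ⊆ topChain G p q e u (s + j) :=
        H.chain_mono (Finset.empty_subset _) e u (s + j)
      have htop := hgood j (by omega)
      have hbot : 2 ≤ (bottomChain G p q e u (s + j))ᶜ.card :=
        htop.trans (Finset.card_le_card (Finset.compl_subset_compl.mpr hsub))
      rw [← add_assoc]
      change x ∈ update G p q (topChain G p q e u (s + j)) (e (s + j)) (u (s + j)) ↔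
        x ∈ update G p q (bottomChain G p q e u (s + j)) (e (s + j)) (u (s + j))
      rw [mem_update, mem_update, H.occProb_eq, H.occProb_eq,
        if_neg (insert_ne_univ_of_two_le htop _), if_neg (insert_ne_univ_of_two_le hbot _)]
      by_cases hxe : x = e (s + j)
      · simp [hxe]
      · have hij : i < j := by
          rcases Nat.lt_succ_iff_lt_or_eq.mp hi with h | h
          · exact h
          · exact absurd (h ▸ hx.symm) hxe
        simp [hxe, ih (by omega) x ⟨i, hij, hx⟩]
  rw [covers_iff] at hcov
  ext x
  exact key m le_rfl x (hcov x)

end Dynamics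

/-! ### Drift of the number of closed edges -/

section Operator

variable {V : Type*} [Fintype V] [DecidableEq V] {G : SimpleGraph V} [DecidableRel G.Adj]
  {p q r : ℝ}

lemma edgeTransition_mulVec (e : G.edgeSet) (f : Finset G.edgeSet → ℝ) (A : Finset G.edgeSet) :
    (edgeTransition G p q e).mulVec f A =
      occProb G p q A e * f (insert e A) + (1 - occProb G p q A e) * f (A.erase e) := by
  have hne : A.erase e ≠ insert e A := fun h =>
    Finset.notMem_erase e A (h ▸ Finset.mem_insert_self e A)
  rw [Matrix.mulVec, dotProduct, ← Finset.sum_subset (Finset.subset_univ {insert e A, A.erase e}),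
    Finset.sum_pair hne.symm]
  · simp [edgeTransition, hne]
  · intro B _ hB
    simp only [Finset.mem_insert, Finset.mem_singleton, not_or] at hB
    simp [edgeTransition, hB.1, hB.2]

lemma transition_mulVec (f : Finset G.edgeSet → ℝ) (A : Finset G.edgeSet) :
    (transition G p q).mulVec f A = (1 / (Fintype.card G.edgeSet : ℝ)) * ∑ e : G.edgeSet,
      (occProb G p q A e * f (insert e A) + (1 - occProb G p q A e) * f (A.erase e)) := by
  rw [transition, Matrix.smul_mulVec, Matrix.sum_mulVec, Pi.smul_apply, Finset.sum_apply,
    smul_eq_mul]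
  simp only [edgeTransition_mulVec]

lemma IsTwoLevel.occProb_mem (H : IsTwoLevel G p q r) (A : Finset G.edgeSet) (e : G.edgeSet) :
    0 < occProb G p q A e ∧ occProb G p q A e ≤ p := by
  rw [H.occProb_eq]
  split_ifs
  · exact ⟨H.pos.trans_le H.le, le_rfl⟩
  · exact ⟨H.pos, H.le⟩

/-- Exponential moment of the number of closed edges after one step. -/
lemma IsTwoLevel.transition_half_pow_le (H : IsTwoLevel G p q r) [Nonempty G.edgeSet]
    (A : Finset G.edgeSet) :
    (transition G p q).mulVec (fun B => (1 / 2 : ℝ) ^ Bᶜ.card) A ≤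
      (1 + p) / 2 * (1 + (Aᶜ.card : ℝ) / Fintype.card G.edgeSet) * (1 / 2) ^ Aᶜ.card := by
  rw [transition_mulVec]
  have hm : (0 : ℝ) < Fintype.card G.edgeSet := by exact_mod_cast Fintype.card_pos
  set g : ℝ := (1 / 2) ^ Aᶜ.card with hg
  have hg0 : 0 < g := by positivity
  have hp0 : 0 < p := H.pos.trans_le H.le
  -- Write `a` for the occupation probability, `a ≤ p`. An open edge contributes `a g + (1 - a) g /
  -- 2 = (1 + a) g / 2`, a closed one `2 a g + (1 - a) g = (1 + a) g`.
  have hterm : ∀ e : G.edgeSet,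
      occProb G p q A e * (1 / 2 : ℝ) ^ (insert e A)ᶜ.card +
        (1 - occProb G p q A e) * (1 / 2 : ℝ) ^ (A.erase e)ᶜ.card ≤
      (1 + p) / 2 * g + if e ∈ Aᶜ then (1 + p) / 2 * g else 0 := by
    intro e
    obtain ⟨h0, h1⟩ := H.occProb_mem A e
    by_cases he : e ∈ A
    · have hc : (A.erase e)ᶜ.card = Aᶜ.card + 1 := by
        rw [Finset.compl_erase, Finset.card_insert_of_notMem (by simpa using he)]
      rw [if_neg (by simpa using he), Finset.insert_eq_of_mem he, hc, pow_succ, ← hg]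
      nlinarith
    · have hc : Aᶜ.card = (insert e A)ᶜ.card + 1 := by
        rw [Finset.compl_insert, Finset.card_erase_add_one (by simpa using he)]
      have hg2 : (1 / 2 : ℝ) ^ (insert e A)ᶜ.card = 2 * g := by
        rw [hg, hc, pow_succ]; ring
      rw [if_pos (by simpa using he), Finset.erase_eq_of_notMem he, hg2, ← hg]
      nlinarith
  calc _ ≤ (1 / (Fintype.card G.edgeSet : ℝ)) * ∑ e : G.edgeSet,
        ((1 + p) / 2 * g + if e ∈ Aᶜ then (1 + p) / 2 * g else 0) := by
        exact mul_le_mul_of_nonneg_left (Finset.sum_le_sum fun e _ => hterm e) (by positivity)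
    _ = (1 / (Fintype.card G.edgeSet : ℝ)) *
        (Fintype.card G.edgeSet * ((1 + p) / 2 * g) + Aᶜ.card * ((1 + p) / 2 * g)) := by
        rw [Finset.sum_add_distrib, Finset.sum_ite_mem, Finset.univ_inter]
        simp
    _ = _ := by field_simp

/-- A drift bound for the number of closed edges that is uniform in the configuration. -/
lemma IsTwoLevel.transition_half_pow_drift (H : IsTwoLevel G p q r) [Nonempty G.edgeSet]
    (A : Finset G.edgeSet) :
    (transition G p q).mulVec (fun B => (1 / 2 : ℝ) ^ Bᶜ.card) A ≤
      (3 + p) / 4 * (1 / 2) ^ Aᶜ.card +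
        2 * (1 / 2 : ℝ) ^ ((1 - p) / 4 * Fintype.card G.edgeSet) := by
  have hm : (0 : ℝ) < Fintype.card G.edgeSet := by exact_mod_cast Fintype.card_pos
  have hp0 : 0 < p := H.pos.trans_le H.le
  have hp1 := H.lt_one
  refine (H.transition_half_pow_le A).trans ?_
  have hg0 : (0 : ℝ) < (1 / 2) ^ Aᶜ.card := by positivity
  have hr0 : (0 : ℝ) < (1 / 2 : ℝ) ^ ((1 - p) / 4 * Fintype.card G.edgeSet) := by positivity
  -- If the fraction of closed edges is at most `(1 - p) / 4`, the growth factor is at most `(3 + p)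
  -- / 4 < 1`. Otherwise `(1/2) ^ Aᶜ.card` is itself exponentially small in the number of edges.
  rcases le_total (Aᶜ.card : ℝ) ((1 - p) / 4 * Fintype.card G.edgeSet) with hc | hc
  · have h1 : (Aᶜ.card : ℝ) / Fintype.card G.edgeSet ≤ (1 - p) / 4 := by
      rwa [div_le_iff₀ hm]
    have h2 : (1 + p) / 2 * (1 + (Aᶜ.card : ℝ) / Fintype.card G.edgeSet) ≤ (3 + p) / 4 := by
      have : (1 + p) / 2 * (1 + (Aᶜ.card : ℝ) / Fintype.card G.edgeSet) ≤
        (1 + p) / 2 * (1 + (1 - p) / 4) := by gcongr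
      nlinarith
    have := mul_le_mul_of_nonneg_right h2 hg0.le
    linarith
  · have h1 : (Aᶜ.card : ℝ) / Fintype.card G.edgeSet ≤ 1 := by
      rw [div_le_one hm]; exact_mod_cast Finset.card_le_univ _
    have h2 : (1 / 2 : ℝ) ^ Aᶜ.card ≤ (1 / 2 : ℝ) ^ ((1 - p) / 4 * Fintype.card G.edgeSet) := by
      rw [← Real.rpow_natCast]
      exact Real.rpow_le_rpow_of_exponent_ge (by norm_num) (by norm_num) hc
    have h3 : (1 + p) / 2 * (1 + (Aᶜ.card : ℝ) / Fintype.card G.edgeSet) ≤ 2 := by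
      have h4 : 0 ≤ (Aᶜ.card : ℝ) / Fintype.card G.edgeSet := by positivity
      nlinarith
    have h5 := mul_le_mul h3 h2 hg0.le (by norm_num)
    have h6 : 0 ≤ (3 + p) / 4 * (1 / 2 : ℝ) ^ Aᶜ.card := by positivity
    linarith

end Operator
-- Independence properties of the driving noise
/-- Configurations carry the discrete sigma-algebra. -/
instance configurationMeasurableSpace {V : Type*} (G : SimpleGraph V) :
    MeasurableSpace (Finset G.edgeSet) := ⊤

instance configurationDiscrete {V : Type*} (G : SimpleGraph V) :
    DiscreteMeasurableSpace (Finset G.edgeSet) := ⟨fun _ => trivial⟩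

section Noise

variable {V : Type*} {G : SimpleGraph V} {Ω : Type*} [MeasurableSpace Ω] {μ : Measure Ω}
  {𝓔 : ℕ → Ω → G.edgeSet} {U : ℕ → Ω → ℝ}

lemma IsNoise.shift (h : IsNoise G μ 𝓔 U) (s : ℕ) :
    IsNoise G μ (fun t => 𝓔 (s + t)) (fun t => U (s + t)) where
  isProbabilityMeasure := h.isProbabilityMeasure
  measurable_edge _ := h.measurable_edge _
  measurable_unif _ := h.measurable_unif _
  hasLaw_edge _ := h.hasLaw_edge _
  hasLaw_unif _ := h.hasLaw_unif _
  indep_pair _ := h.indep_pair _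
  indep_seq := h.indep_seq.precomp (g := fun t => s + t) (add_right_injective s)

lemma IsNoise.measurable_pair (h : IsNoise G μ 𝓔 U) (t : ℕ) :
    Measurable (fun ω => (𝓔 t ω, U t ω)) := (h.measurable_edge t).prodMk (h.measurable_unif t)

/-- The noise before time `t` is independent of the noise in a block that starts at time `t`. -/
lemma IsNoise.indepFun_past_block (h : IsNoise G μ 𝓔 U) (t n : ℕ) :
    IndepFun (fun ω (i : Fin t) => (𝓔 i ω, U i ω))
      (fun ω (i : Fin n) => (𝓔 (t + i) ω, U (t + i) ω)) μ := by
  have hd : Disjoint (Finset.range t) (Finset.Ico t (t + n)) := by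
    rw [Finset.disjoint_left]
    intro i hi hi'
    simp only [Finset.mem_range, Finset.mem_Ico] at hi hi'
    omega
  have h0 := h.indep_seq.indepFun_finset _ _ hd h.measurable_pair
  exact h0.comp
    (φ := fun (v : Finset.range t → G.edgeSet × ℝ) (i : Fin t) =>
      v ⟨i, Finset.mem_range.mpr i.2⟩)
    (ψ := fun (v : Finset.Ico t (t + n) → G.edgeSet × ℝ) (i : Fin n) =>
      v ⟨t + i, Finset.mem_Ico.mpr ⟨by omega, by omega⟩⟩)
    (measurable_pi_lambda _ fun i => measurable_pi_apply _)
    (measurable_pi_lambda _ fun i => measurable_pi_apply _)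

lemma IsNoise.measureReal_edge [Fintype G.edgeSet] [Nonempty G.edgeSet] (h : IsNoise G μ 𝓔 U)
    (t : ℕ) (S : Finset G.edgeSet) :
    μ.real (𝓔 t ⁻¹' S) = S.card / Fintype.card G.edgeSet := by
  have h1 : μ (𝓔 t ⁻¹' S) = (uniformOn Set.univ) (S : Set G.edgeSet) := by
    rw [← (h.hasLaw_edge t).map_eq, Measure.map_apply (h.measurable_edge t) (by trivial)]
  rw [measureReal_def, h1, uniformOn_univ, Measure.count_apply_finset, ENNReal.toReal_div]
  simp

lemma IsNoise.measureReal_unif_le (h : IsNoise G μ 𝓔 U) (t : ℕ) {c : ℝ} (h0 : 0 ≤ c)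
    (h1 : c ≤ 1) : μ.real {ω | U t ω ≤ c} = c := by
  have h2 : μ {ω | U t ω ≤ c} = (volume.restrict (Set.Icc (0 : ℝ) 1)) (Set.Iic c) := by
    rw [← (h.hasLaw_unif t).map_eq, Measure.map_apply (h.measurable_unif t) measurableSet_Iic]
    rfl
  have h3 : Set.Iic c ∩ Set.Icc (0 : ℝ) 1 = Set.Icc 0 c := by
    ext x; simp only [Set.mem_inter_iff, Set.mem_Iic, Set.mem_Icc]
    constructor
    · rintro ⟨a, b, _⟩; exact ⟨b, a⟩
    · rintro ⟨a, b⟩; exact ⟨b, a, b.trans h1⟩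
  rw [measureReal_def, h2, Measure.restrict_apply measurableSet_Iic, h3, Real.volume_Icc, sub_zero,
    ENNReal.toReal_ofReal h0]

/-- Integration over a pair of independent variables the first of which is discrete. -/
lemma integral_comp_of_indepFun [IsProbabilityMeasure μ] {α β : Type*} [Fintype α]
    [MeasurableSpace α] [DiscreteMeasurableSpace α] [MeasurableSpace β] {X : Ω → α} {Y : Ω → β}
    (hX : Measurable X) (hY : Measurable Y) (hXY : IndepFun X Y μ) (F : α → β → ℝ)
    (hF : ∀ x, Measurable (F x)) (hint : ∀ x, Integrable (fun ω => F x (Y ω)) μ) :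
    ∫ ω, F (X ω) (Y ω) ∂μ = ∑ x, μ.real (X ⁻¹' {x}) * ∫ ω, F x (Y ω) ∂μ := by
  classical
  have hind : ∀ x, Measurable (Set.indicator ({x} : Set α) (fun _ => (1 : ℝ))) := fun x =>
    measurable_const.indicator (by measurability)
  have h1 : ∀ ω, F (X ω) (Y ω) =
      ∑ x, Set.indicator {x} (fun _ => (1 : ℝ)) (X ω) * F x (Y ω) := by
    intro ω
    rw [Finset.sum_eq_single (X ω)]
    · simp
    · intro b _ hb
      rw [Set.indicator_of_notMem (by simpa using hb.symm), zero_mul]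
    · simp
  have hb : ∀ x, Integrable (fun ω => Set.indicator {x} (fun _ => (1 : ℝ)) (X ω) * F x (Y ω)) μ := by
    intro x
    refine (hint x).bdd_mul (c := 1) ((hind x).comp hX).aestronglyMeasurable
      (Eventually.of_forall fun ω => ?_)
    by_cases hx : X ω ∈ ({x} : Set α) <;> simp [Set.indicator, hx]
  simp_rw [h1]
  rw [integral_finsetSum _ fun x _ => hb x]
  refine Finset.sum_congr rfl fun x _ => ?_
  rw [hXY.integral_fun_comp_mul_comp (f := Set.indicator {x} (fun _ => (1 : ℝ))) (g := F x)
    hX.aemeasurable hY.aemeasurable (hind x).aestronglyMeasurable (hF x).aestronglyMeasurable]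
  congr 1
  have : (fun ω => Set.indicator {x} (fun _ => (1 : ℝ)) (X ω)) =
      Set.indicator (X ⁻¹' {x}) (fun _ => (1 : ℝ)) := by
    ext ω; simp [Set.indicator]
  rw [this, integral_indicator_const _ (hX (by measurability))]
  simp

end Noise

/-! ### The tail of the coupon collector time -/

section Coupon

variable {V : Type*} {G : SimpleGraph V} [Fintype G.edgeSet] [DecidableEq G.edgeSet]
  [Nonempty G.edgeSet] {Ω : Type*} [MeasurableSpace Ω] {μ : Measure Ω}
  {𝓔 : ℕ → Ω → G.edgeSet} {U : ℕ → Ω → ℝ}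

lemma measurableSet_not_covers (he : ∀ t, Measurable (𝓔 t)) (t : ℕ) :
    MeasurableSet {ω | ¬ Covers (fun i => 𝓔 i ω) t} := by
  have : {ω | ¬ Covers (fun i => 𝓔 i ω) t} = ⋃ x : G.edgeSet, ⋂ i ∈ Finset.range t,
      𝓔 i ⁻¹' {x}ᶜ := by
    ext ω; simp [covers_iff]
  rw [this]
  exact MeasurableSet.iUnion fun x => Finset.measurableSet_biInter _ fun i _ =>
    he i (by trivial)

/-- The probability that the first `t` updates miss all edges of `S`. -/
lemma IsNoise.measureReal_avoid (h : IsNoise G μ 𝓔 U) (t : ℕ) (S : Finset G.edgeSet) :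
    μ.real (⋂ i ∈ Finset.range t, 𝓔 i ⁻¹' ((Sᶜ : Finset G.edgeSet) : Set G.edgeSet)) =
      (1 - (S.card : ℝ) / Fintype.card G.edgeSet) ^ t := by
  have hind : iIndepFun 𝓔 μ :=
    h.indep_seq.comp (fun _ => Prod.fst) fun _ => measurable_fst
  have hm : (Fintype.card G.edgeSet : ℝ) ≠ 0 := by
    exact_mod_cast Fintype.card_ne_zero
  rw [measureReal_def, hind.meas_biInter fun i _ => ⟨_, by trivial, rfl⟩, ENNReal.toReal_prod]
  calc _ = ∏ i ∈ Finset.range t, (1 - (S.card : ℝ) / Fintype.card G.edgeSet) := by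
        refine Finset.prod_congr rfl fun i _ => ?_
        rw [← measureReal_def, h.measureReal_edge, Finset.card_compl,
          Nat.cast_sub (Finset.card_le_univ S), sub_div, div_self hm]
    _ = _ := by simp

/-- The probability that the first `t` updates do not visit every edge. -/
lemma IsNoise.measureReal_not_covers (h : IsNoise G μ 𝓔 U) (t : ℕ) :
    μ.real {ω | ¬ Covers (fun i => 𝓔 i ω) t} = couponTail (Fintype.card G.edgeSet) t := by
  have := h.isProbabilityMeasure
  have hset : {ω | ¬ Covers (fun i => 𝓔 i ω) t} = ⋃ x ∈ (Finset.univ : Finset G.edgeSet),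
      ⋂ i ∈ Finset.range t, 𝓔 i ⁻¹' {x}ᶜ := by
    ext ω; simp [covers_iff]
  rw [hset, measureReal_biUnion_eq_sum_powerset (fun x _ =>
    Finset.measurableSet_biInter _ fun i _ => h.measurable_edge i (by trivial))]
  have hterm : ∀ S : Finset G.edgeSet, S.Nonempty →
      (-1 : ℝ) ^ (S.card + 1) * μ.real (⋂ x ∈ S, ⋂ i ∈ Finset.range t, 𝓔 i ⁻¹' {x}ᶜ) =
      (if S.card = 0 then 0 else
        (-1 : ℝ) ^ (S.card + 1) * (1 - (S.card : ℝ) / Fintype.card G.edgeSet) ^ t) := by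
    intro S hS
    have hne : S.card ≠ 0 := Finset.card_ne_zero.mpr hS
    have hset2 : (⋂ x ∈ S, ⋂ i ∈ Finset.range t, 𝓔 i ⁻¹' {x}ᶜ) =
        ⋂ i ∈ Finset.range t, 𝓔 i ⁻¹' ((Sᶜ : Finset G.edgeSet) : Set G.edgeSet) := by
      ext ω
      simp only [Set.mem_iInter, Set.mem_preimage, Set.mem_compl_iff, Set.mem_singleton_iff,
        Finset.coe_compl, Finset.mem_coe]
      constructor
      · intro hx i hi hS'
        exact hx _ hS' i hi rfl
      · intro hx x hxS i hi hxe
        exact hx i hi (hxe ▸ hxS)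
    rw [if_neg hne, hset2, h.measureReal_avoid]
  -- Inclusion-exclusion runs over nonempty sets of missed edges. The summand is set to zero at
  -- cardinality `0`, so that the sum extends to the whole powerset and can be grouped by
  -- cardinality.
  rw [Finset.sum_congr rfl fun S hS => hterm S (Finset.mem_filter.mp hS).2, Finset.sum_filter,
    Finset.sum_congr rfl (g := fun S : Finset G.edgeSet => if S.card = 0 then 0 else
        (-1 : ℝ) ^ (S.card + 1) * (1 - (S.card : ℝ) / Fintype.card G.edgeSet) ^ t)]
  · rw [Finset.sum_powerset_apply_card (fun k : ℕ => if k = 0 then 0 else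
        (-1 : ℝ) ^ (k + 1) * (1 - (k : ℝ) / Fintype.card G.edgeSet) ^ t), Finset.card_univ,
      Finset.sum_range_succ', couponTail]
    simp only [if_true, smul_zero, add_zero]
    refine Finset.sum_congr rfl fun j _ => ?_
    rw [if_neg (Nat.succ_ne_zero j), nsmul_eq_mul]
    push_cast
    ring
  · intro S _
    rcases S.eq_empty_or_nonempty with rfl | hS
    · simp
    · simp [hS]

/-- The union bound for the coupon collector. -/
lemma IsNoise.couponTail_le (h : IsNoise G μ 𝓔 U) (t : ℕ) :
    couponTail (Fintype.card G.edgeSet) t ≤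
      Fintype.card G.edgeSet * Real.exp (-((t : ℝ) / Fintype.card G.edgeSet)) := by
  have := h.isProbabilityMeasure
  have hm : (0 : ℝ) < Fintype.card G.edgeSet := by exact_mod_cast Fintype.card_pos
  have hm1 : (1 : ℝ) ≤ Fintype.card G.edgeSet := by
    exact_mod_cast Nat.one_le_iff_ne_zero.mpr Fintype.card_ne_zero
  rw [← h.measureReal_not_covers]
  have hset : {ω | ¬ Covers (fun i => 𝓔 i ω) t} = ⋃ x ∈ (Finset.univ : Finset G.edgeSet),
      ⋂ i ∈ Finset.range t, 𝓔 i ⁻¹' ((({x} : Finset G.edgeSet)ᶜ : Finset _) : Set G.edgeSet) := by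
    ext ω; simp [covers_iff]
  rw [hset]
  refine (measureReal_biUnion_finset_le _ _).trans ?_
  simp only [h.measureReal_avoid, Finset.card_singleton, Nat.cast_one, Finset.sum_const,
    Finset.card_univ, nsmul_eq_mul]
  gcongr
  calc (1 - 1 / (Fintype.card G.edgeSet : ℝ)) ^ t
      ≤ Real.exp (-(1 / (Fintype.card G.edgeSet : ℝ))) ^ t := by
        gcongr
        · rw [sub_nonneg, div_le_one hm]; exact hm1
        · have := Real.add_one_le_exp (-(1 / (Fintype.card G.edgeSet : ℝ))); linarith
    _ = _ := by rw [← Real.exp_nat_mul]; congr 1; ring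

end Coupon
-- The chain as a function of the noise, and its one-step expectation
section ChainLaw

variable {V : Type*} [Fintype V] [DecidableEq V] {G : SimpleGraph V} [DecidableRel G.Adj]
  {p q r : ℝ} {Ω : Type*} [MeasurableSpace Ω] {μ : Measure Ω}
  {𝓔 : ℕ → Ω → G.edgeSet} {U : ℕ → Ω → ℝ}

lemma measurable_update :
    Measurable (fun z : Finset G.edgeSet × (G.edgeSet × ℝ) => update G p q z.1 z.2.1 z.2.2) := by
  refine measurable_from_prod_countable_right fun A => ?_
  refine measurable_from_prod_countable_right fun e => ?_
  have h : Measurable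
      (fun u : ℝ => if u ≤ occProb G p q A e then insert e A else A.erase e) :=
    Measurable.ite measurableSet_Iic measurable_const measurable_const
  exact h

lemma measurable_chain (he : ∀ t, Measurable (𝓔 t)) (hu : ∀ t, Measurable (U t))
    (A : Finset G.edgeSet) (t : ℕ) :
    Measurable (fun ω => chain G p q A (fun i => 𝓔 i ω) (fun i => U i ω) t) := by
  induction t with
  | zero => exact measurable_const
  | succ t ih => exact measurable_update.comp (ih.prodMk ((he t).prodMk (hu t)))

lemma measurableSet_not_coalesced (he : ∀ t, Measurable (𝓔 t)) (hu : ∀ t, Measurable (U t))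
    (t : ℕ) :
    MeasurableSet {ω | topChain G p q (fun i => 𝓔 i ω) (fun i => U i ω) t ≠
      bottomChain G p q (fun i => 𝓔 i ω) (fun i => U i ω) t} := by
  have h1 := measurable_chain (p := p) (q := q) he hu Finset.univ t
  have h2 := measurable_chain (p := p) (q := q) he hu ∅ t
  exact (measurableSet_eq_fun h1 h2).compl

variable [Nonempty G.edgeSet]

/-- A finite block of updates, continued arbitrarily. -/
noncomputable def extendBlock {t : ℕ} (v : Fin t → G.edgeSet × ℝ) (i : ℕ) : G.edgeSet × ℝ :=
  if h : i < t then v ⟨i, h⟩ else (Classical.arbitrary _, 0)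

lemma measurable_extendBlock {t : ℕ} (i : ℕ) :
    Measurable (fun v : Fin t → G.edgeSet × ℝ => extendBlock v i) := by
  unfold extendBlock
  split_ifs
  · exact measurable_pi_apply _
  · exact measurable_const

lemma measurable_chain_extendBlock {t : ℕ} (A : Finset G.edgeSet) :
    Measurable (fun v : Fin t → G.edgeSet × ℝ =>
      chain G p q A (fun i => (extendBlock v i).1) (fun i => (extendBlock v i).2) t) :=
  measurable_chain (fun i => (measurable_extendBlock i).fst)
    (fun i => (measurable_extendBlock i).snd) A t

/-- Exhibits the state at time `t` as a function of the first `t` noise pairs alone, the form in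
which independence of disjoint blocks applies. -/
lemma chain_extendBlock {t : ℕ} (A : Finset G.edgeSet) (e : ℕ → G.edgeSet) (u : ℕ → ℝ) :
    chain G p q A (fun i => (extendBlock (fun j : Fin t => (e j, u j)) i).1)
      (fun i => (extendBlock (fun j : Fin t => (e j, u j)) i).2) t = chain G p q A e u t := by
  refine chain_congr A fun i hi => ?_
  simp [extendBlock, hi]

lemma IsNoise.indepFun_chain (h : IsNoise G μ 𝓔 U) (A : Finset G.edgeSet) (t : ℕ) :
    IndepFun (fun ω => chain G p q A (fun i => 𝓔 i ω) (fun i => U i ω) t)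
      (fun ω => (𝓔 t ω, U t ω)) μ := by
  have h0 := (h.indepFun_past_block t 1).comp (measurable_chain_extendBlock (p := p) (q := q) A)
    (measurable_pi_apply (0 : Fin 1))
  convert! h0 using 1
  ext1 ω
  exact (chain_extendBlock A (fun i => 𝓔 i ω) (fun i => U i ω)).symm

/-- One update, averaged over the noise. -/
lemma IsNoise.integral_update (h : IsNoise G μ 𝓔 U) (H : IsTwoLevel G p q r)
    (f : Finset G.edgeSet → ℝ) (A : Finset G.edgeSet) (t : ℕ) :
    ∫ ω, f (update G p q A (𝓔 t ω) (U t ω)) ∂μ = (transition G p q).mulVec f A := by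
  have := h.isProbabilityMeasure
  have hset : ∀ e : G.edgeSet, MeasurableSet {ω | U t ω ≤ occProb G p q A e} := fun e =>
    h.measurable_unif t measurableSet_Iic
  have hdec : ∀ (e : G.edgeSet) (ω : Ω), f (update G p q A e (U t ω)) =
      f (A.erase e) + Set.indicator {ω | U t ω ≤ occProb G p q A e}
        (fun _ => f (insert e A) - f (A.erase e)) ω := by
    intro e ω
    by_cases hu : U t ω ≤ occProb G p q A e <;> simp [Set.indicator, update, hu]
  have hint : ∀ e : G.edgeSet, Integrable (fun ω => f (update G p q A e (U t ω))) μ := by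
    intro e
    simp_rw [hdec e]
    exact (integrable_const _).add ((integrable_const _).indicator (hset e))
  rw [integral_comp_of_indepFun (h.measurable_edge t) (h.measurable_unif t) (h.indep_pair t)
    (fun e u => f (update G p q A e u)) (fun e => ?_) hint, transition_mulVec, Finset.mul_sum]
  · refine Finset.sum_congr rfl fun e _ => ?_
    have he := h.measureReal_edge t {e}
    rw [Finset.coe_singleton, Finset.card_singleton, Nat.cast_one] at he
    obtain ⟨h0, h1⟩ := H.occProb_mem A e
    have hi : ∫ ω, f (update G p q A e (U t ω)) ∂μ =
        occProb G p q A e * f (insert e A) + (1 - occProb G p q A e) * f (A.erase e) := by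
      simp_rw [hdec e]
      rw [integral_add (integrable_const _) ((integrable_const _).indicator (hset e)),
        integral_const, integral_indicator_const _ (hset e),
        h.measureReal_unif_le t h0.le (h1.trans H.lt_one.le)]
      simp only [probReal_univ, smul_eq_mul]
      ring
    rw [he, hi]
  · exact (measurable_of_finite f).comp
      (Measurable.ite (measurableSet_Iic (a := occProb G p q A e)) measurable_const
        measurable_const)

lemma IsNoise.integrable_chain (h : IsNoise G μ 𝓔 U) (f : Finset G.edgeSet → ℝ)
    (A : Finset G.edgeSet) (t : ℕ) :
    Integrable (fun ω => f (chain G p q A (fun i => 𝓔 i ω) (fun i => U i ω) t)) μ := by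
  have := h.isProbabilityMeasure
  refine Integrable.of_bound (C := ∑ B, |f B|) ((measurable_of_finite f).comp
    (measurable_chain h.measurable_edge h.measurable_unif A t)).aestronglyMeasurable
    (Eventually.of_forall fun ω => ?_)
  rw [Real.norm_eq_abs]
  exact Finset.single_le_sum (f := fun B => |f B|) (fun B _ => abs_nonneg _) (Finset.mem_univ _)

/-- The transition matrix is the one-step expectation operator of the coupled chains. -/
lemma IsNoise.integral_chain_succ (h : IsNoise G μ 𝓔 U) (H : IsTwoLevel G p q r)
    (f : Finset G.edgeSet → ℝ) (A : Finset G.edgeSet) (t : ℕ) :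
    ∫ ω, f (chain G p q A (fun i => 𝓔 i ω) (fun i => U i ω) (t + 1)) ∂μ =
      ∫ ω, (transition G p q).mulVec f
        (chain G p q A (fun i => 𝓔 i ω) (fun i => U i ω) t) ∂μ := by
  have := h.isProbabilityMeasure
  have hX := measurable_chain (p := p) (q := q) h.measurable_edge h.measurable_unif A t
  have hm : ∀ B : Finset G.edgeSet, Measurable
      (fun z : G.edgeSet × ℝ => f (update G p q B z.1 z.2)) := fun B =>
    (measurable_of_finite f).comp (measurable_update.comp (measurable_const.prodMk measurable_id))
  have hb : ∀ B : Finset G.edgeSet, |f B| ≤ ∑ B, |f B| := fun B =>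
    Finset.single_le_sum (f := fun B => |f B|) (fun B _ => abs_nonneg _) (Finset.mem_univ _)
  have h1 := integral_comp_of_indepFun hX (h.measurable_pair t) (h.indepFun_chain A t)
    (fun B z => f (update G p q B z.1 z.2)) hm
    (fun B => Integrable.of_bound (C := ∑ B, |f B|)
      ((hm B).comp (h.measurable_pair t)).aestronglyMeasurable
      (Eventually.of_forall fun ω => hb _))
  have h2 := integral_comp_of_indepFun hX (h.measurable_pair t) (h.indepFun_chain A t)
    (fun B _ => (transition G p q).mulVec f B) (fun B => measurable_const)
    (fun B => integrable_const _)
  simp only [chain]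
  rw [h1, h2]
  refine Finset.sum_congr rfl fun B _ => ?_
  rw [h.integral_update H, integral_const]
  simp

end ChainLaw

/-! ### Tail bounds for the coupling time -/

section Tails

variable {V : Type*} [Fintype V] [DecidableEq V] {G : SimpleGraph V} [DecidableRel G.Adj]
  [Nonempty G.edgeSet] {p q r : ℝ} {Ω : Type*} [MeasurableSpace Ω] {μ : Measure Ω}
  {𝓔 : ℕ → Ω → G.edgeSet} {U : ℕ → Ω → ℝ}

/-- A bound for the probability that the top chain misses fewer than two edges at time `t`. -/
noncomputable def nearlyFullBound (p : ℝ) (m t : ℕ) : ℝ :=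
  2 * (((3 + p) / 4) ^ t + 8 / (1 - p) * (1 / 2 : ℝ) ^ ((1 - p) / 4 * m))

/-- Iteration of the drift inequality from the value `1` at the full configuration. The constant
term `8 / (1 - p) * b` is the fixed point of `x ↦ (3 + p) / 4 * x + 2 * b`. -/
lemma IsNoise.integral_half_pow_le (h : IsNoise G μ 𝓔 U) (H : IsTwoLevel G p q r) (t : ℕ) :
    ∫ ω, (1 / 2 : ℝ) ^ (topChain G p q (fun i => 𝓔 i ω) (fun i => U i ω) t)ᶜ.card ∂μ ≤
      ((3 + p) / 4) ^ t + 8 / (1 - p) * (1 / 2 : ℝ) ^ ((1 - p) / 4 * Fintype.card G.edgeSet) := by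
  have := h.isProbabilityMeasure
  have hp0 : 0 < p := H.pos.trans_le H.le
  have hp1 : 0 < 1 - p := sub_pos.mpr H.lt_one
  set b : ℝ := (1 / 2 : ℝ) ^ ((1 - p) / 4 * Fintype.card G.edgeSet) with hb
  have hb0 : 0 < b := by positivity
  set g : Finset G.edgeSet → ℝ := fun B => (1 / 2 : ℝ) ^ Bᶜ.card with hg
  induction t with
  | zero =>
    have : 0 ≤ 8 / (1 - p) * b := by positivity
    simp only [topChain, chain]
    simpa using this
  | succ t ih =>
    have hI := h.integrable_chain (p := p) (q := q) g Finset.univ t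
    calc ∫ ω, g (chain G p q Finset.univ (fun i => 𝓔 i ω) (fun i => U i ω) (t + 1)) ∂μ
        = ∫ ω, (transition G p q).mulVec g
            (chain G p q Finset.univ (fun i => 𝓔 i ω) (fun i => U i ω) t) ∂μ :=
          h.integral_chain_succ H g _ t
      _ ≤ ∫ ω, ((3 + p) / 4 * g (chain G p q Finset.univ (fun i => 𝓔 i ω) (fun i => U i ω) t) +
            2 * b) ∂μ :=
          integral_mono (h.integrable_chain _ _ t) ((hI.const_mul _).add (integrable_const _))
            fun ω => H.transition_half_pow_drift _
      _ = (3 + p) / 4 * ∫ ω, g (chain G p q Finset.univ (fun i => 𝓔 i ω) (fun i => U i ω) t) ∂μ +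
            2 * b := by
          rw [integral_add (hI.const_mul _) (integrable_const _), integral_const_mul]
          simp
      _ ≤ (3 + p) / 4 * (((3 + p) / 4) ^ t + 8 / (1 - p) * b) + 2 * b := by
          gcongr
          exact ih
      _ = _ := by field_simp; ring

/-- Markov's inequality: at most one closed edge means that `(1/2) ^ (number of closed edges)` is at
least `1 / 2`. -/
lemma IsNoise.measureReal_nearly_full_le (h : IsNoise G μ 𝓔 U) (H : IsTwoLevel G p q r) (t : ℕ) :
    μ.real {ω | (topChain G p q (fun i => 𝓔 i ω) (fun i => U i ω) t)ᶜ.card < 2} ≤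
      nearlyFullBound p (Fintype.card G.edgeSet) t := by
  have := h.isProbabilityMeasure
  have hI : Integrable (fun ω => (1 / 2 : ℝ) ^
      (topChain G p q (fun i => 𝓔 i ω) (fun i => U i ω) t)ᶜ.card) μ :=
    h.integrable_chain (fun B => (1 / 2 : ℝ) ^ Bᶜ.card) Finset.univ t
  have hmk := mul_meas_ge_le_integral_of_nonneg
    (Eventually.of_forall fun ω => by positivity) hI (1 / 2)
  have hsub : {ω | (topChain G p q (fun i => 𝓔 i ω) (fun i => U i ω) t)ᶜ.card < 2} ⊆
      {ω | (1 / 2 : ℝ) ≤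
        (1 / 2) ^ (topChain G p q (fun i => 𝓔 i ω) (fun i => U i ω) t)ᶜ.card} := by
    intro ω hω
    have h1 : (topChain G p q (fun i => 𝓔 i ω) (fun i => U i ω) t)ᶜ.card ≤ 1 := by
      have : _ < 2 := hω
      omega
    have := pow_le_pow_of_le_one (a := (1 / 2 : ℝ)) (by norm_num) (by norm_num) h1
    rw [pow_one] at this
    exact this
  have h2 := measureReal_mono (μ := μ) hsub
  have h3 := h.integral_half_pow_le H t
  simp only [measureReal_def] at hmk h2 ⊢
  rw [nearlyFullBound]
  linarith

/-- A bound for the tail of the coupling time. -/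
lemma IsNoise.measureReal_not_coalesced_le (h : IsNoise G μ 𝓔 U) (H : IsTwoLevel G p q r)
    (s m : ℕ) :
    μ.real {ω | topChain G p q (fun i => 𝓔 i ω) (fun i => U i ω) (s + m) ≠
      bottomChain G p q (fun i => 𝓔 i ω) (fun i => U i ω) (s + m)} ≤
      couponTail (Fintype.card G.edgeSet) m +
        m * nearlyFullBound p (Fintype.card G.edgeSet) s := by
  have := h.isProbabilityMeasure
  have hp0 : 0 < p := H.pos.trans_le H.le
  have hp1 : 0 < 1 - p := sub_pos.mpr H.lt_one
  -- After a burn-in of `s` steps, either the next `m` updates fail to visit every edge, or the top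
  -- chain is nearly full at one of these `m` times, or the chains have merged.
  have hsub : {ω | topChain G p q (fun i => 𝓔 i ω) (fun i => U i ω) (s + m) ≠
      bottomChain G p q (fun i => 𝓔 i ω) (fun i => U i ω) (s + m)} ⊆
      {ω | ¬ Covers (fun i => 𝓔 (s + i) ω) m} ∪ ⋃ i ∈ Finset.range m,
        {ω | (topChain G p q (fun i => 𝓔 i ω) (fun i => U i ω) (s + i))ᶜ.card < 2} := by
    intro ω hω
    by_contra hcon
    simp only [Set.mem_union, Set.mem_iUnion, Finset.mem_range, not_or, not_exists] at hcon
    obtain ⟨h1, h2⟩ := hcon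
    refine hω (H.coalesced_of_covers (fun i hi => ?_) (not_not.mp h1))
    exact not_lt.mp (h2 i hi)
  refine (measureReal_mono hsub).trans ((measureReal_union_le _ _).trans ?_)
  rw [(h.shift s).measureReal_not_covers]
  gcongr
  refine (measureReal_biUnion_finset_le _ _).trans ?_
  calc _ ≤ ∑ i ∈ Finset.range m, nearlyFullBound p (Fintype.card G.edgeSet) s := by
        refine Finset.sum_le_sum fun i _ => (h.measureReal_nearly_full_le H (s + i)).trans ?_
        unfold nearlyFullBound
        have : ((3 + p) / 4) ^ (s + i) ≤ ((3 + p) / 4) ^ s :=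
          pow_le_pow_of_le_one (by positivity) (by linarith) (by omega)
        linarith
    _ = _ := by simp

/-- The tail of the coupling time is submultiplicative. -/
lemma IsNoise.measureReal_not_coalesced_add_le (h : IsNoise G μ 𝓔 U) (H : IsTwoLevel G p q r)
    (t n : ℕ) :
    μ.real {ω | topChain G p q (fun i => 𝓔 i ω) (fun i => U i ω) (t + n) ≠
      bottomChain G p q (fun i => 𝓔 i ω) (fun i => U i ω) (t + n)} ≤
    μ.real {ω | topChain G p q (fun i => 𝓔 i ω) (fun i => U i ω) t ≠
      bottomChain G p q (fun i => 𝓔 i ω) (fun i => U i ω) t} *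
    μ.real {ω | topChain G p q (fun i => 𝓔 (t + i) ω) (fun i => U (t + i) ω) n ≠
      bottomChain G p q (fun i => 𝓔 (t + i) ω) (fun i => U (t + i) ω) n} := by
  have := h.isProbabilityMeasure
  have hblock : ∀ k : ℕ, MeasurableSet {v : Fin k → G.edgeSet × ℝ |
      topChain G p q (fun i => (extendBlock v i).1) (fun i => (extendBlock v i).2) k ≠
      bottomChain G p q (fun i => (extendBlock v i).1) (fun i => (extendBlock v i).2) k} :=
    fun k => (measurableSet_eq_fun (measurable_chain_extendBlock (p := p) (q := q) Finset.univ)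
      (measurable_chain_extendBlock (p := p) (q := q) ∅)).compl
  have hind := (h.indepFun_past_block t n).measure_inter_preimage_eq_mul _ _ (hblock t) (hblock n)
  have e1 : (fun ω (i : Fin t) => (𝓔 i ω, U i ω)) ⁻¹' {v : Fin t → G.edgeSet × ℝ |
      topChain G p q (fun i => (extendBlock v i).1) (fun i => (extendBlock v i).2) t ≠
      bottomChain G p q (fun i => (extendBlock v i).1) (fun i => (extendBlock v i).2) t} =
      {ω | topChain G p q (fun i => 𝓔 i ω) (fun i => U i ω) t ≠
      bottomChain G p q (fun i => 𝓔 i ω) (fun i => U i ω) t} := by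
    ext ω
    have := fun A => chain_extendBlock (p := p) (q := q) (t := t) A (fun i => 𝓔 i ω)
      (fun i => U i ω)
    simp only [Set.mem_preimage, Set.mem_ofPred_eq, topChain, bottomChain, this]
  have e2 : (fun ω (i : Fin n) => (𝓔 (t + i) ω, U (t + i) ω)) ⁻¹' {v : Fin n → G.edgeSet × ℝ |
      topChain G p q (fun i => (extendBlock v i).1) (fun i => (extendBlock v i).2) n ≠
      bottomChain G p q (fun i => (extendBlock v i).1) (fun i => (extendBlock v i).2) n} =
      {ω | topChain G p q (fun i => 𝓔 (t + i) ω) (fun i => U (t + i) ω) n ≠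
      bottomChain G p q (fun i => 𝓔 (t + i) ω) (fun i => U (t + i) ω) n} := by
    ext ω
    have := fun A => chain_extendBlock (p := p) (q := q) (t := n) A (fun i => 𝓔 (t + i) ω)
      (fun i => U (t + i) ω)
    simp only [Set.mem_preimage, Set.mem_ofPred_eq, topChain, bottomChain, this]
  rw [e1, e2] at hind
  simp only [measureReal_def]
  rw [← ENNReal.toReal_mul, ← hind]
  -- Chains that differ at time `t + n` differed at time `t`, and the fresh block of length `n` has
  -- not merged the extreme states. These two events depend on disjoint blocks of noise.
  refine ENNReal.toReal_mono (measure_ne_top _ _) (measure_mono fun ω hω => ⟨fun h1 => ?_, fun h1 => ?_⟩)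
  · exact hω (coalesced_mono (by omega) h1)
  · exact hω (H.coalesced_of_shift h1)

lemma IsNoise.measureReal_not_coalesced_mul_le (h : IsNoise G μ 𝓔 U) (H : IsTwoLevel G p q r)
    {n : ℕ} {ε : ℝ} (hε : ∀ t, μ.real {ω |
      topChain G p q (fun i => 𝓔 (t + i) ω) (fun i => U (t + i) ω) n ≠
      bottomChain G p q (fun i => 𝓔 (t + i) ω) (fun i => U (t + i) ω) n} ≤ ε) (k : ℕ) :
    μ.real {ω | topChain G p q (fun i => 𝓔 i ω) (fun i => U i ω) (k * n) ≠
      bottomChain G p q (fun i => 𝓔 i ω) (fun i => U i ω) (k * n)} ≤ ε ^ k := by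
  have := h.isProbabilityMeasure
  have h0 : 0 ≤ ε := measureReal_nonneg.trans (hε 0)
  induction k with
  | zero => simp
  | succ k ih =>
    rw [Nat.succ_mul, pow_succ]
    exact (h.measureReal_not_coalesced_add_le H _ _).trans
      (mul_le_mul ih (hε _) measureReal_nonneg (pow_nonneg h0 k))

end Tails
-- Eigenvalues and the coupling tail
section Oscillation

variable {V : Type*} [Fintype V] [DecidableEq V] {G : SimpleGraph V} [DecidableRel G.Adj]
  [Nonempty G.edgeSet] {p q r : ℝ} {Ω : Type*} [MeasurableSpace Ω] {μ : Measure Ω}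
  {𝓔 : ℕ → Ω → G.edgeSet} {U : ℕ → Ω → ℝ}

lemma transition_mulVec_const (c : ℝ) :
    (transition G p q).mulVec (fun _ => c) = fun _ => c := by
  ext A
  have hm : (Fintype.card G.edgeSet : ℝ) ≠ 0 := by exact_mod_cast Fintype.card_ne_zero
  rw [transition_mulVec]
  simp only [← add_mul, add_sub_cancel, one_mul, Finset.sum_const, Finset.card_univ, nsmul_eq_mul]
  field_simp

lemma IsNoise.integral_chain_eigen (h : IsNoise G μ 𝓔 U) (H : IsTwoLevel G p q r)
    {f : Finset G.edgeSet → ℝ} {l : ℝ} (hf : (transition G p q).mulVec f = l • f)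
    (A : Finset G.edgeSet) (t : ℕ) :
    ∫ ω, f (chain G p q A (fun i => 𝓔 i ω) (fun i => U i ω) t) ∂μ = l ^ t * f A := by
  have := h.isProbabilityMeasure
  induction t with
  | zero => simp [chain]
  | succ t ih =>
    rw [h.integral_chain_succ H, hf]
    simp only [Pi.smul_apply, smul_eq_mul]
    rw [integral_const_mul, ih]
    ring

/-- An eigenfunction is constant, or its eigenvalue is bounded through the coupling tail. -/
lemma IsNoise.eigen_oscillation (h : IsNoise G μ 𝓔 U) (H : IsTwoLevel G p q r)
    {f : Finset G.edgeSet → ℝ} {l : ℝ} (hf : (transition G p q).mulVec f = l • f) (t : ℕ) :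
    (∀ A B, f A = f B) ∨ |l| ^ t ≤
      μ.real {ω | topChain G p q (fun i => 𝓔 i ω) (fun i => U i ω) t ≠
        bottomChain G p q (fun i => 𝓔 i ω) (fun i => U i ω) t} := by
  have := h.isProbabilityMeasure
  -- Start two copies from a pair that maximises `|f A - f B|`. The mean difference at time `t` is
  -- `l ^ t` times the initial one, yet the difference vanishes after coalescence and never exceeds
  -- the maximum.
  obtain ⟨⟨A, B⟩, hmax⟩ := Finite.exists_max
    (fun z : Finset G.edgeSet × Finset G.edgeSet => |f z.1 - f z.2|)
  rcases eq_or_ne (f A) (f B) with hAB | hAB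
  · left
    intro A' B'
    have := hmax (A', B')
    simp only [hAB, sub_self, abs_zero] at this
    exact sub_eq_zero.mp (abs_eq_zero.mp (le_antisymm this (abs_nonneg _)))
  right
  have hM : 0 < |f A - f B| := abs_pos.mpr (sub_ne_zero.mpr hAB)
  set S := {ω | topChain G p q (fun i => 𝓔 i ω) (fun i => U i ω) t ≠
        bottomChain G p q (fun i => 𝓔 i ω) (fun i => U i ω) t} with hS
  have hSm : MeasurableSet S := measurableSet_not_coalesced h.measurable_edge h.measurable_unif t
  have hIA := h.integrable_chain (p := p) (q := q) f A t
  have hIB := h.integrable_chain (p := p) (q := q) f B t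
  have hle : |l| ^ t * |f A - f B| ≤ |f A - f B| * μ.real S := by
    calc |l| ^ t * |f A - f B| = |l ^ t * f A - l ^ t * f B| := by
          rw [← mul_sub, abs_mul, abs_pow]
      _ = |∫ ω, (f (chain G p q A (fun i => 𝓔 i ω) (fun i => U i ω) t) -
            f (chain G p q B (fun i => 𝓔 i ω) (fun i => U i ω) t)) ∂μ| := by
          rw [integral_sub hIA hIB, h.integral_chain_eigen H hf, h.integral_chain_eigen H hf]
      _ ≤ ∫ ω, |f (chain G p q A (fun i => 𝓔 i ω) (fun i => U i ω) t) -
            f (chain G p q B (fun i => 𝓔 i ω) (fun i => U i ω) t)| ∂μ :=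
          abs_integral_le_integral_abs
      _ ≤ ∫ ω, S.indicator (fun _ => |f A - f B|) ω ∂μ := by
          refine integral_mono (hIA.sub hIB).abs ((integrable_const _).indicator hSm) fun ω => ?_
          by_cases hω : ω ∈ S
          · rw [Set.indicator_of_mem hω]
            exact hmax (_, _)
          · rw [Set.indicator_of_notMem hω]
            have hc := not_not.mp hω
            simp only [H.chain_eq_bottomChain hc, sub_self, abs_zero, le_refl]
      _ = |f A - f B| * μ.real S := by
          rw [integral_indicator_const _ hSm, smul_eq_mul, mul_comm]
  rw [mul_comm] at hle
  exact le_of_mul_le_mul_left hle hM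

/-- Eigenvalues of the transition matrix other than `1` are bounded by the coupling tail. -/
lemma IsNoise.abs_eigenvalue_pow_le (h : IsNoise G μ 𝓔 U) (H : IsTwoLevel G p q r) {l : ℝ}
    (hl : Module.End.HasEigenvalue (Matrix.toLin' (transition G p q)) l) (hl1 : l ≠ 1) (t : ℕ) :
    |l| ^ t ≤ μ.real {ω | topChain G p q (fun i => 𝓔 i ω) (fun i => U i ω) t ≠
        bottomChain G p q (fun i => 𝓔 i ω) (fun i => U i ω) t} := by
  obtain ⟨f, hf⟩ := hl.exists_hasEigenvector
  have hf1 : (transition G p q).mulVec f = l • f := by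
    have := hf.apply_eq_smul
    rwa [Matrix.toLin'_apply] at this
  rcases h.eigen_oscillation H hf1 t with hc | hc
  -- A nonzero constant is fixed by the stochastic matrix, which would force `l = 1`.
  · exfalso
    have hfc : f = fun _ => f ∅ := by ext A; exact hc A ∅
    have h0 : f ∅ ≠ 0 := by
      intro h0
      exact hf.2 (by rw [hfc, h0]; rfl)
    rw [hfc, transition_mulVec_const] at hf1
    have := congrFun hf1 ∅
    simp only [Pi.smul_apply, smul_eq_mul] at this
    exact hl1 (mul_right_cancel₀ h0 (by rw [one_mul]; exact this.symm))
  · exact hc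

end Oscillation

/-! ### Reversibility and the Dirichlet form -/

section Reversible

variable {V : Type*} [Fintype V] [DecidableEq V] {G : SimpleGraph V} [DecidableRel G.Adj]
  {p q : ℝ}

/-- A single update draws `B` from the stationary measure conditioned on the state off `e`. The
denominator depends only on that state, so detailed balance is immediate in this form. -/
lemma edgeTransition_apply (hp : p ∈ Set.Ioo (0 : ℝ) 1) (hq : 0 < q) (e : G.edgeSet)
    (A B : Finset G.edgeSet) :
    edgeTransition G p q e A B = if A.erase e = B.erase e then
      prob G p q B / (prob G p q (insert e A) + prob G p q (A.erase e)) else 0 := by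
  have h1 := prob_pos G hp hq (insert e A)
  have h2 := prob_pos G hp hq (A.erase e)
  rw [edgeTransition]
  by_cases hB1 : B = insert e A
  · rw [if_pos hB1, hB1, if_pos, occProb]
    simp
  · rw [if_neg hB1]
    by_cases hB2 : B = A.erase e
    · rw [if_pos hB2, hB2, if_pos (by simp), occProb]
      field_simp
      ring
    · rw [if_neg hB2, if_neg]
      intro h
      by_cases he : e ∈ B
      · apply hB1
        rw [← Finset.insert_erase he, ← h]
        ext x; by_cases hx : x = e <;> simp [hx]
      · exact hB2 (by rw [h, Finset.erase_eq_of_notMem he])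

/-- The random-cluster measure is in detailed balance with each single-edge update. -/
lemma prob_mul_edgeTransition (hp : p ∈ Set.Ioo (0 : ℝ) 1) (hq : 0 < q) (e : G.edgeSet)
    (A B : Finset G.edgeSet) :
    prob G p q A * edgeTransition G p q e A B = prob G p q B * edgeTransition G p q e B A := by
  rw [edgeTransition_apply hp hq, edgeTransition_apply hp hq]
  by_cases h : A.erase e = B.erase e
  · have h' : insert e A = insert e B := by
      ext x
      by_cases hx : x = e
      · simp [hx]
      · have := Finset.ext_iff.mp h x
        simpa [hx] using this
    rw [if_pos h, if_pos h.symm, h, h']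
    ring
  · rw [if_neg h, if_neg (fun h' => h h'.symm), mul_zero, mul_zero]

lemma sum_prob_edgeTransition (hp : p ∈ Set.Ioo (0 : ℝ) 1) (hq : 0 < q) (e : G.edgeSet)
    (f g : Finset G.edgeSet → ℝ) :
    ∑ A, prob G p q A * ((edgeTransition G p q e).mulVec f A * g A) =
      ∑ A, prob G p q A * (f A * (edgeTransition G p q e).mulVec g A) := by
  simp only [Matrix.mulVec, dotProduct, Finset.sum_mul, Finset.mul_sum]
  rw [Finset.sum_comm]
  refine Finset.sum_congr rfl fun A _ => Finset.sum_congr rfl fun B _ => ?_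
  have := prob_mul_edgeTransition hp hq e A B
  linear_combination -(f A * g B) * this

lemma transition_mulVec_eq_sum (f : Finset G.edgeSet → ℝ) (A : Finset G.edgeSet) :
    (transition G p q).mulVec f A =
      (1 / (Fintype.card G.edgeSet : ℝ)) * ∑ e, (edgeTransition G p q e).mulVec f A := by
  rw [transition_mulVec]
  simp only [edgeTransition_mulVec]

lemma sum_prob_transition (hp : p ∈ Set.Ioo (0 : ℝ) 1) (hq : 0 < q)
    (f g : Finset G.edgeSet → ℝ) :
    ∑ A, prob G p q A * ((transition G p q).mulVec f A * g A) =
      ∑ A, prob G p q A * (f A * (transition G p q).mulVec g A) := by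
  have h1 : ∀ A, prob G p q A * ((transition G p q).mulVec f A * g A) = ∑ e,
      (1 / (Fintype.card G.edgeSet : ℝ)) *
        (prob G p q A * ((edgeTransition G p q e).mulVec f A * g A)) := by
    intro A
    rw [transition_mulVec_eq_sum, Finset.mul_sum, Finset.sum_mul, Finset.mul_sum]
    exact Finset.sum_congr rfl fun e _ => by ring
  have h2 : ∀ A, prob G p q A * (f A * (transition G p q).mulVec g A) = ∑ e,
      (1 / (Fintype.card G.edgeSet : ℝ)) *
        (prob G p q A * (f A * (edgeTransition G p q e).mulVec g A)) := by
    intro A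
    rw [transition_mulVec_eq_sum, Finset.mul_sum, Finset.mul_sum, Finset.mul_sum]
    exact Finset.sum_congr rfl fun e _ => by ring
  simp_rw [h1, h2]
  rw [Finset.sum_comm, Finset.sum_comm (s := (Finset.univ : Finset (Finset G.edgeSet)))]
  refine Finset.sum_congr rfl fun e _ => ?_
  rw [← Finset.mul_sum, ← Finset.mul_sum, sum_prob_edgeTransition hp hq]

lemma occProb_insert (A : Finset G.edgeSet) (e : G.edgeSet) :
    occProb G p q (insert e A) e = occProb G p q A e := by
  simp [occProb]

lemma occProb_erase (A : Finset G.edgeSet) (e : G.edgeSet) :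
    occProb G p q (A.erase e) e = occProb G p q A e := by
  have : insert e (A.erase e) = insert e A := by
    ext x; by_cases hx : x = e <;> simp [hx]
  simp [occProb, this]

lemma edgeTransition_mulVec_idem (e : G.edgeSet) (f : Finset G.edgeSet → ℝ) :
    (edgeTransition G p q e).mulVec ((edgeTransition G p q e).mulVec f) =
      (edgeTransition G p q e).mulVec f := by
  ext A
  have h : insert e (A.erase e) = insert e A := by
    ext x; by_cases hx : x = e <;> simp [hx]
  rw [edgeTransition_mulVec]
  simp only [edgeTransition_mulVec, occProb_insert, occProb_erase, Finset.insert_idem,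
    Finset.erase_insert_eq_erase, Finset.erase_idem, h]
  ring

/-- A heat-bath update is a conditional expectation: being self-adjoint and idempotent, its
quadratic form at `f` is the squared norm of its image. -/
lemma sum_prob_edgeTransition_nonneg (hp : p ∈ Set.Ioo (0 : ℝ) 1) (hq : 0 < q) (e : G.edgeSet)
    (f : Finset G.edgeSet → ℝ) :
    0 ≤ ∑ A, prob G p q A * ((edgeTransition G p q e).mulVec f A * f A) := by
  rw [sum_prob_edgeTransition hp hq, ← edgeTransition_mulVec_idem,
    ← sum_prob_edgeTransition hp hq]
  exact Finset.sum_nonneg fun A _ => mul_nonneg (prob_pos G hp hq A).le (mul_self_nonneg _)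

/-- The Dirichlet form of a function of a single edge. -/
lemma le_sum_prob_transition (hp : p ∈ Set.Ioo (0 : ℝ) 1) (hq : 0 < q) [Nonempty G.edgeSet]
    (e₀ : G.edgeSet) (f : Finset G.edgeSet → ℝ)
    (hf : ∀ e ≠ e₀, ∀ A, f (insert e A) = f A ∧ f (A.erase e) = f A) :
    (1 - 1 / (Fintype.card G.edgeSet : ℝ)) * ∑ A, prob G p q A * (f A * f A) ≤
      ∑ A, prob G p q A * ((transition G p q).mulVec f A * f A) := by
  have hm : (0 : ℝ) < Fintype.card G.edgeSet := by exact_mod_cast Fintype.card_pos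
  have h1 : ∀ A, prob G p q A * ((transition G p q).mulVec f A * f A) =
      (1 - 1 / (Fintype.card G.edgeSet : ℝ)) * (prob G p q A * (f A * f A)) +
      (1 / (Fintype.card G.edgeSet : ℝ)) *
        (prob G p q A * ((edgeTransition G p q e₀).mulVec f A * f A)) := by
    intro A
    -- Every update other than that of `e₀` leaves `f` unchanged; the remaining one contributes a
    -- nonnegative form.
    have h2 : ∑ e, (edgeTransition G p q e).mulVec f A =
        (edgeTransition G p q e₀).mulVec f A + ((Fintype.card G.edgeSet : ℝ) - 1) * f A := by
      rw [← Finset.add_sum_erase _ _ (Finset.mem_univ e₀)]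
      congr 1
      rw [Finset.sum_congr rfl (g := fun _ => f A)]
      · rw [Finset.sum_const, Finset.card_erase_of_mem (Finset.mem_univ _), Finset.card_univ,
          nsmul_eq_mul, Nat.cast_sub (Nat.one_le_iff_ne_zero.mpr Fintype.card_ne_zero),
          Nat.cast_one]
      · intro e he
        rw [edgeTransition_mulVec, (hf e (Finset.ne_of_mem_erase he) A).1,
          (hf e (Finset.ne_of_mem_erase he) A).2]
        ring
    rw [transition_mulVec_eq_sum, h2]
    field_simp
    ring
  simp_rw [h1]
  rw [Finset.sum_add_distrib, ← Finset.mul_sum, ← Finset.mul_sum]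
  have := sum_prob_edgeTransition_nonneg hp hq e₀ f
  have : 0 ≤ 1 / (Fintype.card G.edgeSet : ℝ) *
    ∑ A, prob G p q A * ((edgeTransition G p q e₀).mulVec f A * f A) := by positivity
  linarith

end Reversible
-- Spectral gap and relaxation time
/-- A Rayleigh quotient bound on the orthogonal complement of an eigenvector. -/
lemma exists_eigenvector_orthogonal {E : Type*} [NormedAddCommGroup E] [InnerProductSpace ℝ E]
    [FiniteDimensional ℝ E] {T : E →ₗ[ℝ] E} (hT : T.IsSymmetric) {v : E} (hv : T v = v) {g : E}
    (hg : g ≠ 0) (hvg : inner ℝ v g = 0) {κ : ℝ} (hκ : κ * ‖g‖ ^ 2 ≤ inner ℝ (T g) g) :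
    ∃ l, κ ≤ l ∧ ∃ w : E, w ≠ 0 ∧ inner ℝ v w = 0 ∧ T w = l • w := by
  let W : Submodule ℝ E := (Submodule.span ℝ {v})ᗮ
  have hmem : ∀ x, x ∈ W ↔ inner ℝ v x = 0 := fun x =>
    Submodule.mem_orthogonal_singleton_iff_inner_right
  have hW : ∀ x ∈ W, T x ∈ W := by
    intro x hx
    rw [hmem] at hx ⊢
    rw [← hT v x, hv, hx]
  have hS := hT.restrict_invariant hW
  set S := T.restrict hW with hSdef
  let g' : W := ⟨g, (hmem g).mpr hvg⟩
  have hg' : g' ≠ 0 := fun h => hg (congrArg Subtype.val h)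
  have : Nontrivial W := ⟨g', 0, hg'⟩
  -- Symmetry makes the complement of `v` invariant; there the supremum of the Rayleigh quotient is
  -- an eigenvalue, and `g` bounds it from below.
  have heig := hS.hasEigenvalue_iSup_of_finiteDimensional
  set l : ℝ := ⨆ x : {x : W // x ≠ 0}, RCLike.re (inner ℝ (S x) (x : W)) / ‖(x : W)‖ ^ 2 with hl
  obtain ⟨w, hw⟩ := heig.exists_hasEigenvector
  refine ⟨l, ?_, w, fun h => hw.2 (Subtype.ext h), (hmem _).mp w.2, ?_⟩
  · have hbdd : BddAbove (Set.range fun x : {x : W // x ≠ 0} =>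
        RCLike.re (inner ℝ (S x) (x : W)) / ‖(x : W)‖ ^ 2) := by
      refine ⟨‖LinearMap.toContinuousLinearMap S‖, ?_⟩
      rintro _ ⟨x, rfl⟩
      have hx : 0 < ‖(x : W)‖ := norm_pos_iff.mpr x.2
      simp only [RCLike.re_to_real]
      rw [div_le_iff₀ (by positivity)]
      calc inner ℝ (S x) (x : W) ≤ ‖S x‖ * ‖(x : W)‖ := real_inner_le_norm _ _
        _ ≤ (‖LinearMap.toContinuousLinearMap S‖ * ‖(x : W)‖) * ‖(x : W)‖ := by
            gcongr
            exact (LinearMap.toContinuousLinearMap S).le_opNorm x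
        _ = _ := by ring
    have h1 := le_ciSup hbdd ⟨g', hg'⟩
    refine le_trans ?_ h1
    have hgp : 0 < ‖g‖ := norm_pos_iff.mpr hg
    simp only [RCLike.re_to_real]
    rw [le_div_iff₀ (by change 0 < ‖g‖ ^ 2; positivity)]
    exact hκ
  · have := hw.apply_eq_smul
    exact congrArg Subtype.val this

section Gap

variable {V : Type*} [Fintype V] [DecidableEq V] {G : SimpleGraph V} [DecidableRel G.Adj]
  {p q : ℝ}

/-- The transition matrix conjugated by the square root of the stationary measure. -/
noncomputable def symmetrized (G : SimpleGraph V) [DecidableRel G.Adj] (p q : ℝ) :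
    EuclideanSpace ℝ (Finset G.edgeSet) →ₗ[ℝ] EuclideanSpace ℝ (Finset G.edgeSet) :=
  Matrix.toEuclideanLin (Matrix.of fun A B =>
    Real.sqrt (prob G p q A) * transition G p q A B / Real.sqrt (prob G p q B))

lemma symmetrized_apply (x : EuclideanSpace ℝ (Finset G.edgeSet)) (A : Finset G.edgeSet) :
    symmetrized G p q x A = Real.sqrt (prob G p q A) *
      (transition G p q).mulVec (fun B => x B / Real.sqrt (prob G p q B)) A := by
  rw [symmetrized, Matrix.toLpLin_apply]
  simp only [Matrix.mulVec, dotProduct, Matrix.of_apply, Finset.mul_sum]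
  exact Finset.sum_congr rfl fun B _ => by ring

lemma inner_symmetrized (hp : p ∈ Set.Ioo (0 : ℝ) 1) (hq : 0 < q)
    (x y : EuclideanSpace ℝ (Finset G.edgeSet)) :
    inner ℝ (symmetrized G p q x) y = ∑ A, prob G p q A *
      ((transition G p q).mulVec (fun B => x B / Real.sqrt (prob G p q B)) A *
        (y A / Real.sqrt (prob G p q A))) := by
  rw [PiLp.inner_apply]
  refine Finset.sum_congr rfl fun A _ => ?_
  have h1 := prob_pos G hp hq A
  have h2 : Real.sqrt (prob G p q A) ≠ 0 := (Real.sqrt_pos.mpr h1).ne'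
  rw [symmetrized_apply]
  simp only [RCLike.inner_apply, conj_trivial]
  nth_rewrite 2 [← Real.mul_self_sqrt h1.le]
  field_simp

lemma symmetrized_isSymmetric (hp : p ∈ Set.Ioo (0 : ℝ) 1) (hq : 0 < q) :
    (symmetrized G p q).IsSymmetric := by
  intro x y
  rw [inner_symmetrized hp hq, real_inner_comm, inner_symmetrized hp hq,
    sum_prob_transition hp hq]
  exact Finset.sum_congr rfl fun A _ => by ring

/-- A function of a single edge shows that the gap is at most `1 / m`. -/
lemma exists_eigenfunction (hp : p ∈ Set.Ioo (0 : ℝ) 1) (hq : 0 < q) [Nonempty G.edgeSet] :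
    ∃ l, 1 - 1 / (Fintype.card G.edgeSet : ℝ) ≤ l ∧ ∃ f : Finset G.edgeSet → ℝ, f ≠ 0 ∧
      ∑ A, prob G p q A * f A = 0 ∧ (transition G p q).mulVec f = l • f := by
  classical
  set s : Finset G.edgeSet → ℝ := fun A => Real.sqrt (prob G p q A) with hs
  have hspos : ∀ A, 0 < s A := fun A => Real.sqrt_pos.mpr (prob_pos G hp hq A)
  have hss : ∀ A, s A * s A = prob G p q A := fun A => Real.mul_self_sqrt (prob_pos G hp hq A).le
  have hinner : ∀ y : EuclideanSpace ℝ (Finset G.edgeSet),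
      inner ℝ (WithLp.toLp 2 s : EuclideanSpace ℝ (Finset G.edgeSet)) y =
        ∑ A, prob G p q A * (y A / s A) := by
    intro y
    rw [PiLp.inner_apply]
    refine Finset.sum_congr rfl fun A _ => ?_
    simp only [RCLike.inner_apply, conj_trivial]
    rw [← hss]
    field_simp [(hspos A).ne']
  let e₀ : G.edgeSet := Classical.arbitrary _
  have hsum : ∑ A, prob G p q A = 1 := by
    simp only [prob]
    rw [← Finset.sum_div]
    exact div_self (partitionFunction_pos G hp hq).ne'
  set c : ℝ := ∑ A, prob G p q A * (if e₀ ∈ A then 1 else 0) with hc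
  -- The test function is the centred indicator of one edge. It is nonzero because its values at the
  -- empty and the full configuration differ by one.
  let F : Finset G.edgeSet → ℝ := fun A => (if e₀ ∈ A then 1 else 0) - c
  have hF0 : ∑ A, prob G p q A * F A = 0 := by
    simp only [F, mul_sub, Finset.sum_sub_distrib, ← Finset.sum_mul, hsum]
    rw [← hc]; ring
  let g : EuclideanSpace ℝ (Finset G.edgeSet) := WithLp.toLp 2 (fun A => s A * F A)
  have hgs : ∀ A, g A / s A = F A := fun A => by
    change s A * F A / s A = F A
    field_simp [(hspos A).ne']
  have hg0 : g ≠ 0 := by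
    intro h
    have h1 : ∀ A, F A = 0 := fun A => by rw [← hgs, h]; simp
    have h2 := h1 ∅
    have h3 := h1 Finset.univ
    simp only [F, Finset.notMem_empty, if_false, Finset.mem_univ, if_true] at h2 h3
    linarith
  have hT := symmetrized_isSymmetric (G := G) hp hq
  have hv : symmetrized G p q (WithLp.toLp 2 s) = WithLp.toLp 2 s := by
    ext A
    rw [symmetrized_apply]
    have : (fun B => (WithLp.toLp 2 s : EuclideanSpace ℝ (Finset G.edgeSet)) B /
        Real.sqrt (prob G p q B)) = fun _ => 1 := by
      ext B; exact div_self (hspos B).ne'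
    rw [this, transition_mulVec_const, mul_one]
  have hvg : inner ℝ (WithLp.toLp 2 s : EuclideanSpace ℝ (Finset G.edgeSet)) g = 0 := by
    rw [hinner]
    simp only [hgs]
    exact hF0
  have hκ : (1 - 1 / (Fintype.card G.edgeSet : ℝ)) * ‖g‖ ^ 2 ≤ inner ℝ (symmetrized G p q g) g := by
    rw [inner_symmetrized hp hq, EuclideanSpace.norm_sq_eq]
    have h2 : ∀ A, g A / Real.sqrt (prob G p q A) = F A := fun A => hgs A
    have h3 : ∀ A, ‖g A‖ ^ 2 = prob G p q A * (F A * F A) := by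
      intro A
      rw [Real.norm_eq_abs, sq_abs, ← hss]
      change (s A * F A) ^ 2 = _
      ring
    simp only [h2, h3]
    refine le_sum_prob_transition hp hq e₀ F fun e he A => ?_
    simp [F, he.symm]
  obtain ⟨l, hl, w, hw0, hvw, hTw⟩ := exists_eigenvector_orthogonal hT hv hg0 hvg hκ
  refine ⟨l, hl, fun A => w A / s A, ?_, ?_, ?_⟩
  · intro h
    apply hw0
    ext A
    have := congrFun h A
    simp only [Pi.zero_apply, div_eq_zero_iff, (hspos A).ne', or_false] at this
    exact this
  · rw [← hinner]; exact hvw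
  · ext A
    have h1 : symmetrized G p q w A = l * w A := by rw [hTw]; rfl
    rw [symmetrized_apply] at h1
    have h2 := (hspos A).ne'
    change s A * _ = _ at h1
    change _ = l * (w A / s A)
    rw [eq_comm, ← mul_div_assoc, ← h1]
    field_simp
    rfl

/-- The relaxation time is bounded below by the number of edges and above through the coupling
tail. -/
lemma IsNoise.relaxationTime_bounds {r : ℝ} [Nonempty G.edgeSet] {Ω : Type*} [MeasurableSpace Ω]
    {μ : Measure Ω} {𝓔 : ℕ → Ω → G.edgeSet} {U : ℕ → Ω → ℝ} (h : IsNoise G μ 𝓔 U)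
    (H : IsTwoLevel G p q r) (hq : 0 < q) {n : ℕ} {θ : ℝ} (hθ0 : 0 ≤ θ) (hθ1 : θ < 1)
    (hn : n ≠ 0)
    (htail : μ.real {ω | topChain G p q (fun i => 𝓔 i ω) (fun i => U i ω) n ≠
      bottomChain G p q (fun i => 𝓔 i ω) (fun i => U i ω) n} ≤ θ ^ n) :
    (Fintype.card G.edgeSet : ℝ) ≤ relaxationTime G p q ∧
      relaxationTime G p q ≤ 1 / (1 - θ) := by
  have hp : p ∈ Set.Ioo (0 : ℝ) 1 := ⟨H.pos.trans_le H.le, H.lt_one⟩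
  have hm : (0 : ℝ) < Fintype.card G.edgeSet := by exact_mod_cast Fintype.card_pos
  have hupper : ∀ l ∈ {l : ℝ | l ≠ 1 ∧
      Module.End.HasEigenvalue (Matrix.toLin' (transition G p q)) l}, l ≤ θ := by
    rintro l ⟨hl1, hl⟩
    have h1 := (h.abs_eigenvalue_pow_le H hl hl1 n).trans htail
    exact (le_abs_self l).trans (le_of_pow_le_pow_left₀ hn hθ0 h1)
  obtain ⟨l, hl, f, hf0, hfs, hf⟩ := exists_eigenfunction (G := G) hp hq
  have hlmem : l ∈ {l : ℝ | l ≠ 1 ∧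
      Module.End.HasEigenvalue (Matrix.toLin' (transition G p q)) l} := by
    refine ⟨?_, Module.End.hasEigenvalue_of_hasEigenvector (x := f) ?_⟩
    -- An eigenfunction for `1` would be constant, hence zero since its mean is zero; the other
    -- alternative, `1 ≤ θ ^ n`, is excluded by `θ < 1`.
    · rintro rfl
      rcases h.eigen_oscillation H hf n with hc | hc
      · apply hf0
        have hfc : ∀ A, f A = f ∅ := fun A => hc A ∅
        simp only [hfc] at hfs
        rw [← Finset.sum_mul, mul_eq_zero] at hfs
        have h1 : 0 < ∑ A, prob G p q A :=
          Finset.sum_pos (fun A _ => prob_pos G hp hq A) Finset.univ_nonempty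
        ext A
        rw [hfc A]
        exact hfs.resolve_left h1.ne'
      · rw [abs_one, one_pow] at hc
        have := pow_lt_one₀ hθ0 hθ1 hn
        linarith
    · rw [Module.End.hasEigenvector_iff, Module.End.mem_eigenspace_iff, Matrix.toLin'_apply]
      exact ⟨hf, hf0⟩
  have h1 : l ≤ secondEigenvalue G p q := le_csSup ⟨θ, hupper⟩ hlmem
  have h2 : secondEigenvalue G p q ≤ θ := csSup_le ⟨l, hlmem⟩ hupper
  have h3 : 0 < 1 - secondEigenvalue G p q := by linarith
  refine ⟨?_, ?_⟩
  · rw [relaxationTime, le_div_iff₀ h3]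
    have h4 : 1 - secondEigenvalue G p q ≤ 1 / (Fintype.card G.edgeSet : ℝ) := by linarith
    calc _ ≤ (Fintype.card G.edgeSet : ℝ) * (1 / (Fintype.card G.edgeSet : ℝ)) := by gcongr
      _ = 1 := by field_simp
  · rw [relaxationTime]
    exact one_div_le_one_div_of_le (by linarith) (by linarith)

end Gap
-- Moments of a hitting time from its tail
section Hitting

variable {Ω : Type*} [MeasurableSpace Ω] {μ : Measure Ω}

/-- Existence cannot be dropped: `sInf ∅ = 0` would make the left side false although `Q r` fails.
-/
lemma lt_sInf_iff_of_monotone {Q : ℕ → Prop} (hmono : ∀ s t, s ≤ t → Q s → Q t)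
    (hex : ∃ t, Q t) (r : ℕ) : r < sInf {t | Q t} ↔ ¬ Q r := by
  constructor
  · intro h hr
    exact absurd (Nat.sInf_le (s := {t | Q t}) hr) (not_le.mpr h)
  · intro h
    by_contra! hle
    exact h (hmono _ _ hle (Nat.sInf_mem (s := {t | Q t}) hex))

variable {Q : ℕ → Ω → Prop}

lemma measurable_hittingTime (hmono : ∀ ω s t, s ≤ t → Q s ω → Q t ω)
    (hmeas : ∀ t, MeasurableSet {ω | ¬ Q t ω}) :
    Measurable (fun ω => sInf {t | Q t ω}) := by
  refine measurable_of_Ioi fun r => ?_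
  -- If `Q` never holds, the time has the default value `0`; exceeding `r` therefore also requires
  -- that `Q` holds eventually.
  have : (fun ω => sInf {t | Q t ω}) ⁻¹' Set.Ioi r =
      (⋃ t, {ω | ¬ Q t ω}ᶜ) ∩ {ω | ¬ Q r ω} := by
    ext ω
    simp only [Set.mem_preimage, Set.mem_Ioi, Set.mem_inter_iff, Set.mem_iUnion,
      Set.mem_compl_iff, Set.mem_ofPred_eq, not_not]
    constructor
    · intro h
      have hex : ∃ t, Q t ω := by
        by_contra! hno
        have : {t | Q t ω} = ∅ := by ext t; simp [hno t]
        rw [this, Nat.sInf_empty] at h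
        omega
      exact ⟨hex, (lt_sInf_iff_of_monotone (hmono ω) hex r).mp h⟩
    · rintro ⟨hex, h⟩
      exact (lt_sInf_iff_of_monotone (hmono ω) hex r).mpr h
  rw [this]
  exact (MeasurableSet.iUnion fun t => (hmeas t).compl).inter (hmeas r)

lemma ae_exists_of_summable [IsProbabilityMeasure μ]
    (hsum : Summable fun t => μ.real {ω | ¬ Q t ω}) : ∀ᵐ ω ∂μ, ∃ t, Q t ω := by
  have h0 := hsum.tendsto_atTop_zero
  rw [ae_iff]
  have hle : ∀ t, μ.real {ω | ¬ ∃ t, Q t ω} ≤ μ.real {ω | ¬ Q t ω} := fun t =>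
    measureReal_mono fun ω hω hQ => hω ⟨t, hQ⟩
  have := ge_of_tendsto' h0 hle
  exact (measureReal_eq_zero_iff).mp (le_antisymm this measureReal_nonneg)

/-- Weighted tail sums are expectations of functions of a hitting time. -/
lemma integral_sum_range_hittingTime [IsProbabilityMeasure μ]
    (hmono : ∀ ω s t, s ≤ t → Q s ω → Q t ω) (hmeas : ∀ t, MeasurableSet {ω | ¬ Q t ω})
    (hex : ∀ᵐ ω ∂μ, ∃ t, Q t ω) {b : ℕ → ℝ} (hb : ∀ r, 0 ≤ b r) {m : ℝ}
    (hsum : HasSum (fun r => b r * μ.real {ω | ¬ Q r ω}) m) :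
    Integrable (fun ω => ∑ r ∈ Finset.range (sInf {t | Q t ω}), b r) μ ∧
      ∫ ω, ∑ r ∈ Finset.range (sInf {t | Q t ω}), b r ∂μ = m := by
  have hmeasf : Measurable (fun ω => ∑ r ∈ Finset.range (sInf {t | Q t ω}), b r) :=
    (measurable_of_countable (fun k : ℕ => ∑ r ∈ Finset.range k, b r)).comp
      (measurable_hittingTime hmono hmeas)
  have hnn : ∀ ω, 0 ≤ ∑ r ∈ Finset.range (sInf {t | Q t ω}), b r := fun ω =>
    Finset.sum_nonneg fun r _ => hb r
  -- Layer-cake form: `r` lies below the hitting time exactly when `Q r` fails, so the finite sum is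
  -- a series of indicators, to be integrated term by term.
  have hpt : ∀ᵐ ω ∂μ, ENNReal.ofReal (∑ r ∈ Finset.range (sInf {t | Q t ω}), b r) =
      ∑' r, Set.indicator {ω | ¬ Q r ω} (fun _ => ENNReal.ofReal (b r)) ω := by
    filter_upwards [hex] with ω hω
    rw [ENNReal.ofReal_sum_of_nonneg fun r _ => hb r,
      tsum_eq_sum (s := Finset.range (sInf {t | Q t ω}))]
    · refine Finset.sum_congr rfl fun r hr => ?_
      have : ¬ Q r ω :=
        (lt_sInf_iff_of_monotone (hmono ω) hω r).mp (Finset.mem_range.mp hr)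
      simp [Set.indicator, this]
    · intro r hr
      have : Q r ω := by
        by_contra h
        exact hr (Finset.mem_range.mpr ((lt_sInf_iff_of_monotone (hmono ω) hω r).mpr h))
      simp [Set.indicator, this]
  have hlint : ∫⁻ ω, ENNReal.ofReal (∑ r ∈ Finset.range (sInf {t | Q t ω}), b r) ∂μ =
      ENNReal.ofReal m := by
    rw [lintegral_congr_ae hpt, lintegral_tsum fun r =>
      (measurable_const.indicator (hmeas r)).aemeasurable, ← hsum.tsum_eq,
      ENNReal.ofReal_tsum_of_nonneg (fun r => mul_nonneg (hb r) measureReal_nonneg) hsum.summable]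
    refine tsum_congr fun r => ?_
    rw [lintegral_indicator_const (hmeas r), ENNReal.ofReal_mul (hb r), measureReal_def,
      ENNReal.ofReal_toReal (measure_ne_top _ _)]
  have hm : 0 ≤ m := hsum.nonneg fun r => mul_nonneg (hb r) measureReal_nonneg
  refine ⟨⟨hmeasf.aestronglyMeasurable, ?_⟩, ?_⟩
  · rw [hasFiniteIntegral_iff_ofReal (Eventually.of_forall hnn), hlint]
    exact ENNReal.ofReal_lt_top
  · rw [integral_eq_lintegral_of_nonneg_ae (Eventually.of_forall hnn)
      hmeasf.aestronglyMeasurable, hlint, ENNReal.toReal_ofReal hm]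

lemma sum_range_two_mul_add_one (N : ℕ) :
    ∑ r ∈ Finset.range N, (2 * (r : ℝ) + 1) = (N : ℝ) ^ 2 := by
  induction N with
  | zero => simp
  | succ N ih => rw [Finset.sum_range_succ, ih]; push_cast; ring

/-- First and second moment of a hitting time from its tail. -/
lemma hittingTime_moments [IsProbabilityMeasure μ]
    (hmono : ∀ ω s t, s ≤ t → Q s ω → Q t ω) (hmeas : ∀ t, MeasurableSet {ω | ¬ Q t ω})
    {m₁ m₂ : ℝ} (h₁ : HasSum (fun r => μ.real {ω | ¬ Q r ω}) m₁)
    (h₂ : HasSum (fun r : ℕ => (2 * (r : ℝ) + 1) * μ.real {ω | ¬ Q r ω}) m₂) :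
    (∀ᵐ ω ∂μ, ∃ t, Q t ω) ∧ MemLp (fun ω => ((sInf {t | Q t ω} : ℕ) : ℝ)) 2 μ ∧
      ∫ ω, ((sInf {t | Q t ω} : ℕ) : ℝ) ∂μ = m₁ ∧
      ∫ ω, ((sInf {t | Q t ω} : ℕ) : ℝ) ^ 2 ∂μ = m₂ := by
  have hex := ae_exists_of_summable h₁.summable
  -- Weights `1` sum to the time itself, weights `2 r + 1` to its square.
  have i₁ := integral_sum_range_hittingTime hmono hmeas hex (b := fun _ => 1)
    (fun _ => zero_le_one) (by simpa using h₁)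
  have i₂ := integral_sum_range_hittingTime hmono hmeas hex (b := fun r => 2 * (r : ℝ) + 1)
    (fun _ => by positivity) h₂
  simp only [sum_range_two_mul_add_one] at i₂
  simp only [Finset.sum_const, Finset.card_range, nsmul_eq_mul, mul_one] at i₁
  have hm : AEStronglyMeasurable (fun ω => ((sInf {t | Q t ω} : ℕ) : ℝ)) μ :=
    ((measurable_of_countable (fun k : ℕ => (k : ℝ))).comp
      (measurable_hittingTime hmono hmeas)).aestronglyMeasurable
  exact ⟨hex, (memLp_two_iff_integrable_sq hm).mpr i₂.1, i₁.2, i₂.2⟩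

end Hitting

/-! ### Comparison of weighted tail sums -/

section TailSums

/-- By monotonicity, decay along multiples of `n` is geometric decay with ratio the `n`-th root of
the block factor. -/
lemma summable_of_geometric_blocks {a : ℕ → ℝ} (ha0 : ∀ t, 0 ≤ a t) (hanti : Antitone a) {n : ℕ}
    (hn : n ≠ 0) {ε : ℝ} (hε : ε < 1) (ha : ∀ k, a (k * n) ≤ ε ^ k) :
    Summable fun t : ℕ => (2 * (t : ℝ) + 1) * a t := by
  have hε0 : 0 ≤ ε := by
    have := (ha0 (1 * n)).trans (ha 1)
    simpa using this
  -- The maximum with `1 / 2` keeps the ratio positive, so that the incomplete last block can be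
  -- paid for by dividing by `ε'`.
  set ε' := max ε (1 / 2) with hε'
  have h0 : 0 < ε' := lt_max_of_lt_right (by norm_num)
  have h1 : ε' < 1 := max_lt hε (by norm_num)
  set x : ℝ := ε' ^ ((n : ℝ)⁻¹) with hx
  have hx0 : 0 < x := Real.rpow_pos_of_pos h0 _
  have hx1 : x < 1 := Real.rpow_lt_one h0.le h1 (by positivity)
  have hxn : x ^ n = ε' := Real.rpow_inv_natCast_pow h0.le hn
  have hbound : ∀ t, a t ≤ x ^ t / ε' := by
    intro t
    have ht : t / n * n ≤ t := Nat.div_mul_le_self t n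
    rw [le_div_iff₀ h0]
    calc a t * ε' ≤ ε ^ (t / n) * ε' := by
          gcongr
          exact (hanti ht).trans (ha _)
      _ ≤ ε' ^ (t / n) * ε' := by
          gcongr
          exact le_max_left _ _
      _ = x ^ (n * (t / n) + n) := by rw [pow_add, pow_mul, hxn]
      _ ≤ x ^ t := by
          refine pow_le_pow_of_le_one hx0.le hx1.le ?_
          have := Nat.div_add_mod t n
          have := Nat.mod_lt t (Nat.pos_of_ne_zero hn)
          omega
  refine Summable.of_nonneg_of_le (fun t => mul_nonneg (by positivity) (ha0 t)) (fun t => ?_)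
    ((hasSum_geometric_weighted hx0.le hx1).summable.mul_right (1 / ε'))
  calc (2 * (t : ℝ) + 1) * a t ≤ (2 * (t : ℝ) + 1) * (x ^ t / ε') := by
        gcongr; exact hbound t
    _ = _ := by ring

lemma summable_of_summable_weighted {a : ℕ → ℝ} (ha0 : ∀ t, 0 ≤ a t)
    (h : Summable fun t : ℕ => (2 * (t : ℝ) + 1) * a t) : Summable a := by
  refine Summable.of_nonneg_of_le ha0 (fun t => ?_) h
  have : 0 ≤ 2 * (t : ℝ) * a t := mul_nonneg (by positivity) (ha0 t)
  linarith

/-- By Bernoulli's inequality `(1 - 1 / (2 m)) ^ (2 m) ≥ 1 / 4 ≥ ε`, so all but one of the block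
factors can be traded for geometric decay. The factor `ε` that is kept makes the far tail
negligible. -/
lemma le_geometric_of_blocks {a : ℕ → ℝ} (hanti : Antitone a) {m : ℕ} (hm : 1 ≤ m)
    {ε : ℝ} (hε0 : 0 ≤ ε) (hε : ε ≤ 1 / 4) (ha : ∀ k, a (k * (2 * m)) ≤ ε ^ k) {t : ℕ}
    (ht : 2 * m ≤ t) : a t ≤ 16 * ε * (1 - 1 / (2 * m : ℝ)) ^ t := by
  have hm' : (1 : ℝ) ≤ m := by exact_mod_cast hm
  have hb0 : 0 ≤ 1 - 1 / (2 * m : ℝ) := by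
    rw [sub_nonneg, div_le_one (by positivity)]; linarith
  have hb1 : 1 - 1 / (2 * m : ℝ) ≤ 1 := by
    have : 0 ≤ 1 / (2 * m : ℝ) := by positivity
    linarith
  have hq : (1 / 4 : ℝ) ≤ (1 - 1 / (2 * m : ℝ)) ^ (2 * m) := by
    have h := one_add_mul_le_pow (a := -(1 / (2 * m : ℝ))) (by linarith) m
    have h2 : 1 + (m : ℝ) * -(1 / (2 * m : ℝ)) = 1 / 2 := by field_simp; norm_num
    rw [h2, ← sub_eq_add_neg] at h
    rw [mul_comm 2 m, pow_mul]
    nlinarith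
  set k := t / (2 * m) with hk
  have hkpos : 1 ≤ k := (Nat.one_le_div_iff (by omega)).mpr ht
  obtain ⟨j, hj⟩ : ∃ j, k = j + 1 := ⟨k - 1, by omega⟩
  have htk : t ≤ 2 * m * (k + 1) := by
    have h1 := Nat.div_add_mod t (2 * m)
    have h2 := Nat.mod_lt t (show 0 < 2 * m by omega)
    rw [← hk] at h1
    nlinarith
  calc a t ≤ a (k * (2 * m)) := hanti (Nat.div_mul_le_self t (2 * m))
    _ ≤ ε ^ k := ha k
    _ = ε * ε ^ j := by rw [hj, pow_succ]; ring
    _ ≤ ε * (1 / 4) ^ j := by gcongr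
    -- With `k = j + 1`, two extra factors `1 / 4` are inserted: one for the retained `ε`, one for
    -- the incomplete block.
    _ = 16 * ε * (1 / 4) ^ (k + 1) := by rw [hj]; ring
    _ ≤ 16 * ε * ((1 - 1 / (2 * m : ℝ)) ^ (2 * m)) ^ (k + 1) := by gcongr
    _ ≤ 16 * ε * (1 - 1 / (2 * m : ℝ)) ^ t := by
        rw [← pow_mul]
        gcongr 16 * ε * ?_
        exact pow_le_pow_of_le_one hb0 hb1 htk

lemma hasSum_ite_range (f : ℕ → ℝ) (N : ℕ) :
    HasSum (fun t => if t ∈ Finset.range N then f t else 0) (∑ t ∈ Finset.range N, f t) := by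
  have h : HasSum (fun t => if t ∈ Finset.range N then f t else 0)
      (∑ t ∈ Finset.range N, if t ∈ Finset.range N then f t else 0) :=
    hasSum_sum_of_ne_finset_zero fun t ht => if_neg ht
  rwa [Finset.sum_congr rfl fun t ht => if_pos ht] at h

/-- A second moment bound by comparison with a shifted tail `w`. -/
lemma tsum_weighted_le {a w : ℕ → ℝ} (ha1 : ∀ t, a t ≤ 1)
    (hanti : Antitone a) (hw0 : ∀ r, 0 ≤ w r) {s m : ℕ} (hm : 1 ≤ m) {δ ε M₁ M₂ : ℝ}
    (hδ : 0 ≤ δ) (hshift : ∀ r, a (s + r) ≤ w r + r * δ) (hε0 : 0 ≤ ε) (hε : ε ≤ 1 / 4)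
    (ha : ∀ k, a (k * (2 * m)) ≤ ε ^ k) (h₁ : HasSum w M₁)
    (h₂ : HasSum (fun r : ℕ => (2 * (r : ℝ) + 1) * w r) M₂) {A : ℝ}
    (hA : HasSum (fun t : ℕ => (2 * (t : ℝ) + 1) * a t) A) :
    A ≤ M₂ + (s : ℝ) ^ 2 + 2 * s * M₁ + 8 * (m : ℝ) ^ 3 * δ + 128 * ε * (m : ℝ) ^ 2 := by
  have hm' : (1 : ℝ) ≤ m := by exact_mod_cast hm
  have hb0 : 0 ≤ 1 - 1 / (2 * m : ℝ) := by
    rw [sub_nonneg, div_le_one (by positivity)]; linarith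
  have hb1 : 1 - 1 / (2 * m : ℝ) < 1 := by
    have : 0 < 1 / (2 * m : ℝ) := by positivity
    linarith
  -- the four summands of the bound
  have s1 : HasSum (fun t : ℕ => if t ∈ Finset.range s then (2 * (t : ℝ) + 1) else 0)
      ((s : ℝ) ^ 2) := by
    rw [← sum_range_two_mul_add_one]
    exact hasSum_ite_range _ s
  have s2 : HasSum (fun t : ℕ => if t ∈ Finset.range (2 * m) then
      (2 * m * δ) * (2 * (t : ℝ) + 1) else 0) (8 * (m : ℝ) ^ 3 * δ) := by
    have e : 8 * (m : ℝ) ^ 3 * δ =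
        ∑ t ∈ Finset.range (2 * m), (2 * m * δ) * (2 * (t : ℝ) + 1) := by
      rw [← Finset.mul_sum, sum_range_two_mul_add_one]; push_cast; ring
    rw [e]
    exact hasSum_ite_range _ (2 * m)
  have s3 : HasSum (fun t : ℕ => if s ≤ t then (2 * (t : ℝ) + 1) * w (t - s) else 0)
      (M₂ + 2 * s * M₁) := by
    -- The shift changes the weight to `2 (s + r) + 1 = (2 r + 1) + 2 s`.
    have h := h₂.add (h₁.mul_left (2 * (s : ℝ)))
    rw [← hasSum_nat_add_iff' s]
    have hz : ∑ i ∈ Finset.range s,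
        (if s ≤ i then (2 * (i : ℝ) + 1) * w (i - s) else 0) = 0 :=
      Finset.sum_eq_zero fun i hi => if_neg (by have := Finset.mem_range.mp hi; omega)
    rw [hz, sub_zero]
    convert! h using 1
    ext r
    rw [if_pos (by omega), Nat.add_sub_cancel]
    push_cast; ring
  have s4 := (hasSum_geometric_weighted hb0 hb1).mul_left (16 * ε)
  have hall := ((s1.add s2).add s3).add s4
  have hle := hasSum_le (fun t => ?_) hA hall
  · refine hle.trans ?_
    have : 2 / (1 - (1 - 1 / (2 * m : ℝ))) ^ 2 - 1 / (1 - (1 - 1 / (2 * m : ℝ))) =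
        8 * (m : ℝ) ^ 2 - 2 * m := by
      rw [sub_sub_cancel]; field_simp; ring
    rw [this]
    have : 0 ≤ ε * m := by positivity
    linarith
  · have hg : 0 ≤ 16 * ε * ((2 * (t : ℝ) + 1) * (1 - 1 / (2 * m : ℝ)) ^ t) := by positivity
    have hc : 0 ≤ (if s ≤ t then (2 * (t : ℝ) + 1) * w (t - s) else 0) := by
      split_ifs
      · exact mul_nonneg (by positivity) (hw0 _)
      · exact le_rfl
    have ht0 : (0 : ℝ) < 2 * t + 1 := by positivity
    -- Three ranges: `a t ≤ 1` during the burn-in, the shifted comparison with error at most `2 m δ`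
    -- up to `2 m`, and geometric decay from `2 m` on.
    by_cases h1 : t < s
    · have : (if t ∈ Finset.range (2 * m) then (2 * m * δ) * (2 * (t : ℝ) + 1) else 0) ≥ 0 := by
        split_ifs
        · positivity
        · exact le_rfl
      have h2 := mul_le_mul_of_nonneg_left (ha1 t) ht0.le
      rw [if_pos (Finset.mem_range.mpr h1)]
      linarith
    · rw [if_neg (by simpa using h1)]
      by_cases h2 : t < 2 * m
      · rw [if_pos (Finset.mem_range.mpr h2), if_pos (not_lt.mp h1)]
        obtain ⟨d, rfl⟩ := Nat.exists_eq_add_of_le (not_lt.mp h1)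
        rw [Nat.add_sub_cancel_left]
        have h3 : (d : ℝ) * δ ≤ 2 * m * δ := by
          gcongr
          exact_mod_cast (by omega : d ≤ 2 * m)
        have h4 := mul_le_mul_of_nonneg_left ((hshift d).trans (add_le_add_right h3 _)) ht0.le
        linarith
      · have h3 := le_geometric_of_blocks hanti hm hε0 hε ha (not_lt.mp h2)
        have h4 := mul_le_mul_of_nonneg_left h3 ht0.le
        rw [if_neg (by simpa using h2)]
        linarith

end TailSums
-- Moments of the coupling time and of the coupon collector time
section Times

variable {V : Type*} [Fintype V] [DecidableEq V] {G : SimpleGraph V} [DecidableRel G.Adj]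
  {p q r : ℝ}

/-- When `u > p`, the update closes its edge in every configuration. A sweep of such updates empties
all chains. -/
lemma IsTwoLevel.coalesced_of_closing (H : IsTwoLevel G p q r) {e : ℕ → G.edgeSet} {u : ℕ → ℝ}
    {n : ℕ} (hu : ∀ i < n, p < u i) (hcov : Covers e n) :
    topChain G p q e u n = bottomChain G p q e u n := by
  have key : ∀ A : Finset G.edgeSet, ∀ t ≤ n, ∀ x ∈ chain G p q A e u t, ∀ i < t, e i ≠ x := by
    intro A t
    induction t with
    | zero => intro _ x _ i hi; omega
    | succ t ih =>
      intro ht x hx i hi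
      rw [chain, mem_update] at hx
      rcases hx with ⟨-, hle⟩ | ⟨hne, hx⟩
      · have h1 := (H.occProb_mem (chain G p q A e u t) (e t)).2
        have h2 := hu t (by omega)
        linarith
      · rcases Nat.lt_succ_iff_lt_or_eq.mp hi with h | rfl
        · exact ih (by omega) x hx i h
        · exact hne.symm
  have hempty : ∀ A : Finset G.edgeSet, chain G p q A e u n = ∅ := by
    intro A
    rw [Finset.eq_empty_iff_forall_notMem]
    intro x hx
    obtain ⟨i, hi, hix⟩ := covers_iff.mp hcov x
    exact key A n le_rfl x hx i hi hix
  rw [topChain, bottomChain, hempty, hempty]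

lemma exists_covers {E : Type*} [Fintype E] [DecidableEq E] [Nonempty E] :
    ∃ x : ℕ → E, Covers x (Fintype.card E) := by
  refine ⟨fun i => if h : i < Fintype.card E then (Fintype.equivFin E).symm ⟨i, h⟩ else
    Classical.arbitrary E, covers_iff.mpr fun y => ⟨Fintype.equivFin E y, Fin.is_lt _, ?_⟩⟩
  simp

variable [Nonempty G.edgeSet] {Ω : Type*} [MeasurableSpace Ω] {μ : Measure Ω}
  {𝓔 : ℕ → Ω → G.edgeSet} {U : ℕ → Ω → ℝ}

/-- The chains coalesce within one sweep with a positive probability. -/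
lemma IsNoise.measureReal_not_coalesced_card_le (h : IsNoise G μ 𝓔 U) (H : IsTwoLevel G p q r) :
    μ.real {ω | topChain G p q (fun i => 𝓔 i ω) (fun i => U i ω) (Fintype.card G.edgeSet) ≠
      bottomChain G p q (fun i => 𝓔 i ω) (fun i => U i ω) (Fintype.card G.edgeSet)} ≤
    1 - ((1 - p) / Fintype.card G.edgeSet) ^ Fintype.card G.edgeSet := by
  have := h.isProbabilityMeasure
  set m := Fintype.card G.edgeSet with hm
  obtain ⟨x, hx⟩ := exists_covers (E := G.edgeSet)
  set S : Set Ω := ⋂ i ∈ Finset.range m,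
    (fun ω => (𝓔 i ω, U i ω)) ⁻¹' (({x i} : Set G.edgeSet) ×ˢ Set.Ioi p) with hS
  have hSm : MeasurableSet S := Finset.measurableSet_biInter _ fun i _ =>
    h.measurable_pair i ((by trivial : MeasurableSet ({x i} : Set G.edgeSet)).prod
      measurableSet_Ioi)
  have hSp : μ.real S = ((1 - p) / m) ^ m := by
    rw [hS, measureReal_def, h.indep_seq.meas_biInter fun i _ =>
      ⟨_, (by trivial : MeasurableSet ({x i} : Set G.edgeSet)).prod measurableSet_Ioi, rfl⟩,
      ENNReal.toReal_prod]
    calc _ = ∏ _i ∈ Finset.range m, (1 - p) / (m : ℝ) := by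
          refine Finset.prod_congr rfl fun i _ => ?_
          have h1 : (fun ω => (𝓔 i ω, U i ω)) ⁻¹' (({x i} : Set G.edgeSet) ×ˢ Set.Ioi p) =
              𝓔 i ⁻¹' {x i} ∩ U i ⁻¹' Set.Ioi p := by
            ext ω; simp
          have h2 := h.measureReal_edge i {x i}
          rw [Finset.coe_singleton, Finset.card_singleton, Nat.cast_one] at h2
          have h3 : μ.real (U i ⁻¹' Set.Ioi p) = 1 - p := by
            have h4 : U i ⁻¹' Set.Ioi p = {ω | U i ω ≤ p}ᶜ := by ext ω; simp
            have h5 : MeasurableSet {ω | U i ω ≤ p} := h.measurable_unif i measurableSet_Iic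
            rw [h4, probReal_compl_eq_one_sub h5,
              h.measureReal_unif_le i (H.pos.trans_le H.le).le H.lt_one.le]
          rw [h1, (h.indep_pair i).measure_inter_preimage_eq_mul _ _ (by trivial) measurableSet_Ioi,
            ENNReal.toReal_mul, ← measureReal_def, ← measureReal_def, h2, h3]
          ring
      _ = _ := by simp [div_pow]
  rw [← hSp, ← probReal_compl_eq_one_sub hSm]
  refine measureReal_mono fun ω hω hωS => hω ?_
  simp only [hS, Set.mem_iInter, Finset.mem_range, Set.mem_preimage, Set.mem_prod,
    Set.mem_singleton_iff, Set.mem_Ioi] at hωS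
  refine H.coalesced_of_closing (fun i hi => (hωS i hi).2) ?_
  rw [covers_iff] at hx ⊢
  intro y
  obtain ⟨i, hi, hy⟩ := hx y
  exact ⟨i, hi, by rw [(hωS i hi).1, hy]⟩

lemma IsNoise.antitone_not_coalesced (h : IsNoise G μ 𝓔 U) :
    Antitone fun t => μ.real {ω | ¬ topChain G p q (fun i => 𝓔 i ω) (fun i => U i ω) t =
      bottomChain G p q (fun i => 𝓔 i ω) (fun i => U i ω) t} := by
  have := h.isProbabilityMeasure
  intro s t hst
  exact measureReal_mono fun ω hω hs => hω (coalesced_mono hst hs)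

/-- The crude positive probability of merging in one sweep suffices here and is available for every
size, whereas the sharper tail bound is informative only for large graphs. -/
lemma IsNoise.summable_not_coalesced (h : IsNoise G μ 𝓔 U) (H : IsTwoLevel G p q r) :
    Summable fun t : ℕ => (2 * (t : ℝ) + 1) *
      μ.real {ω | ¬ topChain G p q (fun i => 𝓔 i ω) (fun i => U i ω) t =
        bottomChain G p q (fun i => 𝓔 i ω) (fun i => U i ω) t} := by
  have hm : (0 : ℝ) < Fintype.card G.edgeSet := by exact_mod_cast Fintype.card_pos
  have hp := sub_pos.mpr H.lt_one
  refine summable_of_geometric_blocks (fun _ => measureReal_nonneg) h.antitone_not_coalesced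
    (n := Fintype.card G.edgeSet) Fintype.card_ne_zero
    (ε := 1 - ((1 - p) / Fintype.card G.edgeSet) ^ Fintype.card G.edgeSet)
    (by have : 0 < ((1 - p) / Fintype.card G.edgeSet) ^ Fintype.card G.edgeSet := by positivity
        linarith) fun k => ?_
  exact h.measureReal_not_coalesced_mul_le H
    (fun t => (h.shift t).measureReal_not_coalesced_card_le H) k

/-- Existence, integrability, and the first two moments of the coupling time. -/
lemma IsNoise.couplingTime_moments (h : IsNoise G μ 𝓔 U) (H : IsTwoLevel G p q r) :
    (∀ᵐ ω ∂μ, ∃ t, topChain G p q (fun i => 𝓔 i ω) (fun i => U i ω) t =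
      bottomChain G p q (fun i => 𝓔 i ω) (fun i => U i ω) t) ∧
    MemLp (fun ω => (couplingTime G p q (fun i => 𝓔 i ω) (fun i => U i ω) : ℝ)) 2 μ ∧
    HasSum (fun t : ℕ => (2 * (t : ℝ) + 1) *
      μ.real {ω | ¬ topChain G p q (fun i => 𝓔 i ω) (fun i => U i ω) t =
        bottomChain G p q (fun i => 𝓔 i ω) (fun i => U i ω) t})
      (∫ ω, (couplingTime G p q (fun i => 𝓔 i ω) (fun i => U i ω) : ℝ) ^ 2 ∂μ) := by
  have := h.isProbabilityMeasure
  have hs2 := h.summable_not_coalesced (p := p) (q := q) H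
  have hs1 := summable_of_summable_weighted (fun _ => measureReal_nonneg) hs2
  obtain ⟨h1, h2, -, h4⟩ := hittingTime_moments (μ := μ)
    (Q := fun t ω => topChain G p q (fun i => 𝓔 i ω) (fun i => U i ω) t =
      bottomChain G p q (fun i => 𝓔 i ω) (fun i => U i ω) t)
    (fun ω s t hst hs => coalesced_mono hst hs)
    (fun t => measurableSet_not_coalesced h.measurable_edge h.measurable_unif t)
    hs1.hasSum hs2.hasSum
  refine ⟨h1, h2, ?_⟩
  have h5 := hs2.hasSum
  rw [← h4] at h5
  exact h5

/-- Existence, integrability, and the first two moments of the coupon collector time. -/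
lemma IsNoise.couponTime_moments (h : IsNoise G μ 𝓔 U) :
    (∀ᵐ ω ∂μ, ∃ t, Covers (fun i => 𝓔 i ω) t) ∧
    MemLp (fun ω => (couponTime G (fun i => 𝓔 i ω) : ℝ)) 2 μ ∧
    ∫ ω, (couponTime G (fun i => 𝓔 i ω) : ℝ) ∂μ =
      Fintype.card G.edgeSet * harm (Fintype.card G.edgeSet) ∧
    ∫ ω, (couponTime G (fun i => 𝓔 i ω) : ℝ) ^ 2 ∂μ =
      (Fintype.card G.edgeSet : ℝ) ^ 2 * (harm (Fintype.card G.edgeSet) ^ 2 +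
        harmSq (Fintype.card G.edgeSet)) -
        Fintype.card G.edgeSet * harm (Fintype.card G.edgeSet) := by
  have := h.isProbabilityMeasure
  simp only [couponTime_eq]
  refine hittingTime_moments (μ := μ) (Q := fun t ω => Covers (fun i => 𝓔 i ω) t)
    (fun ω s t hst hs => hs.mono hst)
    (fun t => measurableSet_not_covers h.measurable_edge t) ?_ ?_
  · simp only [h.measureReal_not_covers]
    exact hasSum_couponTail _
  · simp only [h.measureReal_not_covers]
    exact hasSum_mul_couponTail _

/-- The coupling time is at least the coupon collector time, which is at least the number of
edges. -/
lemma IsNoise.couponTime_le_couplingTime (h : IsNoise G μ 𝓔 U) (H : IsTwoLevel G p q r) :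
    ∀ᵐ ω ∂μ, Fintype.card G.edgeSet ≤ couponTime G (fun i => 𝓔 i ω) ∧
      couponTime G (fun i => 𝓔 i ω) ≤
        couplingTime G p q (fun i => 𝓔 i ω) (fun i => U i ω) := by
  filter_upwards [(h.couplingTime_moments H).1] with ω hω
  have h1 : topChain G p q (fun i => 𝓔 i ω) (fun i => U i ω)
      (couplingTime G p q (fun i => 𝓔 i ω) (fun i => U i ω)) = bottomChain G p q
      (fun i => 𝓔 i ω) (fun i => U i ω)
      (couplingTime G p q (fun i => 𝓔 i ω) (fun i => U i ω)) := Nat.sInf_mem hω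
  have h2 := covers_of_coalesced h1
  rw [couponTime_eq]
  exact ⟨card_le_of_covers (Nat.sInf_mem (s := {t | Covers (fun i => 𝓔 i ω) t}) ⟨_, h2⟩),
    Nat.sInf_le h2⟩

/-- The distribution function of the coupling time. -/
lemma IsNoise.measureReal_couplingTime_le (h : IsNoise G μ 𝓔 U) (H : IsTwoLevel G p q r)
    {a : ℝ} (ha : 0 ≤ a) :
    μ.real {ω | (couplingTime G p q (fun i => 𝓔 i ω) (fun i => U i ω) : ℝ) ≤ a} =
      1 - μ.real {ω | topChain G p q (fun i => 𝓔 i ω) (fun i => U i ω) ⌊a⌋₊ ≠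
        bottomChain G p q (fun i => 𝓔 i ω) (fun i => U i ω) ⌊a⌋₊} := by
  have := h.isProbabilityMeasure
  rw [← probReal_compl_eq_one_sub
    (measurableSet_not_coalesced h.measurable_edge h.measurable_unif _)]
  refine measureReal_congr ?_
  filter_upwards [(h.couplingTime_moments (p := p) (q := q) H).1] with ω hω
  have h1 := lt_sInf_iff_of_monotone (Q := fun t => topChain G p q (fun i => 𝓔 i ω)
    (fun i => U i ω) t = bottomChain G p q (fun i => 𝓔 i ω) (fun i => U i ω) t)
    (fun s t hst hs => coalesced_mono hst hs) hω ⌊a⌋₊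
  have h2 : (couplingTime G p q (fun i => 𝓔 i ω) (fun i => U i ω) : ℝ) ≤ a ↔
      couplingTime G p q (fun i => 𝓔 i ω) (fun i => U i ω) ≤ ⌊a⌋₊ := (Nat.le_floor_iff ha).symm
  refine propext ?_
  change (couplingTime G p q (fun i => 𝓔 i ω) (fun i => U i ω) : ℝ) ≤ a ↔ ¬ ¬ _
  rw [h2, ← h1, not_lt]
  rfl

lemma IsNoise.couponTail_le_measureReal (h : IsNoise G μ 𝓔 U) (t : ℕ) :
    couponTail (Fintype.card G.edgeSet) t ≤
      μ.real {ω | topChain G p q (fun i => 𝓔 i ω) (fun i => U i ω) t ≠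
        bottomChain G p q (fun i => 𝓔 i ω) (fun i => U i ω) t} := by
  have := h.isProbabilityMeasure
  rw [← h.measureReal_not_covers]
  exact measureReal_mono fun ω hω hc => hω (covers_of_coalesced hc)

/-- The second moments of the two times are close. -/
lemma IsNoise.integral_couplingTime_sq_le (h : IsNoise G μ 𝓔 U) (H : IsTwoLevel G p q r)
    {s m : ℕ} (hm : 1 ≤ m) (hsm : s ≤ m) {ε : ℝ} (hε : ε ≤ 1 / 4)
    (htail : couponTail (Fintype.card G.edgeSet) m +
      2 * m * nearlyFullBound p (Fintype.card G.edgeSet) s ≤ ε) :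
    ∫ ω, (couplingTime G p q (fun i => 𝓔 i ω) (fun i => U i ω) : ℝ) ^ 2 ∂μ ≤
      ∫ ω, (couponTime G (fun i => 𝓔 i ω) : ℝ) ^ 2 ∂μ + (s : ℝ) ^ 2 +
      2 * s * (Fintype.card G.edgeSet * harm (Fintype.card G.edgeSet)) +
      8 * (m : ℝ) ^ 3 * nearlyFullBound p (Fintype.card G.edgeSet) s +
      128 * ε * (m : ℝ) ^ 2 := by
  have := h.isProbabilityMeasure
  have hp0 : 0 < p := H.pos.trans_le H.le
  have hp1 := sub_pos.mpr H.lt_one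
  have hδ : 0 ≤ nearlyFullBound p (Fintype.card G.edgeSet) s := by
    unfold nearlyFullBound; positivity
  have hw0 : ∀ r, 0 ≤ couponTail (Fintype.card G.edgeSet) r := fun r => by
    rw [← h.measureReal_not_covers]; exact measureReal_nonneg
  have hanti : ∀ {a b : ℕ}, a ≤ b → couponTail (Fintype.card G.edgeSet) b ≤
      couponTail (Fintype.card G.edgeSet) a := by
    intro a b hab
    rw [← h.measureReal_not_covers, ← h.measureReal_not_covers]
    exact measureReal_mono fun ω hω hc => hω (hc.mono hab)
  have hε0 : 0 ≤ ε := (add_nonneg (hw0 m) (by positivity)).trans htail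
  -- A block of `2 m` steps has room for a burn-in of `s ≤ m` steps and at least `m` further
  -- updates, so its failure probability is at most `ε`, uniformly in its starting time.
  have hblock : ∀ t, μ.real {ω |
      topChain G p q (fun i => 𝓔 (t + i) ω) (fun i => U (t + i) ω) (2 * m) ≠
      bottomChain G p q (fun i => 𝓔 (t + i) ω) (fun i => U (t + i) ω) (2 * m)} ≤ ε := by
    intro t
    have h1 := (h.shift t).measureReal_not_coalesced_le H s (2 * m - s)
    rw [Nat.add_sub_cancel' (by omega)] at h1
    refine h1.trans (le_trans ?_ htail)
    have h2 : ((2 * m - s : ℕ) : ℝ) ≤ 2 * m := by exact_mod_cast (by omega : 2 * m - s ≤ 2 * m)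
    exact add_le_add (hanti (by omega)) (mul_le_mul_of_nonneg_right h2 hδ)
  rw [h.couponTime_moments.2.2.2]
  exact tsum_weighted_le (a := fun t => μ.real {ω | ¬ topChain G p q (fun i => 𝓔 i ω)
      (fun i => U i ω) t = bottomChain G p q (fun i => 𝓔 i ω) (fun i => U i ω) t})
    (fun t => measureReal_le_one) h.antitone_not_coalesced hw0 hm hδ
    (fun r => h.measureReal_not_coalesced_le H s r) hε0 hε
    (fun k => h.measureReal_not_coalesced_mul_le H hblock k)
    (hasSum_couponTail _) (hasSum_mul_couponTail _) (h.couplingTime_moments H).2.2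

/-- The means are close once the second moments are. -/
lemma IsNoise.integral_sub_le (h : IsNoise G μ 𝓔 U) (H : IsTwoLevel G p q r) :
    ∫ ω, (couponTime G (fun i => 𝓔 i ω) : ℝ) ∂μ ≤
      ∫ ω, (couplingTime G p q (fun i => 𝓔 i ω) (fun i => U i ω) : ℝ) ∂μ ∧
    2 * Fintype.card G.edgeSet *
      (∫ ω, (couplingTime G p q (fun i => 𝓔 i ω) (fun i => U i ω) : ℝ) ∂μ -
        ∫ ω, (couponTime G (fun i => 𝓔 i ω) : ℝ) ∂μ) ≤
      ∫ ω, (couplingTime G p q (fun i => 𝓔 i ω) (fun i => U i ω) : ℝ) ^ 2 ∂μ -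
        ∫ ω, (couponTime G (fun i => 𝓔 i ω) : ℝ) ^ 2 ∂μ := by
  have := h.isProbabilityMeasure
  have hT := (h.couplingTime_moments (p := p) (q := q) H).2.1
  have hW := h.couponTime_moments.2.1
  have hT1 := hT.integrable one_le_two
  have hW1 := hW.integrable one_le_two
  have hle := h.couponTime_le_couplingTime (p := p) (q := q) H
  constructor
  · refine integral_mono_ae hW1 hT1 ?_
    filter_upwards [hle] with ω hω
    exact_mod_cast hω.2
  · rw [← integral_sub hT1 hW1, ← integral_const_mul, ← integral_sub hT.integrable_sq hW.integrable_sq]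
    refine integral_mono_ae ((hT1.sub hW1).const_mul _)
      (hT.integrable_sq.sub hW.integrable_sq) ?_
    filter_upwards [hle] with ω hω
    have h1 : (Fintype.card G.edgeSet : ℝ) ≤ couponTime G (fun i => 𝓔 i ω) := by
      exact_mod_cast hω.1
    have h2 : (couponTime G (fun i => 𝓔 i ω) : ℝ) ≤
        couplingTime G p q (fun i => 𝓔 i ω) (fun i => U i ω) := by exact_mod_cast hω.2
    -- `T² - W² = (T - W) (T + W)`, and both times are at least the number of edges.
    nlinarith

end Times
-- Asymptotics of the error terms, the mean and the variance
section Asymptotics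

lemma tendsto_nat_sqrt_atTop : Tendsto Nat.sqrt atTop atTop :=
  tendsto_atTop.mpr fun b => by
    filter_upwards [eventually_ge_atTop (b * b)] with L hL
    exact Nat.le_sqrt.mpr hL

/-- The probability of a nearly full configuration after `√L` steps decays faster than any
polynomial. -/
lemma tendsto_pow_mul_nearlyFullBound {p : ℝ} (hp : p ∈ Set.Ioo (0 : ℝ) 1) (k : ℕ) :
    Tendsto (fun L : ℕ => (L : ℝ) ^ k * nearlyFullBound p L (Nat.sqrt L)) atTop (𝓝 0) := by
  have h0 := hp.1
  have h1 := sub_pos.mpr hp.2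
  have hρ0 : 0 ≤ (3 + p) / 4 := by positivity
  have hρ1 : (3 + p) / 4 < 1 := by linarith
  have hθ0 : 0 ≤ (1 / 2 : ℝ) ^ ((1 - p) / 4) := by positivity
  have hθ1 : (1 / 2 : ℝ) ^ ((1 - p) / 4) < 1 :=
    Real.rpow_lt_one (by norm_num) (by norm_num) (by positivity)
  have a1 : Tendsto (fun L : ℕ => (L : ℝ) ^ k * ((3 + p) / 4) ^ Nat.sqrt L) atTop (𝓝 0) := by
    have h2 := ((tendsto_pow_const_mul_const_pow_of_abs_lt_one (2 * k)
      (by rwa [abs_of_nonneg hρ0])).comp tendsto_nat_sqrt_atTop).const_mul ((4 : ℝ) ^ k)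
    rw [mul_zero] at h2
    refine squeeze_zero' (Eventually.of_forall fun L => by positivity) ?_ h2
    filter_upwards [eventually_ge_atTop 1] with L hL
    have hs : 1 ≤ Nat.sqrt L := Nat.le_sqrt.mpr (by omega)
    -- Turns a power of `L` into a power of the exponent `Nat.sqrt L`, for which polynomial times
    -- exponential decay applies.
    have hle : L ≤ 4 * Nat.sqrt L ^ 2 := by
      have := Nat.sqrt_le_add L
      nlinarith
    have hle' : (L : ℝ) ≤ 4 * (Nat.sqrt L : ℝ) ^ 2 := by exact_mod_cast hle
    simp only [Function.comp]
    rw [← mul_assoc]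
    gcongr
    calc (L : ℝ) ^ k ≤ (4 * (Nat.sqrt L : ℝ) ^ 2) ^ k := by gcongr
      _ = _ := by rw [mul_pow, pow_mul]
  have a2 := tendsto_pow_const_mul_const_pow_of_abs_lt_one k
    (r := (1 / 2 : ℝ) ^ ((1 - p) / 4)) (by rwa [abs_of_nonneg hθ0])
  have a3 := (a1.add (a2.const_mul (8 / (1 - p)))).const_mul 2
  simp only [mul_zero, add_zero] at a3
  refine a3.congr fun L => ?_
  rw [nearlyFullBound, Real.rpow_mul (by norm_num), Real.rpow_natCast]
  ring

lemma tendsto_one_add_log_sq_div_sqrt :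
    Tendsto (fun L : ℕ => (1 + Real.log L) ^ 2 / Real.sqrt L) atTop (𝓝 0) := by
  have h1 : Tendsto (fun x : ℝ => Real.log x / x ^ (1 / 4 : ℝ)) atTop (𝓝 0) :=
    (isLittleO_log_rpow_atTop (by norm_num)).tendsto_div_nhds_zero
  have h2 : Tendsto (fun x : ℝ => 1 / x ^ (1 / 4 : ℝ)) atTop (𝓝 0) := by
    simp only [one_div]
    exact (tendsto_rpow_atTop (by norm_num)).inv_tendsto_atTop
  have h3 := ((h2.add h1).pow 2).comp tendsto_natCast_atTop_atTop
  simp only [add_zero, ne_eq, OfNat.ofNat_ne_zero, not_false_eq_true, zero_pow] at h3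
  refine h3.congr fun L => ?_
  simp only [Function.comp]
  rw [← add_div, div_pow, Real.sqrt_eq_rpow, ← Real.rpow_natCast ((L : ℝ) ^ (1 / 4 : ℝ)),
    ← Real.rpow_mul (by positivity)]
  norm_num

lemma harm_le_self {L : ℕ} (hL : 1 ≤ L) : harm L ≤ L := by
  have hL0 : (0 : ℝ) < L := by exact_mod_cast hL
  have := Real.log_le_sub_one_of_pos hL0
  linarith [harm_le L]

/-- The error in the comparison of the second moments is negligible. -/
lemma tendsto_second_moment_error {p : ℝ} (hp : p ∈ Set.Ioo (0 : ℝ) 1) :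
    Tendsto (fun L : ℕ => ((Nat.sqrt L : ℝ) ^ 2 + 2 * Nat.sqrt L * (L * harm L) +
      8 * ((L ^ 2 : ℕ) : ℝ) ^ 3 * nearlyFullBound p L (Nat.sqrt L) +
      128 * (L * Real.exp (-L) + 2 * ((L ^ 2 : ℕ) : ℝ) * nearlyFullBound p L (Nat.sqrt L)) *
        ((L ^ 2 : ℕ) : ℝ) ^ 2) * harm L / (L : ℝ) ^ 2) atTop (𝓝 0) := by
  -- The burn-in terms give the order `(log L) ^ 2 / √L`, which dominates. The coefficient `264 = 8
  -- + 2 * 128` collects the two terms in `L ^ 6 δ`.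
  have t1 := tendsto_one_add_log_sq_div_sqrt.const_mul 3
  have t2 := (tendsto_pow_mul_nearlyFullBound hp 6).const_mul 264
  have t3 := ((Real.tendsto_pow_mul_exp_neg_atTop_nhds_zero 5).comp
    (tendsto_natCast_atTop_atTop (R := ℝ))).const_mul 128
  have t := (t1.add t2).add t3
  simp only [mul_zero, add_zero] at t
  have h0 := hp.1
  have h1 := sub_pos.mpr hp.2
  have hδ0 : ∀ L, 0 ≤ nearlyFullBound p L (Nat.sqrt L) := fun L => by
    unfold nearlyFullBound; positivity
  refine squeeze_zero' ?_ ?_ t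
  · filter_upwards [eventually_ge_atTop 1] with L hL
    have h1 : 0 ≤ harm L := zero_le_one.trans (one_le_harm hL)
    have h2 := hδ0 L
    positivity
  · filter_upwards [eventually_ge_atTop 1] with L hL
    have hL1 : (1 : ℝ) ≤ L := by exact_mod_cast hL
    have hL0 : (0 : ℝ) < L := by linarith
    have hH1 := one_le_harm hL
    have hHL := harm_le_self hL
    have hHlog := harm_le L
    have hlog : 1 ≤ 1 + Real.log L := by linarith [Real.log_nonneg hL1]
    have hδ := hδ0 L
    set δ := nearlyFullBound p L (Nat.sqrt L)
    have hs : (Nat.sqrt L : ℝ) ≤ Real.sqrt L := Real.nat_sqrt_le_real_sqrt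
    have hr1 : 1 ≤ Real.sqrt L := Real.one_le_sqrt.mpr hL1
    have hrr : Real.sqrt L * Real.sqrt L = L := Real.mul_self_sqrt hL0.le
    have hHL2 : harm L / (L : ℝ) ^ 2 ≤ 1 := by
      rw [div_le_one (by positivity)]; nlinarith
    have hHL0 : 0 ≤ harm L / (L : ℝ) ^ 2 := by positivity
    have b1 : ((Nat.sqrt L : ℝ) ^ 2 + 2 * Nat.sqrt L * (L * harm L)) * (harm L / (L : ℝ) ^ 2) ≤
        3 * ((1 + Real.log L) ^ 2 / Real.sqrt L) := by
      have c1 : (Nat.sqrt L : ℝ) ^ 2 + 2 * Nat.sqrt L * (L * harm L) ≤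
          3 * Real.sqrt L * (L * harm L) := by
        have d1 : (Nat.sqrt L : ℝ) ^ 2 ≤ Real.sqrt L * (L * harm L) := by
          calc (Nat.sqrt L : ℝ) ^ 2 ≤ Real.sqrt L ^ 2 := by gcongr
            _ = (L : ℝ) * 1 := by rw [sq, hrr, mul_one]
            _ ≤ 1 * (L * harm L) := by rw [one_mul]; gcongr
            _ ≤ Real.sqrt L * (L * harm L) := by gcongr
        have d2 : 2 * Nat.sqrt L * (L * harm L) ≤ 2 * Real.sqrt L * (L * harm L) := by gcongr
        linarith
      calc _ ≤ 3 * Real.sqrt L * (L * harm L) * (harm L / (L : ℝ) ^ 2) := by gcongr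
        _ = 3 * harm L ^ 2 * (Real.sqrt L / L) := by field_simp
        _ = 3 * (harm L ^ 2 / Real.sqrt L) := by rw [Real.sqrt_div_self']; ring
        _ ≤ _ := by gcongr
    have b2 : (8 * ((L ^ 2 : ℕ) : ℝ) ^ 3 * δ + 128 * (L * Real.exp (-L) +
        2 * ((L ^ 2 : ℕ) : ℝ) * δ) * ((L ^ 2 : ℕ) : ℝ) ^ 2) * (harm L / (L : ℝ) ^ 2) ≤
        264 * ((L : ℝ) ^ 6 * δ) + 128 * ((L : ℝ) ^ 5 * Real.exp (-L)) := by
      calc _ ≤ (8 * ((L ^ 2 : ℕ) : ℝ) ^ 3 * δ + 128 * (L * Real.exp (-L) +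
            2 * ((L ^ 2 : ℕ) : ℝ) * δ) * ((L ^ 2 : ℕ) : ℝ) ^ 2) * 1 := by gcongr
        _ = _ := by push_cast; ring
    simp only [Function.comp]
    calc _ = ((Nat.sqrt L : ℝ) ^ 2 + 2 * Nat.sqrt L * (L * harm L)) * (harm L / (L : ℝ) ^ 2) +
        (8 * ((L ^ 2 : ℕ) : ℝ) ^ 3 * δ + 128 * (L * Real.exp (-L) +
          2 * ((L ^ 2 : ℕ) : ℝ) * δ) * ((L ^ 2 : ℕ) : ℝ) ^ 2) * (harm L / (L : ℝ) ^ 2) := by ring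
      _ ≤ _ := by linarith

lemma tendsto_couponTail_error {p : ℝ} (hp : p ∈ Set.Ioo (0 : ℝ) 1) :
    Tendsto (fun L : ℕ => L * Real.exp (-L) +
      2 * ((L ^ 2 : ℕ) : ℝ) * nearlyFullBound p L (Nat.sqrt L)) atTop (𝓝 0) := by
  have t2 := (tendsto_pow_mul_nearlyFullBound hp 2).const_mul 2
  have t3 := (Real.tendsto_pow_mul_exp_neg_atTop_nhds_zero 1).comp
    (tendsto_natCast_atTop_atTop (R := ℝ))
  have t := t3.add t2
  simp only [mul_zero, add_zero] at t
  refine t.congr fun L => ?_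
  simp only [Function.comp]
  push_cast; ring

lemma tendsto_harm_atTop : Tendsto harm atTop atTop := by
  have h := tendsto_harm_sub_log.add_atTop
    (Real.tendsto_log_atTop.comp (tendsto_natCast_atTop_atTop (R := ℝ)))
  refine h.congr fun L => ?_
  simp

lemma tendsto_couponVariance :
    Tendsto (fun L : ℕ => ((L : ℝ) ^ 2 * harmSq L - L * harm L) / (L : ℝ) ^ 2) atTop
      (𝓝 (Real.pi ^ 2 / 6)) := by
  have h1 : Tendsto (fun L : ℕ => harm L / (L : ℝ)) atTop (𝓝 0) := by
    have h2 : Tendsto (fun L : ℕ => (harm L - Real.log L) * (1 / (L : ℝ)) + Real.log L / L) atTop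
        (𝓝 (Real.eulerMascheroniConstant * 0 + 0)) :=
      (tendsto_harm_sub_log.mul tendsto_one_div_atTop_nhds_zero_nat).add
        ((Real.isLittleO_log_id_atTop.tendsto_div_nhds_zero).comp tendsto_natCast_atTop_atTop)
    rw [mul_zero, add_zero] at h2
    refine h2.congr fun L => ?_
    ring
  have h3 := tendsto_harmSq.sub h1
  rw [sub_zero] at h3
  refine h3.congr' ?_
  filter_upwards [eventually_ge_atTop 1] with L hL
  have hL0 : (L : ℝ) ≠ 0 := by exact_mod_cast (by omega : L ≠ 0)
  field_simp

variable {m₁ m₂ R : ℕ → ℝ}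

/-- If the first moment is close to that of the coupon collector, then so is the centring. -/
lemma tendsto_mean_error
    (hle : ∀ᶠ L : ℕ in atTop, (L : ℝ) * harm L ≤ m₁ L)
    (hdiff : ∀ᶠ L : ℕ in atTop, 2 * (L : ℝ) * (m₁ L - L * harm L) ≤ R L)
    (hR : Tendsto (fun L : ℕ => R L * harm L / (L : ℝ) ^ 2) atTop (𝓝 0)) :
    Tendsto (fun L : ℕ => (m₁ L - L * harm L) / L * harm L) atTop (𝓝 0) := by
  refine squeeze_zero' ?_ ?_ hR
  · filter_upwards [hle, eventually_ge_atTop 1] with L h1 hL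
    have h2 := one_le_harm hL
    have h3 : 0 ≤ m₁ L - L * harm L := by linarith
    positivity
  · filter_upwards [hle, hdiff, eventually_ge_atTop 1] with L h1 h2 hL
    have hL0 : (0 : ℝ) < L := by exact_mod_cast hL
    have h3 := one_le_harm hL
    have h4 : 0 ≤ m₁ L - L * harm L := by linarith
    have h5 : L * (m₁ L - L * harm L) ≤ R L := by
      have := mul_nonneg hL0.le h4
      linarith
    calc (m₁ L - L * harm L) / L * harm L
        = (L * (m₁ L - L * harm L)) * (harm L / (L : ℝ) ^ 2) := by field_simp
      _ ≤ R L * (harm L / (L : ℝ) ^ 2) := by gcongr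
      _ = _ := by ring

lemma tendsto_zero_of_mul_harm {d : ℕ → ℝ} (h : Tendsto (fun L => d L * harm L) atTop (𝓝 0)) :
    Tendsto d atTop (𝓝 0) := by
  have h1 := h.mul tendsto_harm_atTop.inv_tendsto_atTop
  rw [zero_mul] at h1
  refine h1.congr' ?_
  filter_upwards [eventually_ge_atTop 1] with L hL
  have : harm L ≠ 0 := (zero_lt_one.trans_le (one_le_harm hL)).ne'
  simp only [Pi.inv_apply]
  field_simp

/-- With `d = m₁ L - L * harm L`, the variance differs from that of the coupon collector by the
second-moment error minus `2 L (harm L) d + d ^ 2`. After division by `L ^ 2` the cross term is `2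
(harm L) d / L`; this is why errors must vanish even when multiplied by `harm L`. -/
lemma tendsto_variance
    (hle : ∀ᶠ L : ℕ in atTop, (L : ℝ) * harm L ≤ m₁ L)
    (hdiff : ∀ᶠ L : ℕ in atTop, 2 * (L : ℝ) * (m₁ L - L * harm L) ≤
      m₂ L - ((L : ℝ) ^ 2 * (harm L ^ 2 + harmSq L) - L * harm L))
    (hsq : ∀ᶠ L : ℕ in atTop,
      m₂ L ≤ ((L : ℝ) ^ 2 * (harm L ^ 2 + harmSq L) - L * harm L) + R L)
    (hR : Tendsto (fun L : ℕ => R L * harm L / (L : ℝ) ^ 2) atTop (𝓝 0)) :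
    Tendsto (fun L : ℕ => (m₂ L - m₁ L ^ 2) / (L : ℝ) ^ 2) atTop (𝓝 (Real.pi ^ 2 / 6)) := by
  have hd2 : ∀ᶠ L : ℕ in atTop, 2 * (L : ℝ) * (m₁ L - L * harm L) ≤ R L := by
    filter_upwards [hdiff, hsq] with L h1 h2
    linarith
  have hx := tendsto_mean_error hle hd2 hR
  have hd := tendsto_zero_of_mul_harm hx
  have hΔ : Tendsto (fun L : ℕ =>
      (m₂ L - ((L : ℝ) ^ 2 * (harm L ^ 2 + harmSq L) - L * harm L)) / (L : ℝ) ^ 2) atTop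
      (𝓝 0) := by
    have hR' : Tendsto (fun L : ℕ => R L / (L : ℝ) ^ 2) atTop (𝓝 0) :=
      tendsto_zero_of_mul_harm (hR.congr fun L => by ring)
    refine squeeze_zero' ?_ ?_ hR'
    · filter_upwards [hle, hdiff] with L h1 h2
      have : 0 ≤ 2 * (L : ℝ) * (m₁ L - L * harm L) := mul_nonneg (by positivity) (by linarith)
      exact div_nonneg (by linarith) (by positivity)
    · filter_upwards [hsq] with L h1
      gcongr
      linarith
  have h := ((tendsto_couponVariance.add hΔ).sub (hx.const_mul 2)).sub (hd.pow 2)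
  simp only [add_zero, mul_zero, sub_zero, ne_eq, OfNat.ofNat_ne_zero, not_false_eq_true,
    zero_pow] at h
  refine h.congr' ?_
  filter_upwards [eventually_ge_atTop 1] with L hL
  have hL0 : (L : ℝ) ≠ 0 := by exact_mod_cast (by omega : L ≠ 0)
  field_simp
  ring

/-- Rounding and a burn-in of `o(L)` steps do not move a threshold inside a window of width `L`. -/
lemma tendsto_floor_div_sub_log {a : ℕ → ℝ} {y : ℝ} {s : ℕ → ℕ}
    (hs : Tendsto (fun L : ℕ => (s L : ℝ) / L) atTop (𝓝 0))
    (ha : Tendsto (fun L : ℕ => a L / L - Real.log L) atTop (𝓝 y)) :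
    Tendsto (fun L : ℕ => ((⌊a L⌋₊ - s L : ℕ) : ℝ) / L - Real.log L) atTop (𝓝 y) ∧
      ∀ᶠ L : ℕ in atTop, s L ≤ ⌊a L⌋₊ ∧ (⌊a L⌋₊ : ℝ) ≤ (L : ℝ) ^ 2 ∧ 0 ≤ a L := by
  have hlog : Tendsto (fun L : ℕ => Real.log L) atTop atTop :=
    Real.tendsto_log_atTop.comp tendsto_natCast_atTop_atTop
  have hbig : Tendsto (fun L : ℕ => a L / L) atTop atTop :=
    (ha.add_atTop hlog).congr fun L => by ring
  have hsmall : Tendsto (fun L : ℕ => a L / (L : ℝ) ^ 2) atTop (𝓝 0) := by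
    have h2 : Tendsto (fun L : ℕ => (a L / L - Real.log L) * (1 / (L : ℝ)) + Real.log L / L) atTop
        (𝓝 (y * 0 + 0)) :=
      (ha.mul tendsto_one_div_atTop_nhds_zero_nat).add
        ((Real.isLittleO_log_id_atTop.tendsto_div_nhds_zero).comp tendsto_natCast_atTop_atTop)
    rw [mul_zero, add_zero] at h2
    refine h2.congr fun L => ?_
    ring
  have hev : ∀ᶠ L : ℕ in atTop, s L ≤ ⌊a L⌋₊ ∧ (⌊a L⌋₊ : ℝ) ≤ (L : ℝ) ^ 2 ∧ 0 ≤ a L := by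
    filter_upwards [hbig.eventually_ge_atTop 1, hs.eventually_lt_const zero_lt_one,
      hsmall.eventually_lt_const zero_lt_one, eventually_ge_atTop 1] with L h1 h2 h3 hL
    have hL0 : (0 : ℝ) < L := by exact_mod_cast hL
    rw [le_div_iff₀ hL0, one_mul] at h1
    rw [div_lt_one hL0] at h2
    rw [div_lt_one (by positivity)] at h3
    have ha0 : 0 ≤ a L := by linarith
    exact ⟨Nat.le_floor (by linarith), (Nat.floor_le ha0).trans h3.le, ha0⟩
  refine ⟨?_, hev⟩
  have hone := tendsto_one_div_atTop_nhds_zero_nat (𝕜 := ℝ)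
  have hlow : Tendsto (fun L : ℕ => (a L / L - Real.log L) - 1 / (L : ℝ) - (s L : ℝ) / L) atTop
      (𝓝 y) := by
    have := (ha.sub hone).sub hs
    simpa using this
  refine tendsto_of_tendsto_of_tendsto_of_le_of_le' hlow ha ?_ ?_
  · filter_upwards [hev, eventually_ge_atTop 1] with L h1 hL
    have hL0 : (0 : ℝ) < L := by exact_mod_cast hL
    have h2 := Nat.lt_floor_add_one (a L)
    rw [Nat.cast_sub h1.1]
    have h3 : (a L - 1 - s L) / L ≤ ((⌊a L⌋₊ : ℝ) - s L) / L := by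
      gcongr
      linarith
    have h4 : (a L - 1 - s L) / L = a L / L - 1 / L - s L / L := by ring
    linarith
  · filter_upwards [hev, eventually_ge_atTop 1] with L h1 hL
    have hL0 : (0 : ℝ) < L := by exact_mod_cast hL
    have h2 := Nat.floor_le h1.2.2
    rw [Nat.cast_sub h1.1]
    have h3 : ((⌊a L⌋₊ : ℝ) - s L) / L ≤ a L / L := by
      gcongr
      have : (0 : ℝ) ≤ s L := by positivity
      linarith
    linarith

end Asymptotics
-- The coupling tail at times of order `L log L`
section Relaxation

/-- For large `L` the coupling tail after `O(L log L)` steps bounds the relaxation time. -/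
lemma eventually_relaxation_tail {p : ℝ} (hp : p ∈ Set.Ioo (0 : ℝ) 1) :
    ∀ᶠ L : ℕ in atTop, ∃ m : ℕ, 1 ≤ m ∧
      L * Real.exp (-((m : ℝ) / L)) + m * nearlyFullBound p L (Nat.sqrt L) ≤
        Real.exp (-(1 / (4 * (L : ℝ)))) ^ (Nat.sqrt L + m) := by
  have t := (tendsto_pow_mul_nearlyFullBound hp 4).const_mul (3 * Real.exp 1 ^ 2)
  rw [mul_zero] at t
  filter_upwards [t.eventually_lt_const zero_lt_one, eventually_ge_atTop 3] with L h1 hL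
  have h0 := hp.1
  have h1p := sub_pos.mpr hp.2
  have hδ : 0 ≤ nearlyFullBound p L (Nat.sqrt L) := by
    unfold nearlyFullBound; positivity
  have hL3 : (3 : ℝ) ≤ L := by exact_mod_cast hL
  have hL0 : (0 : ℝ) < L := by linarith
  -- For `m = 3 l L` both summands are at most `exp (-2 l)`, so their sum is at most `exp (-l)`. The
  -- right side is at least `exp (-l)` because `√L + 3 l L ≤ 4 l L`. The logarithm in the time
  -- cancels that in the exponent, leaving the rate `1 / (4 L)`.
  set l := ⌈Real.log L⌉₊ with hl
  have hlog : 0 < Real.log L := Real.log_pos (by linarith)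
  have hl1 : 1 ≤ l := Nat.one_le_iff_ne_zero.mpr (Nat.ceil_pos.mpr hlog).ne'
  have hl1' : (1 : ℝ) ≤ l := by exact_mod_cast hl1
  have hle : Real.log L ≤ l := Nat.le_ceil _
  have hlt : (l : ℝ) < Real.log L + 1 := Nat.ceil_lt_add_one hlog.le
  have hLexp : (L : ℝ) ≤ Real.exp l := by
    rw [← Real.log_le_iff_le_exp hL0]; exact hle
  have hexpL : Real.exp l ≤ Real.exp 1 * L := by
    calc Real.exp l ≤ Real.exp (1 + Real.log L) := Real.exp_le_exp.mpr (by linarith)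
      _ = _ := by rw [Real.exp_add, Real.exp_log hL0]
  have hlL : (l : ℝ) ≤ L := by
    have := Real.log_le_sub_one_of_pos hL0
    linarith
  refine ⟨3 * l * L, ?_, ?_⟩
  · have : 1 ≤ l * L := Nat.mul_pos (by omega) (by omega)
    nlinarith
  · have c1 : L * Real.exp (-(((3 * l * L : ℕ) : ℝ) / L)) ≤ Real.exp (-(2 * l)) := by
      calc L * Real.exp (-(((3 * l * L : ℕ) : ℝ) / L))
          ≤ Real.exp l * Real.exp (-(((3 * l * L : ℕ) : ℝ) / L)) := by gcongr
        _ = Real.exp (-(2 * l)) := by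
            rw [← Real.exp_add]
            congr 1
            push_cast
            field_simp
            ring
    have c2 : ((3 * l * L : ℕ) : ℝ) * nearlyFullBound p L (Nat.sqrt L) ≤ Real.exp (-(2 * l)) := by
      rw [Real.exp_neg, ← one_div, le_div_iff₀ (Real.exp_pos _)]
      have e1 : Real.exp (2 * l) ≤ (Real.exp 1 * L) ^ 2 := by
        rw [two_mul, Real.exp_add, sq]
        gcongr
      calc ((3 * l * L : ℕ) : ℝ) * nearlyFullBound p L (Nat.sqrt L) * Real.exp (2 * l)
          ≤ (3 * L * L) * nearlyFullBound p L (Nat.sqrt L) * (Real.exp 1 * L) ^ 2 := by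
            push_cast
            gcongr
        _ = 3 * Real.exp 1 ^ 2 * ((L : ℝ) ^ 4 * nearlyFullBound p L (Nat.sqrt L)) := by ring
        _ ≤ 1 := h1.le
    have c3 : 2 * Real.exp (-(2 * l)) ≤ Real.exp (-l) := by
      have e1 : Real.exp (-(2 * l)) = Real.exp (-l) * Real.exp (-l) := by
        rw [← Real.exp_add]; congr 1; ring
      have e2 : Real.exp (-l) ≤ 1 / 2 := by
        rw [Real.exp_neg, ← one_div]
        refine one_div_le_one_div_of_le two_pos ?_
        have := Real.add_one_le_exp (l : ℝ)
        linarith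
      rw [e1]
      nlinarith [Real.exp_pos (-(l : ℝ))]
    have c4 : Real.exp (-l) ≤ Real.exp (-(1 / (4 * (L : ℝ)))) ^ (Nat.sqrt L + 3 * l * L) := by
      rw [← Real.exp_nat_mul]
      refine Real.exp_le_exp.mpr ?_
      have e1 : ((Nat.sqrt L + 3 * l * L : ℕ) : ℝ) ≤ 4 * l * L := by
        have : Nat.sqrt L ≤ l * L := (Nat.sqrt_le_self L).trans (Nat.le_mul_of_pos_left _ hl1)
        have : Nat.sqrt L + 3 * l * L ≤ 4 * l * L := by nlinarith
        exact_mod_cast this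
      have e2 : ((Nat.sqrt L + 3 * l * L : ℕ) : ℝ) * (1 / (4 * (L : ℝ))) ≤ l := by
        rw [mul_one_div, div_le_iff₀ (by positivity)]
        linarith
      rw [mul_neg]
      linarith
    linarith

lemma one_div_one_sub_exp_le {L : ℝ} (hL : 1 ≤ L) :
    1 / (1 - Real.exp (-(1 / (4 * L)))) ≤ 8 * L := by
  set x := 1 / (4 * L) with hx
  have hL0 : 0 < L := by linarith
  have hx0 : 0 < x := by positivity
  have hx1 : x ≤ 1 := by rw [hx, div_le_one (by positivity)]; linarith
  have h1 : Real.exp (-x) ≤ 1 / (1 + x) := by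
    rw [Real.exp_neg, ← one_div]
    refine one_div_le_one_div_of_le (by linarith) ?_
    linarith [Real.add_one_le_exp x]
  have h2 : x / 2 ≤ 1 - Real.exp (-x) := by
    have h3 : 1 - 1 / (1 + x) = x / (1 + x) := by field_simp; ring
    have h4 : x / 2 ≤ x / (1 + x) := by gcongr; linarith
    linarith
  calc 1 / (1 - Real.exp (-x)) ≤ 1 / (x / 2) := one_div_le_one_div_of_le (by positivity) h2
    _ = 8 * L := by rw [hx]; field_simp; norm_num

end Relaxation

lemma card_cycleGraph_edgeSet {L : ℕ} (hL : 3 ≤ L) :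
    Fintype.card (SimpleGraph.cycleGraph L).edgeSet = L := by
  obtain ⟨n, rfl⟩ : ∃ n, L = n + 3 := ⟨L - 3, by omega⟩
  exact card_cycle_edgeSet

lemma nonempty_cycleGraph_edgeSet {L : ℕ} (hL : 3 ≤ L) :
    Nonempty (SimpleGraph.cycleGraph L).edgeSet := by
  rw [← Fintype.card_pos_iff, card_cycleGraph_edgeSet hL]
  omega

end FK

/-! ### Proof of the main theorem -/

/-- For every `L ≥ 3` the noise `(𝓔 L t, U L t)` drives the FK heat-bath coupling on the cycle with
`L` vertices; `T L` is its coupling time and `W L` the coupon collector time of its edge process. -/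
theorem theorem2 (p q : ℝ) (hp : p ∈ Set.Ioo (0 : ℝ) 1) (hq : 1 ≤ q)
    (Ω : ℕ → Type*) [∀ L, MeasurableSpace (Ω L)] (μ : ∀ L, Measure (Ω L))
    (𝓔 : ∀ L, ℕ → Ω L → (SimpleGraph.cycleGraph L).edgeSet) (U : ∀ L, ℕ → Ω L → ℝ)
    (hnoise : ∀ L, 3 ≤ L → FK.IsNoise (SimpleGraph.cycleGraph L) (μ L) (𝓔 L) (U L))
    (T W : ∀ L, Ω L → ℝ)
    (hT : ∀ L ω, T L ω =
      (FK.couplingTime (SimpleGraph.cycleGraph L) p q (fun t => 𝓔 L t ω) (fun t => U L t ω) : ℝ))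
    (hW : ∀ L ω, W L ω =
      (FK.couponTime (SimpleGraph.cycleGraph L) (fun t => 𝓔 L t ω) : ℝ)) :
    -- almost surely the two times are finite, and they have finite second moments
    (∀ L, 3 ≤ L →
      (∀ᵐ ω ∂(μ L), ∃ t : ℕ,
        FK.topChain (SimpleGraph.cycleGraph L) p q (fun t => 𝓔 L t ω) (fun t => U L t ω) t =
          FK.bottomChain (SimpleGraph.cycleGraph L) p q
            (fun t => 𝓔 L t ω) (fun t => U L t ω) t) ∧
      (∀ᵐ ω ∂(μ L), ∃ t : ℕ, 1 ≤ t ∧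
        (Finset.range t).image (fun t => 𝓔 L t ω) = Finset.univ) ∧
      MemLp (T L) 2 (μ L) ∧ MemLp (W L) 2 (μ L)) ∧
    -- the mean
    ((fun L => ∫ ω, T L ω ∂(μ L)) ~[atTop] (fun L => ∫ ω, W L ω ∂(μ L))) ∧
    -- the variance
    ((fun L => variance (T L) (μ L)) ~[atTop] (fun L => variance (W L) (μ L))) ∧
    -- the limit law
    (∀ x : ℝ, Tendsto
      (fun L => (μ L).real
        {ω | T L ω ≤ (∫ ω', T L ω' ∂(μ L)) + x * Real.sqrt (variance (T L) (μ L))})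
      atTop (𝓝 (FK.gumbelCDF x))) ∧
    -- the relaxation time
    (∃ c C : ℝ, 0 < c ∧ 0 < C ∧ ∀ᶠ L : ℕ in atTop,
      c * (L : ℝ) ≤ FK.relaxationTime (SimpleGraph.cycleGraph L) p q ∧
        FK.relaxationTime (SimpleGraph.cycleGraph L) p q ≤ C * (L : ℝ)) := by
  have hp0 := hp.1
  have hp1 := sub_pos.mpr hp.2
  have hq0 : 0 < q := by linarith
  -- facts for each length
  have hcard : ∀ L, 3 ≤ L → Fintype.card (SimpleGraph.cycleGraph L).edgeSet = L := fun L hL =>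
    FK.card_cycleGraph_edgeSet hL
  have hne : ∀ L, 3 ≤ L → Nonempty (SimpleGraph.cycleGraph L).edgeSet := fun L hL =>
    FK.nonempty_cycleGraph_edgeSet hL
  have hlev : ∀ L, 3 ≤ L → FK.IsTwoLevel (SimpleGraph.cycleGraph L) p q (FK.bridgeProb p q) :=
    fun L hL => FK.isTwoLevel_cycleGraph hp hq hL
  have hTf : ∀ L, T L = fun ω => (FK.couplingTime (SimpleGraph.cycleGraph L) p q
    (fun t => 𝓔 L t ω) (fun t => U L t ω) : ℝ) := fun L => funext (hT L)
  have hWf : ∀ L, W L = fun ω => (FK.couponTime (SimpleGraph.cycleGraph L)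
    (fun t => 𝓔 L t ω) : ℝ) := fun L => funext (hW L)
  have hTmem : ∀ L, 3 ≤ L → MemLp (T L) 2 (μ L) := by
    intro L hL
    have := hne L hL
    rw [hTf]
    exact ((hnoise L hL).couplingTime_moments (hlev L hL)).2.1
  have hWmom : ∀ L, 3 ≤ L → MemLp (W L) 2 (μ L) ∧ ∫ ω, W L ω ∂(μ L) = L * FK.harm L ∧
      ∫ ω, W L ω ^ 2 ∂(μ L) =
        (L : ℝ) ^ 2 * (FK.harm L ^ 2 + FK.harmSq L) - L * FK.harm L := by
    intro L hL
    have := hne L hL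
    have h := (hnoise L hL).couponTime_moments.2
    rw [hcard L hL] at h
    rw [hWf]
    exact h
  have hvarT : ∀ L, 3 ≤ L → variance (T L) (μ L) =
      ∫ ω, T L ω ^ 2 ∂(μ L) - (∫ ω, T L ω ∂(μ L)) ^ 2 := by
    intro L hL
    have := (hnoise L hL).isProbabilityMeasure
    exact variance_eq_sub (hTmem L hL)
  have hvarW : ∀ L, 3 ≤ L → variance (W L) (μ L) = (L : ℝ) ^ 2 * FK.harmSq L - L * FK.harm L := by
    intro L hL
    have := (hnoise L hL).isProbabilityMeasure
    have h := variance_eq_sub (hWmom L hL).1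
    have h2 : (μ L)[W L ^ 2] = ∫ ω, W L ω ^ 2 ∂(μ L) := rfl
    rw [h, h2, (hWmom L hL).2.1, (hWmom L hL).2.2]
    ring
  set m₁ : ℕ → ℝ := fun L => ∫ ω, T L ω ∂(μ L) with hm₁
  set m₂ : ℕ → ℝ := fun L => ∫ ω, T L ω ^ 2 ∂(μ L) with hm₂
  -- The second-moment error for burn-in `√L` and block scale `L ^ 2`; at time `L ^ 2` the union
  -- bound for the coupon tail is `L exp (-L)`.
  set R : ℕ → ℝ := fun L => (Nat.sqrt L : ℝ) ^ 2 + 2 * Nat.sqrt L * (L * FK.harm L) +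
      8 * ((L ^ 2 : ℕ) : ℝ) ^ 3 * FK.nearlyFullBound p L (Nat.sqrt L) +
      128 * (L * Real.exp (-L) + 2 * ((L ^ 2 : ℕ) : ℝ) * FK.nearlyFullBound p L (Nat.sqrt L)) *
        ((L ^ 2 : ℕ) : ℝ) ^ 2 with hRdef
  have hR : Tendsto (fun L : ℕ => R L * FK.harm L / (L : ℝ) ^ 2) atTop (𝓝 0) :=
    FK.tendsto_second_moment_error hp
  have hmean : ∀ L : ℕ, 3 ≤ L → (L : ℝ) * FK.harm L ≤ m₁ L ∧
      2 * (L : ℝ) * (m₁ L - L * FK.harm L) ≤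
        m₂ L - ((L : ℝ) ^ 2 * (FK.harm L ^ 2 + FK.harmSq L) - L * FK.harm L) := by
    intro L hL
    have := hne L hL
    have h := (hnoise L hL).integral_sub_le (hlev L hL)
    simp only [← hT, ← hW] at h
    rw [hcard L hL, (hWmom L hL).2.1, (hWmom L hL).2.2] at h
    exact h
  have hle : ∀ᶠ L : ℕ in atTop, (L : ℝ) * FK.harm L ≤ m₁ L := by
    filter_upwards [eventually_ge_atTop 3] with L hL using (hmean L hL).1
  have hdiff : ∀ᶠ L : ℕ in atTop, 2 * (L : ℝ) * (m₁ L - L * FK.harm L) ≤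
      m₂ L - ((L : ℝ) ^ 2 * (FK.harm L ^ 2 + FK.harmSq L) - L * FK.harm L) := by
    filter_upwards [eventually_ge_atTop 3] with L hL using (hmean L hL).2
  have hsq : ∀ᶠ L : ℕ in atTop,
      m₂ L ≤ ((L : ℝ) ^ 2 * (FK.harm L ^ 2 + FK.harmSq L) - L * FK.harm L) + R L := by
    filter_upwards [eventually_ge_atTop 3, (FK.tendsto_couponTail_error hp).eventually_le_const
      (show (0 : ℝ) < 1 / 4 by norm_num)] with L hL hsmall
    have := hne L hL
    have hL0 : (L : ℝ) ≠ 0 := by exact_mod_cast (by omega : L ≠ 0)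
    have htail := (hnoise L hL).couponTail_le (L ^ 2)
    rw [hcard L hL] at htail
    have e0 : ((L ^ 2 : ℕ) : ℝ) / L = L := by push_cast; field_simp
    rw [e0] at htail
    have h := (hnoise L hL).integral_couplingTime_sq_le (hlev L hL) (s := Nat.sqrt L) (m := L ^ 2)
      (Nat.one_le_pow _ _ (by omega))
      ((Nat.sqrt_le_self L).trans (Nat.le_self_pow two_ne_zero L)) hsmall
      (by rw [hcard L hL]; gcongr)
    simp only [← hT, ← hW] at h
    rw [(hWmom L hL).2.2, hcard L hL] at h
    simp only [hm₂, hRdef]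
    linarith
  have hd2 : ∀ᶠ L : ℕ in atTop, 2 * (L : ℝ) * (m₁ L - L * FK.harm L) ≤ R L := by
    filter_upwards [hdiff, hsq] with L h1 h2
    linarith
  have hd := FK.tendsto_zero_of_mul_harm (FK.tendsto_mean_error hle hd2 hR)
  have hvar := FK.tendsto_variance hle hdiff hsq hR
  refine ⟨fun L hL => ?_, ?_, ?_, fun x => ?_, ?_⟩
  · have := hne L hL
    refine ⟨((hnoise L hL).couplingTime_moments (hlev L hL)).1, ?_, hTmem L hL, (hWmom L hL).1⟩
    filter_upwards [(hnoise L hL).couponTime_moments.1] with ω hω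
    obtain ⟨t, ht⟩ := hω
    refine ⟨t, ?_, ht⟩
    by_contra! h0
    obtain rfl : t = 0 := by omega
    exact FK.not_covers_zero _ ht
  · have h1 : Tendsto (fun L : ℕ => 1 + (m₁ L - L * FK.harm L) / L * (FK.harm L)⁻¹) atTop
        (𝓝 (1 + 0 * 0)) :=
      tendsto_const_nhds.add (hd.mul FK.tendsto_harm_atTop.inv_tendsto_atTop)
    rw [mul_zero, add_zero] at h1
    refine Asymptotics.isEquivalent_of_tendsto_one (h1.congr' ?_)
    filter_upwards [eventually_ge_atTop 3] with L hL
    have hL0 : (L : ℝ) ≠ 0 := by exact_mod_cast (by omega : L ≠ 0)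
    have hH : FK.harm L ≠ 0 := (zero_lt_one.trans_le (FK.one_le_harm (by omega))).ne'
    simp only [Pi.div_apply]
    rw [(hWmom L hL).2.1]
    change _ = m₁ L / _
    field_simp
    ring
  · have hpi : Real.pi ^ 2 / 6 ≠ 0 := by positivity
    have h1 := hvar.div FK.tendsto_couponVariance hpi
    rw [div_self hpi] at h1
    refine Asymptotics.isEquivalent_of_tendsto_one (h1.congr' ?_)
    filter_upwards [eventually_ge_atTop 3] with L hL
    have hL0 : (L : ℝ) ^ 2 ≠ 0 := by
      have : (L : ℝ) ≠ 0 := by exact_mod_cast (by omega : L ≠ 0)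
      positivity
    simp only [Pi.div_apply]
    rw [hvarT L hL, hvarW L hL, div_div_div_cancel_right₀ hL0]
  · set a : ℕ → ℝ := fun L => m₁ L + x * Real.sqrt (variance (T L) (μ L)) with ha
    have hsd : Tendsto (fun L : ℕ => Real.sqrt (variance (T L) (μ L)) / L) atTop
        (𝓝 (Real.pi / Real.sqrt 6)) := by
      have h1 := (Real.continuous_sqrt.tendsto _).comp hvar
      rw [Real.sqrt_div (by positivity), Real.sqrt_sq Real.pi_pos.le] at h1
      refine h1.congr' ?_
      filter_upwards [eventually_ge_atTop 3] with L hL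
      simp only [Function.comp]
      rw [Real.sqrt_div' _ (by positivity), Real.sqrt_sq (by positivity), hvarT L hL]
    have hay : Tendsto (fun L : ℕ => a L / L - Real.log L) atTop
        (𝓝 (Real.eulerMascheroniConstant + x * (Real.pi / Real.sqrt 6))) := by
      have h1 := (FK.tendsto_harm_sub_log.add hd).add (hsd.const_mul x)
      rw [add_zero] at h1
      refine h1.congr' ?_
      filter_upwards [eventually_ge_atTop 3] with L hL
      have hL0 : (L : ℝ) ≠ 0 := by exact_mod_cast (by omega : L ≠ 0)
      simp only [ha]
      field_simp
      ring
    have hG : FK.gumbelCDF x = Real.exp (-Real.exp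
        (-(Real.eulerMascheroniConstant + x * (Real.pi / Real.sqrt 6)))) := by
      rw [FK.gumbelCDF]
      congr 3
      ring
    rw [hG]
    have hs0 : Tendsto (fun L : ℕ => (Nat.sqrt L : ℝ) / L) atTop (𝓝 0) := by
      have h1 : Tendsto (fun L : ℕ => (Real.sqrt L)⁻¹) atTop (𝓝 0) :=
        (Real.tendsto_sqrt_atTop.comp tendsto_natCast_atTop_atTop).inv_tendsto_atTop
      refine squeeze_zero (fun L => by positivity) (fun L => ?_) h1
      rw [← one_div, ← Real.sqrt_div_self']
      gcongr
      exact Real.nat_sqrt_le_real_sqrt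
    -- The distribution function is squeezed between two coupon collector probabilities: with
    -- burn-in `√L` removed for the lower bound, and with no shift, from `T ≥ W`, for the upper
    -- bound. Both have the same limit.
    obtain ⟨hlow, hev⟩ := FK.tendsto_floor_div_sub_log hs0 hay
    obtain ⟨hup, -⟩ := FK.tendsto_floor_div_sub_log (s := fun _ => 0) (by simp) hay
    have g1 := FK.tendsto_one_sub_couponTail hlow
    have g2 := FK.tendsto_one_sub_couponTail hup
    have g3 := FK.tendsto_pow_mul_nearlyFullBound hp 2
    have g4 := g1.sub g3
    rw [sub_zero] at g4
    have hprob : ∀ᶠ L : ℕ in atTop, (μ L).real {ω | T L ω ≤ a L} =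
        1 - (μ L).real {ω | FK.topChain (SimpleGraph.cycleGraph L) p q (fun t => 𝓔 L t ω)
          (fun t => U L t ω) ⌊a L⌋₊ ≠ FK.bottomChain (SimpleGraph.cycleGraph L) p q
          (fun t => 𝓔 L t ω) (fun t => U L t ω) ⌊a L⌋₊} := by
      filter_upwards [hev, eventually_ge_atTop 3] with L h1 hL
      have := hne L hL
      rw [← (hnoise L hL).measureReal_couplingTime_le (hlev L hL) h1.2.2]
      simp only [hT]
    refine tendsto_of_tendsto_of_tendsto_of_le_of_le' g4 g2 ?_ ?_
    · filter_upwards [hprob, hev, eventually_ge_atTop 3] with L h1 h2 hL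
      have := hne L hL
      change _ ≤ (μ L).real {ω | T L ω ≤ a L}
      rw [h1]
      have h3 := (hnoise L hL).measureReal_not_coalesced_le (hlev L hL) (Nat.sqrt L)
        (⌊a L⌋₊ - Nat.sqrt L)
      rw [Nat.add_sub_cancel' h2.1, hcard L hL] at h3
      have hδ : 0 ≤ FK.nearlyFullBound p L (Nat.sqrt L) := by
        unfold FK.nearlyFullBound; positivity
      have h4 : ((⌊a L⌋₊ - Nat.sqrt L : ℕ) : ℝ) ≤ (L : ℝ) ^ 2 :=
        (Nat.cast_le.mpr (Nat.sub_le _ _)).trans h2.2.1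
      have h5 := mul_le_mul_of_nonneg_right h4 hδ
      linarith
    · filter_upwards [hprob, eventually_ge_atTop 3] with L h1 hL
      have := hne L hL
      change (μ L).real {ω | T L ω ≤ a L} ≤ _
      rw [h1]
      have h3 := (hnoise L hL).couponTail_le_measureReal (p := p) (q := q) ⌊a L⌋₊
      rw [hcard L hL] at h3
      rw [Nat.sub_zero]
      linarith
  -- The test function gives the constant `1`. Eigenvalues other than `1` are at most `exp (-1 / (4
  -- L))`, and `1 - exp (-x) ≥ x / 2` on `(0, 1]` yields `8`.
  · refine ⟨1, 8, one_pos, by norm_num, ?_⟩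
    filter_upwards [FK.eventually_relaxation_tail hp, eventually_ge_atTop 3] with L h1 hL
    have := hne L hL
    obtain ⟨m, hm, htail⟩ := h1
    have hL1 : (1 : ℝ) ≤ L := by exact_mod_cast (by omega : 1 ≤ L)
    have h2 := (hnoise L hL).measureReal_not_coalesced_le (hlev L hL) (Nat.sqrt L) m
    have h3 := (hnoise L hL).couponTail_le m
    rw [hcard L hL] at h2 h3
    have h4 := (hnoise L hL).relaxationTime_bounds (hlev L hL) hq0
      (θ := Real.exp (-(1 / (4 * (L : ℝ))))) (Real.exp_pos _).le
      (Real.exp_lt_one_iff.mpr (by rw [neg_lt_zero]; positivity)) (n := Nat.sqrt L + m) (by omega)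
      (by linarith)
    rw [hcard L hL] at h4
    exact ⟨by rw [one_mul]; exact h4.1, h4.2.trans (FK.one_div_one_sub_exp_le hL1)⟩
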